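/- Let $G$ and $T$ be (finite-dimensional, second countable, Hausdorff, real) Lie groups with $T$ abelian, with Lie algebras $\mathfrak g,\mathfrak t$, and let $(\mathcal G,m,\alpha)$ be a multiplicative $T$-gerbe over $G$: a $T$-gerbe $\mathcal G\to G$, an isomorphism $m:g_1^*\mathcal G\otimes g_2^*\mathcal G\to(g_1g_2)^*\mathcal G$ of gerbes over $G^2$ and a 2-isomorphism $\alpha$ over $G^3$ (the associator) satisfying the pentagon identity over $G^4$. Fix a connective structure on it, i.e. a connective structure on the gerbe $\mathcal G\to G$ and a connection $\nabla_m$ on $m$ such that $\alpha$ is flat. Let $(P,\mathcal P,\rho,\alpha^\rho)$ be a principal $\mathcal G$-bundle over a manifold $M$: a principal $G$-bundle $\pi:P\to M$, a $T$-gerbe $\mathcal P\to P$, an isomorphism $\rho:p^*\mathcal P\otimes g^*\mathcal G\to(pg)^*\mathcal P$ of gerbes over $P\times G$ and a 2-isomorphism $\alpha^\rho$ over $P\times G^2$, compatible with $\alpha$ over $P\times G^3$. Gerbes, isomorphisms and 2-isomorphisms are given by smooth $T$-valued Čech cocycle data on semi-simplicial open covers of $(G^n)_{n\ge1}$ and of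 $(P\times G^n)_{n\ge0}$ (the second mapping to the first over the projections); connective structures on gerbes, connections on isomorphisms and curvings are given by $\mathfrak t$-valued 1-forms, 1-forms and 2-forms on the corresponding open sets. A connective structure on the $\mathcal G$-bundle is a pair $(\nabla,\nabla_\rho)$ of a connective structure $\nabla$ on the gerbe $\mathcal P\to P$ and a connection $\nabla_\rho$ on $\rho$ such that $\alpha^\rho$ is flat. An isomorphism $(\nabla_1,\nabla_{\rho_1})\to(\nabla_2,\nabla_{\rho_2})$ is an isomorphism $\phi:\nabla_1\to\nabla_2$ of connective structures on the gerbe $\mathcal P$ (a connection on the identity of $\mathcal P$) with $(pg)^*\phi\circ(\rho,\nabla_{\rho_1})=(\rho,\nabla_{\rho_2})\circ(p^*\phi\otimes\mathrm{id})$. Write $\theta^L,\theta^R$ for the Maurer–Cartan forms of $G$, and $\langle\alpha\wedge\beta\rangle(X,Y)=\langle\alpha(X),\beta(Y)\rangle-\langle\alpha(Y),\beta(X)\rangle$, $\langle\alpha\otimes\beta\rangle(X,Y)=\langle\alpha(X),\beta(Y)\rangle$. The Maurer–Cartan data of $\mathcal G$ consist of an $\mathrm{Ad}$-invariant symmetric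 bilinear form $\langle\,,\rangle:\mathfrak g\otimes\mathfrak g\to\mathfrak t$ and a curving $\Theta^L$ on $\mathcal G$ with respect to which $\nabla_m$ has curvature $-\langle g_1^*\theta^L\wedge g_2^*\theta^R\rangle$; put $\Theta^{L,en}=\Theta^L-\langle\theta^L\otimes\theta^L\rangle$. A connection with connective structure $(\nabla,\nabla_\rho)$ is a pair $(A,B)$ of a $G$-connection $A\in\Omega^1(P,\mathfrak g)$ and a curving $B$ of $\mathcal P$ such that $\nabla_\rho$ has curvature $-\langle p^*A\wedge g^*\theta^R\rangle$ with respect to $p^*B\otimes g^*\Theta^L$ and $(pg)^*B$. An enhanced connection is a pair $(A,B)$ of a $G$-connection $A$ and an enhanced curving $B$ (local sections of $T^*P\otimes T^*P\otimes\mathfrak t$ satisfying the equations of a curving) such that $\nabla_\rho$ has curvature $-2\langle p^*A\otimes g^*\theta^R\rangle$ with respect to $p^*B\otimes g^*\Theta^{L,en}$ and $(pg)^*B$. The corresponding sets are $\mathcal A(\mathcal P_\nabla)$ and $\mathcal A^{en}(\mathcal P_\nabla)$. Then: 1. Connective structures on $(P,\mathcal P,\rho,\alpha^\rho)$ exist and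 any two are isomorphic; the isomorphisms between two of them form a torsor for $\Omega^1(M,\mathfrak t)$, acting by $\phi\mapsto\phi+\pi^*\tau$. 2. The Maurer–Cartan data exist and are unique. The set $\Omega^1(\mathrm{ad}\,P)\times\Omega^2(M,\mathfrak t)$ is a group $\Omega^1(\mathrm{ad}\,P)\times_{\langle\,,\rangle}\Omega^2(M,\mathfrak t)$ under $(a_1,b_1)\cdot(a_2,b_2)=(a_1+a_2,\,b_1+b_2+\langle a_1\wedge a_2\rangle)$, in which $\Omega^2(M,\mathfrak t)$ is central. For every connective structure $(\nabla,\nabla_\rho)$, the set $\mathcal A(\mathcal P_\nabla)$ is a right torsor for this group, with $(A,B)\cdot(a,b)=(A+a,\,B+\langle A\wedge a\rangle+\pi^*b)$. In particular, for each $G$-connection $A$ on $P$ the set of connections in $\mathcal A(\mathcal P_\nabla)$ over $A$ is an affine space for $\Omega^2(M,\mathfrak t)$, acting by $B\mapsto B+\pi^*b$. 3. For every connective structure $(\nabla,\nabla_\rho)$, the set $\mathcal A^{en}(\mathcal P_\nabla)$ is a right torsor for $\big(\Omega^1(\mathrm{ad}\,P)\times_{\langle\,,\rangle}\Omega^2(M,\mathfrak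 t)\big)\times\Gamma(S^2T^*M\otimes\mathfrak t)$, with $(A,B)\cdot((a,b),k)=\big(A+a,\;B+\langle A\wedge a\rangle+\pi^*b+\langle A\otimes A\rangle-\langle(A+a)\otimes(A+a)\rangle+\pi^*k\big)$. In particular, for each $G$-connection $A$ on $P$ the set of enhanced connections in $\mathcal A^{en}(\mathcal P_\nabla)$ over $A$ is an affine space for $\Gamma(T^*M\otimes T^*M\otimes\mathfrak t)$, acting by $B\mapsto B+\pi^*b$. -/

import Mathlib

open scoped Manifold ContDiff
open Set

noncomputable section

namespace HigherGauge

/-! ### Tensor fields and differential forms with values in a vector space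

In Mathlib the tangent space `TangentSpace I x` of a manifold modelled on `E` is by definition a
copy of `E`.  Fields of covectors and of bilinear forms on `M` with values in `V` are therefore
functions `M → E →L[ℝ] V` and `M → E →L[ℝ] E →L[ℝ] V`.  In the same way the Lie algebra
`T₁ G` of a Lie group modelled on `E` is `E`. -/

section Forms

variable {E H E' H' : Type*}
  [NormedAddCommGroup E] [NormedSpace ℝ E] [TopologicalSpace H]
  [NormedAddCommGroup E'] [NormedSpace ℝ E'] [TopologicalSpace H']
  (I : ModelWithCorners ℝ E H) (J : ModelWithCorners ℝ E' H')
  {M N : Type*} [TopologicalSpace M] [ChartedSpace H M] [TopologicalSpace N] [ChartedSpace H' N]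
  {V : Type*} [NormedAddCommGroup V] [NormedSpace ℝ V]

/-- The differential of `f` at `x`, as a map between the model spaces. -/
def differential (f : M → N) (x : M) : E →L[ℝ] E' := mfderiv I J f x

/-- Pullback of a field of covectors. -/
def pullback₁ (f : M → N) (a : N → E' →L[ℝ] V) : M → E →L[ℝ] V :=
  fun x => (a (f x)).comp (differential I J f x)

/-- Pullback of a field of bilinear forms. -/
def pullback₂ (f : M → N) (B : N → E' →L[ℝ] E' →L[ℝ] V) : M → E →L[ℝ] E →L[ℝ] V :=
  fun x => (B (f x)).bilinearComp (differential I J f x) (differential I J f x)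

/-- Smoothness of a field of covectors on `U`: smoothness of its expression in every chart. -/
def SmoothOn₁ (U : Set M) (a : M → E →L[ℝ] V) : Prop :=
  ∀ x₀ : M, ContDiffOn ℝ ∞ (pullback₁ 𝓘(ℝ, E) I (extChartAt I x₀).symm a)
    ((extChartAt I x₀).target ∩ (extChartAt I x₀).symm ⁻¹' U)

/-- Smoothness of a field of bilinear forms on `U`: smoothness of its expression in every
chart. -/
def SmoothOn₂ (U : Set M) (B : M → E →L[ℝ] E →L[ℝ] V) : Prop :=
  ∀ x₀ : M, ContDiffOn ℝ ∞ (pullback₂ 𝓘(ℝ, E) I (extChartAt I x₀).symm B)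
    ((extChartAt I x₀).target ∩ (extChartAt I x₀).symm ⁻¹' U)

/-- The exterior derivative of a field of covectors, with the convention
`da(X, Y) = X(a(Y)) - Y(a(X)) - a([X, Y])`, computed at `x` in the chart around `x`. -/
def extDeriv₁ (a : M → E →L[ℝ] V) : M → E →L[ℝ] E →L[ℝ] V := fun x =>
  pullback₂ I 𝓘(ℝ, E) (extChartAt I x)
    (fun y => fderiv ℝ (pullback₁ 𝓘(ℝ, E) I (extChartAt I x).symm a) y -
      (fderiv ℝ (pullback₁ 𝓘(ℝ, E) I (extChartAt I x).symm a) y).flip) x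

variable (V)

/-- `Ω¹(U, V)`.  A form on the open set `U` is represented by its extension by zero to `M`. -/
def forms₁ (U : Set M) : Submodule ℝ (M → E →L[ℝ] V) where
  carrier := {a | SmoothOn₁ I U a ∧ ∀ x, x ∉ U → a x = 0}
  zero_mem' := by
    refine ⟨fun x₀ => ?_, fun _ _ => rfl⟩
    have h : pullback₁ 𝓘(ℝ, E) I (extChartAt I x₀).symm (0 : M → E →L[ℝ] V) = fun _ => 0 := by
      funext y; ext v; simp [pullback₁]
    rw [h]; exact contDiffOn_const
  add_mem' := by
    rintro a b ⟨ha, ha'⟩ ⟨hb, hb'⟩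
    refine ⟨fun x₀ => ?_, fun x hx => by simp [ha' x hx, hb' x hx]⟩
    have h : pullback₁ 𝓘(ℝ, E) I (extChartAt I x₀).symm (a + b) =
        pullback₁ 𝓘(ℝ, E) I (extChartAt I x₀).symm a +
          pullback₁ 𝓘(ℝ, E) I (extChartAt I x₀).symm b := by
      funext y; ext v; simp [pullback₁]
    rw [h]; exact (ha x₀).add (hb x₀)
  smul_mem' := by
    rintro c a ⟨ha, ha'⟩
    refine ⟨fun x₀ => ?_, fun x hx => by simp [ha' x hx]⟩
    have h : pullback₁ 𝓘(ℝ, E) I (extChartAt I x₀).symm (c • a) =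
        c • pullback₁ 𝓘(ℝ, E) I (extChartAt I x₀).symm a := by
      funext y; ext v; simp [pullback₁]
    rw [h]; exact (ha x₀).const_smul c

/-- `Γ(T*U ⊗ T*U ⊗ V)`, with the same convention outside of `U`. -/
def tensors₂ (U : Set M) : Submodule ℝ (M → E →L[ℝ] E →L[ℝ] V) where
  carrier := {B | SmoothOn₂ I U B ∧ ∀ x, x ∉ U → B x = 0}
  zero_mem' := by
    refine ⟨fun x₀ => ?_, fun _ _ => rfl⟩
    have h : pullback₂ 𝓘(ℝ, E) I (extChartAt I x₀).symm
        (0 : M → E →L[ℝ] E →L[ℝ] V) = fun _ => 0 := by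
      funext y; ext v w; simp [pullback₂]
    rw [h]; exact contDiffOn_const
  add_mem' := by
    rintro a b ⟨ha, ha'⟩ ⟨hb, hb'⟩
    refine ⟨fun x₀ => ?_, fun x hx => by simp [ha' x hx, hb' x hx]⟩
    have h : pullback₂ 𝓘(ℝ, E) I (extChartAt I x₀).symm (a + b) =
        pullback₂ 𝓘(ℝ, E) I (extChartAt I x₀).symm a +
          pullback₂ 𝓘(ℝ, E) I (extChartAt I x₀).symm b := by
      funext y; ext v w; simp [pullback₂]
    rw [h]; exact (ha x₀).add (hb x₀)
  smul_mem' := by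
    rintro c a ⟨ha, ha'⟩
    refine ⟨fun x₀ => ?_, fun x hx => by simp [ha' x hx]⟩
    have h : pullback₂ 𝓘(ℝ, E) I (extChartAt I x₀).symm (c • a) =
        c • pullback₂ 𝓘(ℝ, E) I (extChartAt I x₀).symm a := by
      funext y; ext v w; simp [pullback₂]
    rw [h]; exact (ha x₀).const_smul c

/-- `Ω²(U, V)`: alternating bilinear forms. -/
def forms₂ (U : Set M) : Submodule ℝ (M → E →L[ℝ] E →L[ℝ] V) :=
  tensors₂ I V U ⊓
    { carrier := {B | ∀ x u v, B x u v = -B x v u}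
      zero_mem' := by intro x u v; simp
      add_mem' := by
        intro a b ha hb x u v
        have h₁ := ha x u v
        have h₂ := hb x u v
        simp only [Pi.add_apply, add_apply, h₁, h₂, neg_add]
      smul_mem' := by
        intro c a ha x u v
        have h₁ := ha x u v
        simp only [Pi.smul_apply, smul_apply, h₁, smul_neg] }

/-- `Γ(S²T*U ⊗ V)`: symmetric bilinear forms. -/
def symTensors₂ (U : Set M) : Submodule ℝ (M → E →L[ℝ] E →L[ℝ] V) :=
  tensors₂ I V U ⊓
    { carrier := {B | ∀ x u v, B x u v = B x v u}
      zero_mem' := by intro x u v; simp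
      add_mem' := by
        intro a b ha hb x u v
        have h₁ := ha x u v
        have h₂ := hb x u v
        simp only [Pi.add_apply, add_apply, h₁, h₂]
      smul_mem' := by
        intro c a ha x u v
        have h₁ := ha x u v
        simp only [Pi.smul_apply, smul_apply, h₁] }

variable {V}

/-- `⟨α ⊗ β⟩` for a bilinear map `⟨ , ⟩`: `(X, Y) ↦ ⟨α(X), β(Y)⟩`. -/
def pairTensor {F : Type*} [NormedAddCommGroup F] [NormedSpace ℝ F]
    (κ : F →L[ℝ] F →L[ℝ] V) (α β : M → E →L[ℝ] F) : M → E →L[ℝ] E →L[ℝ] V :=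
  fun x => κ.bilinearComp (α x) (β x)

/-- `⟨α ∧ β⟩` for a bilinear map `⟨ , ⟩`: `(X, Y) ↦ ⟨α(X), β(Y)⟩ - ⟨α(Y), β(X)⟩`. -/
def pairWedge {F : Type*} [NormedAddCommGroup F] [NormedSpace ℝ F]
    (κ : F →L[ℝ] F →L[ℝ] V) (α β : M → E →L[ℝ] F) : M → E →L[ℝ] E →L[ℝ] V :=
  fun x => pairTensor κ α β x - (pairTensor κ α β x).flip

end Forms

/-! ### Lie groups -/

section LieGroups

variable {E H E' H' : Type*}
  [NormedAddCommGroup E] [NormedSpace ℝ E] [TopologicalSpace H]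
  [NormedAddCommGroup E'] [NormedSpace ℝ E'] [TopologicalSpace H']
  (I : ModelWithCorners ℝ E H) (J : ModelWithCorners ℝ E' H')
  {G : Type*} [TopologicalSpace G] [ChartedSpace H G] [Group G]
  {M : Type*} [TopologicalSpace M] [ChartedSpace H' M]

/-- The left-invariant Maurer-Cartan form `θᴸ`, with values in `T₁ G = E`. -/
def thetaL : G → E →L[ℝ] E := fun g => differential I I (fun h : G => g⁻¹ * h) g

/-- The right-invariant Maurer-Cartan form `θᴿ`. -/
def thetaR : G → E →L[ℝ] E := fun g => differential I I (fun h : G => h * g⁻¹) g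

/-- The adjoint representation on `T₁ G = E`. -/
def adRep (g : G) : E →L[ℝ] E := differential I I (fun h : G => g * h * g⁻¹) 1

/-- The pullback `f*θ` of the Maurer-Cartan form of `G` by `f : M → G`. -/
def logForm (f : M → G) : M → E' →L[ℝ] E := pullback₁ J I f (thetaL I)

end LieGroups

/-! ### Semi-simplicial covers of the nerve of a group and multiplicative gerbes -/

section Nerve

variable {G : Type*} [Group G]

/-- The face maps `d₀, d₁, d₂ : G² → G`. -/
def nerveFace₂ : Fin 3 → G × G → G :=
  ![fun x => x.2, fun x => x.1 * x.2, fun x => x.1]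

/-- The face maps `d₀, …, d₃ : G³ → G²`. -/
def nerveFace₃ : Fin 4 → G × G × G → G × G :=
  ![fun x => (x.2.1, x.2.2), fun x => (x.1 * x.2.1, x.2.2),
    fun x => (x.1, x.2.1 * x.2.2), fun x => (x.1, x.2.1)]

/-- The face maps `d₀, …, d₄ : G⁴ → G³`. -/
def nerveFace₄ : Fin 5 → G × G × G × G → G × G × G :=
  ![fun x => (x.2.1, x.2.2.1, x.2.2.2), fun x => (x.1 * x.2.1, x.2.2.1, x.2.2.2),
    fun x => (x.1, x.2.1 * x.2.2.1, x.2.2.2), fun x => (x.1, x.2.1, x.2.2.1 * x.2.2.2),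
    fun x => (x.1, x.2.1, x.2.2.1)]

end Nerve

/-- A family of open sets covering a space. -/
structure IsOpenCovering {X ι : Type*} [TopologicalSpace X] (U : ι → Set X) : Prop where
  isOpen : ∀ i, IsOpen (U i)
  covers : ∀ x, ∃ i, x ∈ U i

universe w w'

/-- A semi-simplicial open cover of the nerve `BG` of `G`, in the degrees `1, …, 4` that
are needed to describe multiplicative gerbes. -/
structure NerveCover (G : Type*) [Group G] [TopologicalSpace G] where
  (I₁ I₂ I₃ I₄ : Type w)
  U₁ : I₁ → Set G
  U₂ : I₂ → Set (G × G)
  U₃ : I₃ → Set (G × G × G)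
  U₄ : I₄ → Set (G × G × G × G)
  cover₁ : IsOpenCovering U₁
  cover₂ : IsOpenCovering U₂
  cover₃ : IsOpenCovering U₃
  cover₄ : IsOpenCovering U₄
  d₂ : Fin 3 → I₂ → I₁
  d₃ : Fin 4 → I₃ → I₂
  d₄ : Fin 5 → I₄ → I₃
  mapsTo₂ : ∀ j i, MapsTo (nerveFace₂ j) (U₂ i) (U₁ (d₂ j i))
  mapsTo₃ : ∀ j i, MapsTo (nerveFace₃ j) (U₃ i) (U₂ (d₃ j i))
  mapsTo₄ : ∀ j i, MapsTo (nerveFace₄ j) (U₄ i) (U₃ (d₄ j i))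
  d₂_d₃ : ∀ j k : Fin 3, j ≤ k → ∀ i, d₂ j (d₃ k.succ i) = d₂ k (d₃ j.castSucc i)
  d₃_d₄ : ∀ j k : Fin 4, j ≤ k → ∀ i, d₃ j (d₄ k.succ i) = d₃ k (d₄ j.castSucc i)

section Gerbes

variable {EG HG ET HT : Type*}
  [NormedAddCommGroup EG] [NormedSpace ℝ EG] [TopologicalSpace HG]
  [NormedAddCommGroup ET] [NormedSpace ℝ ET] [TopologicalSpace HT]
  (IG : ModelWithCorners ℝ EG HG) (IT : ModelWithCorners ℝ ET HT)
  (G T : Type*) [TopologicalSpace G] [ChartedSpace HG G] [Group G]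
  [TopologicalSpace T] [ChartedSpace HT T] [CommGroup T]

/-- A multiplicative `T`-gerbe over `G`: the gerbe `lam` over `G`, the product `m`, an isomorphism
of gerbes over `G²`, and the associator `α`, a `2`-isomorphism over `G³` subject to the pentagon
identity over `G⁴`, as Čech cocycle data.  Only the values of the functions on the indicated
intersections matter. -/
structure MultiplicativeGerbe where
  cover : NerveCover.{w} G
  lam : cover.I₁ → cover.I₁ → cover.I₁ → G → T
  m : cover.I₂ → cover.I₂ → G × G → T
  α : cover.I₃ → G × G × G → T
  smooth_lam : ∀ i j k,
    ContMDiffOn IG IT ∞ (lam i j k) (cover.U₁ i ∩ cover.U₁ j ∩ cover.U₁ k)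
  smooth_m : ∀ i j, ContMDiffOn (IG.prod IG) IT ∞ (m i j) (cover.U₂ i ∩ cover.U₂ j)
  smooth_α : ∀ i, ContMDiffOn (IG.prod (IG.prod IG)) IT ∞ (α i) (cover.U₃ i)
  lam_cocycle : ∀ i j k l, ∀ x ∈ cover.U₁ i ∩ cover.U₁ j ∩ cover.U₁ k ∩ cover.U₁ l,
    lam i j k x * (lam i j l x)⁻¹ * lam i k l x * (lam j k l x)⁻¹ = 1
  m_cocycle : ∀ i j k, ∀ x ∈ cover.U₂ i ∩ cover.U₂ j ∩ cover.U₂ k,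
    m i j x * (m i k x)⁻¹ * m j k x =
      lam (cover.d₂ 0 i) (cover.d₂ 0 j) (cover.d₂ 0 k) (nerveFace₂ 0 x) *
      (lam (cover.d₂ 1 i) (cover.d₂ 1 j) (cover.d₂ 1 k) (nerveFace₂ 1 x))⁻¹ *
      lam (cover.d₂ 2 i) (cover.d₂ 2 j) (cover.d₂ 2 k) (nerveFace₂ 2 x)
  α_cocycle : ∀ i j, ∀ x ∈ cover.U₃ i ∩ cover.U₃ j,
    α i x * (α j x)⁻¹ =
      (m (cover.d₃ 3 i) (cover.d₃ 3 j) (nerveFace₃ 3 x))⁻¹ *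
      m (cover.d₃ 2 i) (cover.d₃ 2 j) (nerveFace₃ 2 x) *
      (m (cover.d₃ 1 i) (cover.d₃ 1 j) (nerveFace₃ 1 x))⁻¹ *
      m (cover.d₃ 0 i) (cover.d₃ 0 j) (nerveFace₃ 0 x)
  pentagon : ∀ i, ∀ x ∈ cover.U₄ i,
    α (cover.d₄ 4 i) (nerveFace₄ 4 x) * (α (cover.d₄ 3 i) (nerveFace₄ 3 x))⁻¹ *
      α (cover.d₄ 2 i) (nerveFace₄ 2 x) * (α (cover.d₄ 1 i) (nerveFace₄ 1 x))⁻¹ *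
      α (cover.d₄ 0 i) (nerveFace₄ 0 x) = 1

variable {IG IT G T}

/-- A connective structure on a multiplicative gerbe: a connective structure `A` on the gerbe
over `G` and a connection `M` on the product such that the associator is flat. -/
structure MultConnectiveStructure (𝒢 : MultiplicativeGerbe.{w} IG IT G T) where
  A : ∀ i j, forms₁ IG ET (𝒢.cover.U₁ i ∩ 𝒢.cover.U₁ j)
  M : ∀ i, forms₁ (IG.prod IG) ET (𝒢.cover.U₂ i)
  A_cocycle : ∀ i j k, ∀ x ∈ 𝒢.cover.U₁ i ∩ 𝒢.cover.U₁ j ∩ 𝒢.cover.U₁ k,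
    (A i j).1 x - (A i k).1 x + (A j k).1 x = logForm IT IG (𝒢.lam i j k) x
  M_connection : ∀ i j, ∀ x ∈ 𝒢.cover.U₂ i ∩ 𝒢.cover.U₂ j,
    (M i).1 x +
        pullback₁ (IG.prod IG) IG (nerveFace₂ 1) (A (𝒢.cover.d₂ 1 i) (𝒢.cover.d₂ 1 j)).1 x +
        logForm IT (IG.prod IG) (𝒢.m i j) x =
      pullback₁ (IG.prod IG) IG (nerveFace₂ 0) (A (𝒢.cover.d₂ 0 i) (𝒢.cover.d₂ 0 j)).1 x +
        pullback₁ (IG.prod IG) IG (nerveFace₂ 2) (A (𝒢.cover.d₂ 2 i) (𝒢.cover.d₂ 2 j)).1 x +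
        (M j).1 x
  α_flat : ∀ i, ∀ x ∈ 𝒢.cover.U₃ i,
    logForm IT (IG.prod (IG.prod IG)) (𝒢.α i) x +
        pullback₁ (IG.prod (IG.prod IG)) (IG.prod IG) (nerveFace₃ 0) (M (𝒢.cover.d₃ 0 i)).1 x +
        pullback₁ (IG.prod (IG.prod IG)) (IG.prod IG) (nerveFace₃ 2) (M (𝒢.cover.d₃ 2 i)).1 x =
      pullback₁ (IG.prod (IG.prod IG)) (IG.prod IG) (nerveFace₃ 1) (M (𝒢.cover.d₃ 1 i)).1 x +
        pullback₁ (IG.prod (IG.prod IG)) (IG.prod IG) (nerveFace₃ 3) (M (𝒢.cover.d₃ 3 i)).1 x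

/-- The Maurer-Cartan data of a multiplicative gerbe with connective structure: an `Ad`-invariant
symmetric pairing `⟨ , ⟩ : 𝔤 ⊗ 𝔤 → 𝔱` and a curving `Θᴸ` of the gerbe over `G`, with respect to
which the product has curvature `-⟨g₁*θᴸ ∧ g₂*θᴿ⟩`. -/
@[ext]
structure MaurerCartanData {𝒢 : MultiplicativeGerbe.{w} IG IT G T}
    (D : MultConnectiveStructure 𝒢) where
  pairing : EG →L[ℝ] EG →L[ℝ] ET
  Θ : ∀ i, forms₂ IG ET (𝒢.cover.U₁ i)
  symm : ∀ u v, pairing u v = pairing v u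
  adInvariant : ∀ (g : G) (u v : EG), pairing (adRep IG g u) (adRep IG g v) = pairing u v
  Θ_curving : ∀ i j, ∀ x ∈ 𝒢.cover.U₁ i ∩ 𝒢.cover.U₁ j,
    (Θ i).1 x - (Θ j).1 x = extDeriv₁ IG (D.A i j).1 x
  curvature : ∀ i, ∀ x ∈ 𝒢.cover.U₂ i,
    extDeriv₁ (IG.prod IG) (D.M i).1 x -
        (pullback₂ (IG.prod IG) IG Prod.fst (Θ (𝒢.cover.d₂ 2 i)).1 x +
          pullback₂ (IG.prod IG) IG Prod.snd (Θ (𝒢.cover.d₂ 0 i)).1 x) +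
        pullback₂ (IG.prod IG) IG (fun z : G × G => z.1 * z.2) (Θ (𝒢.cover.d₂ 1 i)).1 x =
      -pairWedge pairing
        (pullback₁ (IG.prod IG) IG Prod.fst (thetaL IG))
        (pullback₁ (IG.prod IG) IG Prod.snd (thetaR IG)) x

/-- The Maurer-Cartan enhanced curving `Θᴸ - ⟨θᴸ ⊗ θᴸ⟩`. -/
def MaurerCartanData.enhanced {𝒢 : MultiplicativeGerbe.{w} IG IT G T}
    {D : MultConnectiveStructure 𝒢} (mc : MaurerCartanData D) (i : 𝒢.cover.I₁) :
    G → EG →L[ℝ] EG →L[ℝ] ET :=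
  fun g => (mc.Θ i).1 g - pairTensor mc.pairing (thetaL IG) (thetaL IG) g

end Gerbes

/-! ### Principal bundles -/

section Bundles

variable {EM HM EP HP EG HG : Type*}
  [NormedAddCommGroup EM] [NormedSpace ℝ EM] [TopologicalSpace HM]
  [NormedAddCommGroup EP] [NormedSpace ℝ EP] [TopologicalSpace HP]
  [NormedAddCommGroup EG] [NormedSpace ℝ EG] [TopologicalSpace HG]
  (IM : ModelWithCorners ℝ EM HM) (IP : ModelWithCorners ℝ EP HP) (IG : ModelWithCorners ℝ EG HG)
  (M P G : Type*) [TopologicalSpace M] [ChartedSpace HM M] [TopologicalSpace P] [ChartedSpace HP P]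
  [TopologicalSpace G] [ChartedSpace HG G] [Group G]

/-- A smooth principal `G`-bundle `P → M`: a smooth right action on `P` and a map `proj` which
admits smooth equivariant local trivializations. -/
structure PrincipalBundle where
  proj : P → M
  act : P × G → P
  smooth_proj : ContMDiff IP IM ∞ proj
  smooth_act : ContMDiff (IP.prod IG) IP ∞ act
  act_one : ∀ p, act (p, 1) = p
  act_mul : ∀ p g h, act (act (p, g), h) = act (p, g * h)
  proj_act : ∀ p g, proj (act (p, g)) = proj p
  locallyTrivial : ∀ x : M, ∃ e : Bundle.Trivialization G proj, x ∈ e.baseSet ∧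
    ContMDiffOn IP (IM.prod IG) ∞ e e.source ∧
    ContMDiffOn (IM.prod IG) IP ∞ e.toOpenPartialHomeomorph.symm e.target ∧
    ∀ p ∈ e.source, ∀ g, (e (act (p, g))).2 = (e p).2 * g

variable {IM IP IG M P G}

namespace PrincipalBundle

variable (Q : PrincipalBundle IM IP IG M P G)

/-- The face maps `d₀, d₁ : P × G → P` of the nerve of the action groupoid. -/
def face₁ : Fin 2 → P × G → P := ![Q.act, Prod.fst]

/-- The face maps `d₀, d₁, d₂ : P × G² → P × G`. -/
def face₂ : Fin 3 → P × G × G → P × G :=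
  ![fun x => (Q.act (x.1, x.2.1), x.2.2), fun x => (x.1, x.2.1 * x.2.2), fun x => (x.1, x.2.1)]

/-- The face maps `d₀, …, d₃ : P × G³ → P × G²`. -/
def face₃ : Fin 4 → P × G × G × G → P × G × G :=
  ![fun x => (Q.act (x.1, x.2.1), x.2.2.1, x.2.2.2), fun x => (x.1, x.2.1 * x.2.2.1, x.2.2.2),
    fun x => (x.1, x.2.1, x.2.2.1 * x.2.2.2), fun x => (x.1, x.2.1, x.2.2.1)]

/-- `G`-connections on `P`: forms `A ∈ Ω¹(P, 𝔤)` with `act*A = Ad(g⁻¹) p*A + g*θᴸ` over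
`P × G`. -/
def Connection : Type _ :=
  {A : forms₁ IP EG (univ : Set P) // ∀ z : P × G,
    pullback₁ (IP.prod IG) IP Q.act A.1 z =
      (adRep IG z.2⁻¹).comp (pullback₁ (IP.prod IG) IP Prod.fst A.1 z) +
        pullback₁ (IP.prod IG) IG Prod.snd (thetaL IG) z}

/-- `Ω¹(ad P)`, as the space of tensorial forms on `P`: forms `a ∈ Ω¹(P, 𝔤)` with
`act*a = Ad(g⁻¹) p*a` over `P × G`.  Over `(p, g)` this says both that `a` is equivariant and that
it vanishes on the vertical vectors. -/
def adForms : Submodule ℝ (forms₁ IP EG (univ : Set P)) where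
  carrier := {a | ∀ z : P × G, pullback₁ (IP.prod IG) IP Q.act a.1 z =
    (adRep IG z.2⁻¹).comp (pullback₁ (IP.prod IG) IP Prod.fst a.1 z)}
  zero_mem' := by
    intro z
    simp only [pullback₁, ZeroMemClass.coe_zero, Pi.zero_apply, ContinuousLinearMap.zero_comp,
      ContinuousLinearMap.comp_zero]
  add_mem' := by
    intro a b ha hb z
    have h₁ := ha z
    have h₂ := hb z
    simp only [pullback₁, Submodule.coe_add, Pi.add_apply, ContinuousLinearMap.add_comp,
      ContinuousLinearMap.comp_add] at h₁ h₂ ⊢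
    rw [h₁, h₂]
  smul_mem' := by
    intro c a ha z
    have h₁ := ha z
    simp only [pullback₁, Submodule.coe_smul, Pi.smul_apply, ContinuousLinearMap.smul_comp,
      ContinuousLinearMap.comp_smul] at h₁ ⊢
    rw [h₁]

end PrincipalBundle

/-- A semi-simplicial open cover, in the degrees `0, …, 3`, of the nerve `P × G^n` of the action
groupoid of a principal bundle, together with a map to a given cover of the nerve of `G` which lies
over the projections `P × G^n → G^n`. -/
structure ActionCover (Q : PrincipalBundle IM IP IG M P G) (U : NerveCover.{w} G) where
  (R₀ R₁ R₂ R₃ : Type w')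
  V₀ : R₀ → Set P
  V₁ : R₁ → Set (P × G)
  V₂ : R₂ → Set (P × G × G)
  V₃ : R₃ → Set (P × G × G × G)
  cover₀ : IsOpenCovering V₀
  cover₁ : IsOpenCovering V₁
  cover₂ : IsOpenCovering V₂
  cover₃ : IsOpenCovering V₃
  d₁ : Fin 2 → R₁ → R₀
  d₂ : Fin 3 → R₂ → R₁
  d₃ : Fin 4 → R₃ → R₂
  mapsTo₁ : ∀ j r, MapsTo (Q.face₁ j) (V₁ r) (V₀ (d₁ j r))
  mapsTo₂ : ∀ j r, MapsTo (Q.face₂ j) (V₂ r) (V₁ (d₂ j r))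
  mapsTo₃ : ∀ j r, MapsTo (Q.face₃ j) (V₃ r) (V₂ (d₃ j r))
  d₁_d₂ : ∀ j k : Fin 2, j ≤ k → ∀ r, d₁ j (d₂ k.succ r) = d₁ k (d₂ j.castSucc r)
  d₂_d₃ : ∀ j k : Fin 3, j ≤ k → ∀ r, d₂ j (d₃ k.succ r) = d₂ k (d₃ j.castSucc r)
  π₁ : R₁ → U.I₁
  π₂ : R₂ → U.I₂
  π₃ : R₃ → U.I₃
  mapsTo_π₁ : ∀ r, MapsTo Prod.snd (V₁ r) (U.U₁ (π₁ r))
  mapsTo_π₂ : ∀ r, MapsTo Prod.snd (V₂ r) (U.U₂ (π₂ r))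
  mapsTo_π₃ : ∀ r, MapsTo Prod.snd (V₃ r) (U.U₃ (π₃ r))
  π_d₂ : ∀ j r, U.d₂ j (π₂ r) = π₁ (d₂ j r)
  π_d₃ : ∀ j r, U.d₃ j (π₃ r) = π₂ (d₃ j r)

end Bundles

/-! ### Principal 2-bundles, connective structures and connections -/

section TwoBundles

variable {EM HM EP HP EG HG ET HT : Type*}
  [NormedAddCommGroup EM] [NormedSpace ℝ EM] [TopologicalSpace HM]
  [NormedAddCommGroup EP] [NormedSpace ℝ EP] [TopologicalSpace HP]
  [NormedAddCommGroup EG] [NormedSpace ℝ EG] [TopologicalSpace HG]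
  [NormedAddCommGroup ET] [NormedSpace ℝ ET] [TopologicalSpace HT]
  (IM : ModelWithCorners ℝ EM HM) (IP : ModelWithCorners ℝ EP HP)
  {IG : ModelWithCorners ℝ EG HG} {IT : ModelWithCorners ℝ ET HT}
  (M P : Type*) {G T : Type*}
  [TopologicalSpace M] [ChartedSpace HM M] [TopologicalSpace P] [ChartedSpace HP P]
  [TopologicalSpace G] [ChartedSpace HG G] [Group G]
  [TopologicalSpace T] [ChartedSpace HT T] [CommGroup T]

/-- A principal `𝒢`-bundle over `M`: a principal `G`-bundle `P → M`, a `T`-gerbe `b` over `P`, an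
isomorphism of gerbes `ρ : p*𝒳 ⊗ g*𝒢 → (pg)*𝒳` over `P × G`, given by `ρ`, and a `2`-isomorphism
over `P × G²`, given by `β`, compatible with the associator of `𝒢` over `P × G³`, as Čech cocycle
data. -/
structure PrincipalTwoBundle (𝒢 : MultiplicativeGerbe.{w} IG IT G T) where
  toBundle : PrincipalBundle IM IP IG M P G
  cover : ActionCover.{w, w'} toBundle 𝒢.cover
  b : cover.R₀ → cover.R₀ → cover.R₀ → P → T
  ρ : cover.R₁ → cover.R₁ → P × G → T
  β : cover.R₂ → P × G × G → T
  smooth_b : ∀ r s t,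
    ContMDiffOn IP IT ∞ (b r s t) (cover.V₀ r ∩ cover.V₀ s ∩ cover.V₀ t)
  smooth_ρ : ∀ r s, ContMDiffOn (IP.prod IG) IT ∞ (ρ r s) (cover.V₁ r ∩ cover.V₁ s)
  smooth_β : ∀ r, ContMDiffOn (IP.prod (IG.prod IG)) IT ∞ (β r) (cover.V₂ r)
  b_cocycle : ∀ r s t u, ∀ x ∈ cover.V₀ r ∩ cover.V₀ s ∩ cover.V₀ t ∩ cover.V₀ u,
    b r s t x * (b r s u x)⁻¹ * b r t u x * (b s t u x)⁻¹ = 1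
  ρ_cocycle : ∀ r s t, ∀ x ∈ cover.V₁ r ∩ cover.V₁ s ∩ cover.V₁ t,
    ρ r s x * (ρ r t x)⁻¹ * ρ s t x =
      b (cover.d₁ 1 r) (cover.d₁ 1 s) (cover.d₁ 1 t) (toBundle.face₁ 1 x) *
      (b (cover.d₁ 0 r) (cover.d₁ 0 s) (cover.d₁ 0 t) (toBundle.face₁ 0 x))⁻¹ *
      𝒢.lam (cover.π₁ r) (cover.π₁ s) (cover.π₁ t) x.2
  β_cocycle : ∀ r s, ∀ x ∈ cover.V₂ r ∩ cover.V₂ s,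
    β r x * (β s x)⁻¹ =
      (ρ (cover.d₂ 2 r) (cover.d₂ 2 s) (toBundle.face₂ 2 x))⁻¹ *
      ρ (cover.d₂ 1 r) (cover.d₂ 1 s) (toBundle.face₂ 1 x) *
      (ρ (cover.d₂ 0 r) (cover.d₂ 0 s) (toBundle.face₂ 0 x))⁻¹ *
      𝒢.m (cover.π₂ r) (cover.π₂ s) x.2
  pentagon : ∀ r, ∀ x ∈ cover.V₃ r,
    β (cover.d₃ 3 r) (toBundle.face₃ 3 x) * (β (cover.d₃ 2 r) (toBundle.face₃ 2 x))⁻¹ *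
      β (cover.d₃ 1 r) (toBundle.face₃ 1 x) * (β (cover.d₃ 0 r) (toBundle.face₃ 0 x))⁻¹ *
      𝒢.α (cover.π₃ r) x.2 = 1

variable {IM IP M P}
variable {𝒢 : MultiplicativeGerbe.{w} IG IT G T}

/-- A connective structure on a principal `𝒢`-bundle: a connective structure `σ` on the gerbe over
`P` and a connection `η` on the isomorphism `ρ` such that the `2`-isomorphism `β` is flat. -/
structure ConnectiveStructure (𝒳 : PrincipalTwoBundle.{w, w'} IM IP M P 𝒢)
    (D : MultConnectiveStructure 𝒢) where
  σ : ∀ r s, forms₁ IP ET (𝒳.cover.V₀ r ∩ 𝒳.cover.V₀ s)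
  η : ∀ r, forms₁ (IP.prod IG) ET (𝒳.cover.V₁ r)
  σ_cocycle : ∀ r s t, ∀ x ∈ 𝒳.cover.V₀ r ∩ 𝒳.cover.V₀ s ∩ 𝒳.cover.V₀ t,
    (σ r s).1 x - (σ r t).1 x + (σ s t).1 x = logForm IT IP (𝒳.b r s t) x
  η_connection : ∀ r s, ∀ x ∈ 𝒳.cover.V₁ r ∩ 𝒳.cover.V₁ s,
    (η r).1 x +
        pullback₁ (IP.prod IG) IP (𝒳.toBundle.face₁ 0)
          (σ (𝒳.cover.d₁ 0 r) (𝒳.cover.d₁ 0 s)).1 x +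
        logForm IT (IP.prod IG) (𝒳.ρ r s) x =
      pullback₁ (IP.prod IG) IG Prod.snd (D.A (𝒳.cover.π₁ r) (𝒳.cover.π₁ s)).1 x +
        pullback₁ (IP.prod IG) IP (𝒳.toBundle.face₁ 1)
          (σ (𝒳.cover.d₁ 1 r) (𝒳.cover.d₁ 1 s)).1 x +
        (η s).1 x
  β_flat : ∀ r, ∀ x ∈ 𝒳.cover.V₂ r,
    logForm IT (IP.prod (IG.prod IG)) (𝒳.β r) x +
        pullback₁ (IP.prod (IG.prod IG)) (IG.prod IG) Prod.snd (D.M (𝒳.cover.π₂ r)).1 x +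
        pullback₁ (IP.prod (IG.prod IG)) (IP.prod IG) (𝒳.toBundle.face₂ 1)
          (η (𝒳.cover.d₂ 1 r)).1 x =
      pullback₁ (IP.prod (IG.prod IG)) (IP.prod IG) (𝒳.toBundle.face₂ 0)
          (η (𝒳.cover.d₂ 0 r)).1 x +
        pullback₁ (IP.prod (IG.prod IG)) (IP.prod IG) (𝒳.toBundle.face₂ 2)
          (η (𝒳.cover.d₂ 2 r)).1 x

variable {𝒳 : PrincipalTwoBundle.{w, w'} IM IP M P 𝒢} {D : MultConnectiveStructure 𝒢}

/-- An isomorphism of connective structures on `𝒳`: a connection `φ` on the identity of the gerbe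
over `P`, such that the square formed by `φ` and the two connections on `ρ` commutes. -/
@[ext]
structure ConnectiveIso (S₁ S₂ : ConnectiveStructure 𝒳 D) where
  φ : ∀ r, forms₁ IP ET (𝒳.cover.V₀ r)
  connection : ∀ r s, ∀ x ∈ 𝒳.cover.V₀ r ∩ 𝒳.cover.V₀ s,
    (φ r).1 x - (φ s).1 x = (S₁.σ r s).1 x - (S₂.σ r s).1 x
  comm : ∀ r, ∀ x ∈ 𝒳.cover.V₁ r,
    (S₁.η r).1 x +
        pullback₁ (IP.prod IG) IP (𝒳.toBundle.face₁ 0) (φ (𝒳.cover.d₁ 0 r)).1 x =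
      pullback₁ (IP.prod IG) IP (𝒳.toBundle.face₁ 1) (φ (𝒳.cover.d₁ 1 r)).1 x +
        (S₂.η r).1 x

/-- A connection on `𝒳` with underlying connective structure `S`: a `G`-connection `A` on `P` and a
curving `B` of the gerbe over `P`, such that `ρ` has curvature `-⟨p*A ∧ g*θᴿ⟩` with respect to
`p*B ⊗ g*Θᴸ` and `(pg)*B`. -/
@[ext]
structure TwoConnection (S : ConnectiveStructure 𝒳 D) (mc : MaurerCartanData D) where
  A : 𝒳.toBundle.Connection
  B : ∀ r, forms₂ IP ET (𝒳.cover.V₀ r)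
  curving : ∀ r s, ∀ x ∈ 𝒳.cover.V₀ r ∩ 𝒳.cover.V₀ s,
    (B r).1 x - (B s).1 x = extDeriv₁ IP (S.σ r s).1 x
  curvature : ∀ r, ∀ x ∈ 𝒳.cover.V₁ r,
    extDeriv₁ (IP.prod IG) (S.η r).1 x -
        (pullback₂ (IP.prod IG) IP Prod.fst (B (𝒳.cover.d₁ 1 r)).1 x +
          pullback₂ (IP.prod IG) IG Prod.snd (mc.Θ (𝒳.cover.π₁ r)).1 x) +
        pullback₂ (IP.prod IG) IP 𝒳.toBundle.act (B (𝒳.cover.d₁ 0 r)).1 x =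
      -pairWedge mc.pairing
        (pullback₁ (IP.prod IG) IP Prod.fst A.1.1)
        (pullback₁ (IP.prod IG) IG Prod.snd (thetaR IG)) x

/-- An enhanced connection on `𝒳` with underlying connective structure `S`: a `G`-connection `A` on
`P` and an enhanced curving `B` of the gerbe over `P`, such that `ρ` has curvature
`-2⟨p*A ⊗ g*θᴿ⟩` with respect to `p*B ⊗ g*Θ` and `(pg)*B`, where `Θ` is the Maurer-Cartan enhanced
curving. -/
@[ext]
structure EnhancedConnection (S : ConnectiveStructure 𝒳 D) (mc : MaurerCartanData D) where
  A : 𝒳.toBundle.Connection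
  B : ∀ r, tensors₂ IP ET (𝒳.cover.V₀ r)
  curving : ∀ r s, ∀ x ∈ 𝒳.cover.V₀ r ∩ 𝒳.cover.V₀ s,
    (B r).1 x - (B s).1 x = extDeriv₁ IP (S.σ r s).1 x
  curvature : ∀ r, ∀ x ∈ 𝒳.cover.V₁ r,
    extDeriv₁ (IP.prod IG) (S.η r).1 x -
        (pullback₂ (IP.prod IG) IP Prod.fst (B (𝒳.cover.d₁ 1 r)).1 x +
          pullback₂ (IP.prod IG) IG Prod.snd (mc.enhanced (𝒳.cover.π₁ r)) x) +
        pullback₂ (IP.prod IG) IP 𝒳.toBundle.act (B (𝒳.cover.d₁ 0 r)).1 x =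
      -((2 : ℝ) • pairTensor mc.pairing
        (pullback₁ (IP.prod IG) IP Prod.fst A.1.1)
        (pullback₁ (IP.prod IG) IG Prod.snd (thetaR IG)) x)

/-- The connections with underlying connective structure `S` and underlying `G`-connection `A`. -/
def TwoConnectionOver (S : ConnectiveStructure 𝒳 D) (mc : MaurerCartanData D)
    (A : 𝒳.toBundle.Connection) : Type _ :=
  {c : TwoConnection S mc // c.A = A}

/-- The enhanced connections with underlying connective structure `S` and underlying `G`-connection
`A`. -/
def EnhancedConnectionOver (S : ConnectiveStructure 𝒳 D) (mc : MaurerCartanData D)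
    (A : 𝒳.toBundle.Connection) : Type _ :=
  {c : EnhancedConnection S mc // c.A = A}

end TwoBundles

section Torsors

/-- `act` makes the nonempty set `X` a right torsor for the group `Γ`. -/
structure IsRightTorsor {X Γ : Type*} [Group Γ] (act : X → Γ → X) : Prop where
  nonempty : Nonempty X
  act_one : ∀ x, act x 1 = x
  act_mul : ∀ x g h, act (act x g) h = act x (g * h)
  simplyTransitive : ∀ x y, ∃! g, act x g = y

/-- `act` makes the nonempty set `X` a torsor for the additive commutative group `Γ`. -/
structure IsAdditiveTorsor {X Γ : Type*} [AddCommGroup Γ] (act : X → Γ → X) : Prop where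
  nonempty : Nonempty X
  act_zero : ∀ x, act x 0 = x
  act_add : ∀ x g h, act (act x g) h = act x (g + h)
  simplyTransitive : ∀ x y, ∃! g, act x g = y

variable {EM HM EP HP EG HG ET : Type*}
  [NormedAddCommGroup EM] [NormedSpace ℝ EM] [TopologicalSpace HM]
  [NormedAddCommGroup EP] [NormedSpace ℝ EP] [TopologicalSpace HP]
  [NormedAddCommGroup EG] [NormedSpace ℝ EG] [TopologicalSpace HG]
  [NormedAddCommGroup ET] [NormedSpace ℝ ET]
  {IM : ModelWithCorners ℝ EM HM} {IP : ModelWithCorners ℝ EP HP}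
  {IG : ModelWithCorners ℝ EG HG} {M P G : Type*}
  [TopologicalSpace M] [ChartedSpace HM M] [TopologicalSpace P] [ChartedSpace HP P]
  [TopologicalSpace G] [ChartedSpace HG G] [Group G]

variable (ET) in
/-- The underlying set `Ω¹(ad P) × Ω²(M, 𝔱)` of the central extension. -/
structure AdExtension (Q : PrincipalBundle IM IP IG M P G) where
  a : Q.adForms
  b : forms₂ IM ET (univ : Set M)

/-- The product `(a₁, b₁) · (a₂, b₂) = (a₁ + a₂, b₁ + b₂ + ⟨a₁ ∧ a₂⟩)`.  Here `⟨a₁ ∧ a₂⟩` is a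
`2`-form on `M`, namely the one whose pullback to `P` is the wedge product of the tensorial forms
`a₁` and `a₂`; so the second component is given after pullback to `P`. -/
def IsAdExtensionProduct {Q : PrincipalBundle IM IP IG M P G} (κ : EG →L[ℝ] EG →L[ℝ] ET)
    (mul : AdExtension ET Q → AdExtension ET Q → AdExtension ET Q) : Prop :=
  ∀ x y, (mul x y).a = x.a + y.a ∧
    pullback₂ IP IM Q.proj (mul x y).b.1 =
      pullback₂ IP IM Q.proj x.b.1 + pullback₂ IP IM Q.proj y.b.1 +
        pairWedge κ x.a.1.1 y.a.1.1

end Torsors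

end HigherGauge

end

open HigherGauge

/-!
The forms on the nerve `P × Gⁿ` of the action groupoid of `P` constitute complexes under the
alternating sums of the pullbacks along the face maps, and these complexes are exact: over an open
set of `M` with a section of `P` the nerve has an extra degeneracy (`LocalTriv.homotopy₀`,
`LocalTriv.homotopy₁`, `LocalTriv.homotopy₂`), and the resulting contracting homotopies may be
averaged over a partition of unity of `M`, since all faces lie over the identity of `M`. The cases
needed are `exists_primitive₁`, `exists_primitive₂` and `exists_primitive₁_double`; in the lowest
degree exactness says that basic tensors descend to `M` (`descend₁`, `descend₂`).

On the other hand the sheaves of forms are fine, so that their Čech cohomology vanishes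
(`exists_cech_primitive`, `exists_cech_primitive₂`) and connective structures, connections on
isomorphisms and curvings exist if no compatibility is asked for. The failure of each required
compatibility is independent of the members of the cover, hence a global form (`exists_glue`) in
one of these complexes. It is simplicially closed, as a consequence of the simplicial identities and
of the next higher coherence: the pentagon identities and the flatness of `α` for the failure of
`β` to be flat (`nonempty_connectiveStructure`), the flatness of `β` for the failure of an
isomorphism to commute with `ρ` (`nonempty_connectiveIso`) and for the failure of the curvature
equation (`exists_twoConnection_over`). So it is exact, and a primitive corrects the choice.

For the Maurer-Cartan data the nerve of `G` itself takes the place of the action groupoid. Its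
complex of `2`-forms is not exact, and the curvature of the product is a closed `2`-form on `G²`. In
the left trivialization, closedness is an algebraic identity between bilinear forms on the Lie
algebra, which may be evaluated at unit elements: after subtraction of a coboundary the form is
determined by its mixed component at `(1, 1)`, a bilinear form whose symmetric part is invariant and
whose alternating part is a further coboundary (`IsTrivializedCocycle.exists_primitive`). This
brings the curvature into the form `-⟨g₁*θᴸ ∧ g₂*θᴿ⟩` (`exists_pairing_primitive`,
`nonempty_maurerCartanData`). Evaluation at unit elements also gives uniqueness
(`maurerCartanData_eq`).

Finally, the difference of two connections, or of two enhanced connections, is a tensorial `1`-form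
`a` together with a global `2`-tensor on `P`, whose failure to be basic is the difference of the
prescribed curvatures of `ρ`. By the equivariance of `A` and `a` and the invariance of the pairing,
`⟨A ∧ a⟩`, and in the enhanced case also `⟨A ⊗ A⟩ - ⟨(A + a) ⊗ (A + a)⟩`, have exactly this failure
(`adShift_act`, `symShift_act`). What remains is the pullback of a unique tensor on `M`. Together
with the compatibility of these shifts with the group law (`adShift_mul`, `symShift_add`) this gives
the torsors.
-/

namespace HigherGauge

noncomputable section

set_option linter.unusedSectionVars false

open Filter Topology

/-! ### Differentials, pullbacks and smoothness at a point -/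

section Calculus

variable {E H E' H' E'' H'' : Type*}
  [NormedAddCommGroup E] [NormedSpace ℝ E] [TopologicalSpace H]
  [NormedAddCommGroup E'] [NormedSpace ℝ E'] [TopologicalSpace H']
  [NormedAddCommGroup E''] [NormedSpace ℝ E''] [TopologicalSpace H'']
  {I : ModelWithCorners ℝ E H} {J : ModelWithCorners ℝ E' H'} {K : ModelWithCorners ℝ E'' H''}
  {M N L : Type*} [TopologicalSpace M] [ChartedSpace H M] [TopologicalSpace N] [ChartedSpace H' N]
  [TopologicalSpace L] [ChartedSpace H'' L]
  {V : Type*} [NormedAddCommGroup V] [NormedSpace ℝ V]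

theorem differential_comp {f : M → N} {g : N → L} {x : M}
    (hg : MDifferentiableAt J K g (f x)) (hf : MDifferentiableAt I J f x) :
    differential I K (g ∘ f) x = (differential J K g (f x)).comp (differential I J f x) :=
  mfderiv_comp x hg hf

theorem differential_congr {f g : M → N} {x : M} (h : f =ᶠ[𝓝 x] g) :
    differential I J f x = differential I J g x := h.mfderiv_eq

theorem differential_id (x : M) :
    differential I I (fun y : M => y) x = ContinuousLinearMap.id ℝ E := mfderiv_id

theorem differential_const (c : N) (x : M) : differential I J (fun _ : M => c) x = 0 :=
  mfderiv_const

theorem differential_fst (x : M × N) :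
    differential (I.prod J) I Prod.fst x = ContinuousLinearMap.fst ℝ E E' := mfderiv_fst

theorem differential_snd (x : M × N) :
    differential (I.prod J) J Prod.snd x = ContinuousLinearMap.snd ℝ E E' := mfderiv_snd

theorem differential_prodMk {f : M → N} {g : M → L} {x : M}
    (hf : MDifferentiableAt I J f x) (hg : MDifferentiableAt I K g x) :
    differential I (J.prod K) (fun y => (f y, g y)) x =
      (differential I J f x).prod (differential I K g x) := mfderiv_prodMk hf hg

theorem pullback₁_apply (f : M → N) (a : N → E' →L[ℝ] V) (x : M) (u : E) :
    pullback₁ I J f a x u = a (f x) (differential I J f x u) := rfl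

theorem pullback₂_apply (f : M → N) (B : N → E' →L[ℝ] E' →L[ℝ] V) (x : M) (u v : E) :
    pullback₂ I J f B x u v = B (f x) (differential I J f x u) (differential I J f x v) := rfl

theorem pullback₁_comp {f : M → N} {g : N → L} {x : M}
    (hg : MDifferentiableAt J K g (f x)) (hf : MDifferentiableAt I J f x)
    (a : L → E'' →L[ℝ] V) :
    pullback₁ I K (g ∘ f) a x = pullback₁ I J f (pullback₁ J K g a) x := by
  ext u
  simp [pullback₁, differential_comp hg hf]

theorem pullback₂_comp {f : M → N} {g : N → L} {x : M}
    (hg : MDifferentiableAt J K g (f x)) (hf : MDifferentiableAt I J f x)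
    (B : L → E'' →L[ℝ] E'' →L[ℝ] V) :
    pullback₂ I K (g ∘ f) B x = pullback₂ I J f (pullback₂ J K g B) x := by
  ext u v
  simp [pullback₂, differential_comp hg hf]

theorem pullback₁_congr_map {f g : M → N} {x : M} (h : f =ᶠ[𝓝 x] g) (a : N → E' →L[ℝ] V) :
    pullback₁ I J f a x = pullback₁ I J g a x := by
  simp only [pullback₁, differential_congr h, h.eq_of_nhds]

theorem pullback₂_congr_map {f g : M → N} {x : M} (h : f =ᶠ[𝓝 x] g)
    (B : N → E' →L[ℝ] E' →L[ℝ] V) :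
    pullback₂ I J f B x = pullback₂ I J g B x := by
  simp only [pullback₂, differential_congr h, h.eq_of_nhds]

theorem differential_extChartAt_self [IsManifold I 1 M] (x : M) :
    differential I 𝓘(ℝ, E) (extChartAt I x) x = ContinuousLinearMap.id ℝ E :=
  mfderiv_extChartAt_self

variable [I.Boundaryless] [J.Boundaryless] [K.Boundaryless]
  [IsManifold I ∞ M] [IsManifold J ∞ N] [IsManifold K ∞ L]

theorem contMDiffAt_extChartAt_symm {x : M} {y : E} (hy : y ∈ (extChartAt I x).target) :
    ContMDiffAt 𝓘(ℝ, E) I ∞ (extChartAt I x).symm y :=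
  (contMDiffOn_extChartAt_symm (n := ∞) x).contMDiffAt
    ((isOpen_extChartAt_target x).mem_nhds hy)

theorem differential_eq_fderiv {f : M → N} {x : M} (hf : MDifferentiableAt I J f x) :
    differential I J f x = fderiv ℝ (writtenInExtChartAt I J x f) (extChartAt I x x) := by
  unfold differential
  rw [hf.mfderiv, I.range_eq_univ, fderivWithin_univ]

/-- In the charts at `x` and `f x`, a smooth map and its differential are represented by
`writtenInExtChartAt` and its derivative, on a neighbourhood of `x`. -/
theorem eventually_chart_representation {f : M → N} {x : M} (hf : ContMDiffAt I J ∞ f x) :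
    ∀ᶠ y in 𝓝 (extChartAt I x x),
      (extChartAt J (f x)).symm (writtenInExtChartAt I J x f y) = f ((extChartAt I x).symm y) ∧
      (differential 𝓘(ℝ, E') J (extChartAt J (f x)).symm (writtenInExtChartAt I J x f y)).comp
          (fderiv ℝ (writtenInExtChartAt I J x f) y) =
        (differential I J f ((extChartAt I x).symm y)).comp
          (differential 𝓘(ℝ, E) I (extChartAt I x).symm y) := by
  have hsymm := contMDiffAt_extChartAt_symm (I := I) (mem_extChartAt_target (I := I) x)
  have hx : (extChartAt I x).symm (extChartAt I x x) = x := extChartAt_to_inv x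
  have ht : Tendsto (extChartAt I x).symm (𝓝 (extChartAt I x x)) (𝓝 x) := by
    have := hsymm.continuousAt.tendsto; rwa [hx] at this
  have h1 : ∀ᶠ y in 𝓝 (extChartAt I x x), y ∈ (extChartAt I x).target :=
    (isOpen_extChartAt_target x).mem_nhds (mem_extChartAt_target x)
  have hf1 : ∀ᶠ z in 𝓝 x, ContMDiffAt I J 1 f z :=
    (contMDiffAt_iff_contMDiffAt_nhds (by simp)).1 (hf.of_le (by simp : (1 : WithTop ℕ∞) ≤ ∞))
  have h2 := ht.eventually hf1
  have h3 : ∀ᶠ y in 𝓝 (extChartAt I x x), ∀ᶠ z in 𝓝 y,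
      f ((extChartAt I x).symm z) ∈ (extChartAt J (f x)).source :=
    (ht.eventually (hf.continuousAt.eventually ((isOpen_extChartAt_source (I := J) (f x)).mem_nhds
      (mem_extChartAt_source (f x))))).eventually_nhds
  filter_upwards [h1, h2, h3] with y hy1 hy2 hy3
  have e : (extChartAt J (f x)).symm ∘ writtenInExtChartAt I J x f =ᶠ[𝓝 y]
      f ∘ (extChartAt I x).symm := by
    filter_upwards [hy3] with z hz
    simp only [writtenInExtChartAt, Function.comp_apply]
    exact (extChartAt J (f x)).left_inv hz
  have hS := (contMDiffAt_extChartAt_symm hy1).mdifferentiableAt (by simp)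
  have hF := hy2.mdifferentiableAt (by simp)
  have hE : MDifferentiableAt J 𝓘(ℝ, E') (extChartAt J (f x)) (f ((extChartAt I x).symm y)) := by
    have : IsManifold J 1 N := IsManifold.of_le (n := ∞) (by simp)
    exact mdifferentiableAt_extChartAt (by simpa using hy3.self_of_nhds)
  have hφ : MDifferentiableAt 𝓘(ℝ, E) 𝓘(ℝ, E') (writtenInExtChartAt I J x f) y :=
    MDifferentiableAt.comp y hE (hF.comp y hS)
  have hT := (contMDiffAt_extChartAt_symm (I := J) (x := f x)
    ((extChartAt J (f x)).map_source hy3.self_of_nhds)).mdifferentiableAt (n := ∞) (by simp)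
  refine ⟨e.eq_of_nhds, ?_⟩
  rw [← differential_comp (I := 𝓘(ℝ, E)) hF hS, ← differential_congr e,
    differential_comp (f := writtenInExtChartAt I J x f) (J := 𝓘(ℝ, E')) hT hφ]
  congr 1
  exact mfderiv_eq_fderiv.symm

/-- Smoothness of a field of covectors at a point, tested in the preferred chart. -/
def SmoothAt₁ (I : ModelWithCorners ℝ E H) (a : M → E →L[ℝ] V) (x : M) : Prop :=
  ContDiffAt ℝ ∞ (pullback₁ 𝓘(ℝ, E) I (extChartAt I x).symm a) (extChartAt I x x)

/-- Smoothness of a field of bilinear forms at a point, tested in the preferred chart. -/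
def SmoothAt₂ (I : ModelWithCorners ℝ E H) (B : M → E →L[ℝ] E →L[ℝ] V) (x : M) : Prop :=
  ContDiffAt ℝ ∞ (pullback₂ 𝓘(ℝ, E) I (extChartAt I x).symm B) (extChartAt I x x)

theorem contDiffAt_writtenInExtChartAt {f : M → N} {x : M} (hf : ContMDiffAt I J ∞ f x) :
    ContDiffAt ℝ ∞ (writtenInExtChartAt I J x f) (extChartAt I x x) := by
  have h := (contMDiffAt_iff.1 hf).2
  rwa [I.range_eq_univ, contDiffWithinAt_univ] at h

theorem eventually_pullback₁_chart {f : M → N} {x : M} (hf : ContMDiffAt I J ∞ f x)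
    (a : N → E' →L[ℝ] V) :
    pullback₁ 𝓘(ℝ, E) I (extChartAt I x).symm (pullback₁ I J f a) =ᶠ[𝓝 (extChartAt I x x)]
      fun y => (pullback₁ 𝓘(ℝ, E') J (extChartAt J (f x)).symm a
        (writtenInExtChartAt I J x f y)).comp (fderiv ℝ (writtenInExtChartAt I J x f) y) := by
  filter_upwards [eventually_chart_representation hf] with y hy
  simp only [pullback₁, ContinuousLinearMap.comp_assoc, hy.2, hy.1]

theorem eventually_pullback₂_chart {f : M → N} {x : M} (hf : ContMDiffAt I J ∞ f x)
    (B : N → E' →L[ℝ] E' →L[ℝ] V) :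
    pullback₂ 𝓘(ℝ, E) I (extChartAt I x).symm (pullback₂ I J f B) =ᶠ[𝓝 (extChartAt I x x)]
      fun y => (pullback₂ 𝓘(ℝ, E') J (extChartAt J (f x)).symm B
        (writtenInExtChartAt I J x f y)).bilinearComp
          (fderiv ℝ (writtenInExtChartAt I J x f) y)
          (fderiv ℝ (writtenInExtChartAt I J x f) y) := by
  filter_upwards [eventually_chart_representation hf] with y hy
  ext u v
  have h := fun w => DFunLike.congr_fun hy.2 w
  simp only [ContinuousLinearMap.comp_apply] at h
  simp only [pullback₂, ContinuousLinearMap.bilinearComp_apply, hy.1, h]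

theorem contDiffAt_flip {F A C : Type*} [NormedAddCommGroup F] [NormedSpace ℝ F]
    [NormedAddCommGroup A] [NormedSpace ℝ A] [NormedAddCommGroup C] [NormedSpace ℝ C]
    {n : WithTop ℕ∞} {f : F → A →L[ℝ] C →L[ℝ] V} {x : F} (hf : ContDiffAt ℝ n f x) :
    ContDiffAt ℝ n (fun y => (f y).flip) x := by
  have h : IsBoundedLinearMap ℝ
      (ContinuousLinearMap.flip : (A →L[ℝ] C →L[ℝ] V) → (C →L[ℝ] A →L[ℝ] V)) :=
    IsLinearMap.with_bound ⟨fun _ _ => rfl, fun _ _ => rfl⟩ 1 fun f => by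
      rw [ContinuousLinearMap.opNorm_flip, one_mul]
  exact (IsBoundedLinearMap.contDiff (F := C →L[ℝ] A →L[ℝ] V) h).contDiffAt.comp x hf

theorem contDiffAt_bilinearComp {F : Type*} [NormedAddCommGroup F] [NormedSpace ℝ F]
    {n : WithTop ℕ∞} {B : F → E' →L[ℝ] E' →L[ℝ] V} {L₁ L₂ : F → E →L[ℝ] E'} {x : F}
    (hB : ContDiffAt ℝ n B x) (h₁ : ContDiffAt ℝ n L₁ x) (h₂ : ContDiffAt ℝ n L₂ x) :
    ContDiffAt ℝ n (fun y => (B y).bilinearComp (L₁ y) (L₂ y)) x :=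
  contDiffAt_flip ((contDiffAt_flip (hB.clm_comp h₁)).clm_comp h₂)

theorem SmoothAt₁.pullback {f : M → N} {x : M} {a : N → E' →L[ℝ] V}
    (ha : SmoothAt₁ J a (f x)) (hf : ContMDiffAt I J ∞ f x) :
    SmoothAt₁ I (pullback₁ I J f a) x := by
  refine ContDiffAt.congr_of_eventuallyEq ?_ (eventually_pullback₁_chart hf a)
  have hφ := contDiffAt_writtenInExtChartAt hf
  refine ContDiffAt.clm_comp (ContDiffAt.comp
    (g := pullback₁ 𝓘(ℝ, E') J (extChartAt J (f x)).symm a) _ ?_ hφ) (hφ.fderiv_right (by simp))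
  have : writtenInExtChartAt I J x f (extChartAt I x x) = extChartAt J (f x) (f x) := by
    simp [writtenInExtChartAt]
  rw [this]; exact ha

theorem SmoothAt₂.pullback {f : M → N} {x : M} {B : N → E' →L[ℝ] E' →L[ℝ] V}
    (hB : SmoothAt₂ J B (f x)) (hf : ContMDiffAt I J ∞ f x) :
    SmoothAt₂ I (pullback₂ I J f B) x := by
  refine ContDiffAt.congr_of_eventuallyEq ?_ (eventually_pullback₂_chart hf B)
  have hφ := contDiffAt_writtenInExtChartAt hf
  have hφ' : ContDiffAt ℝ ∞ (fderiv ℝ (writtenInExtChartAt I J x f)) (extChartAt I x x) :=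
    hφ.fderiv_right (by simp)
  refine contDiffAt_bilinearComp (ContDiffAt.comp
    (g := pullback₂ 𝓘(ℝ, E') J (extChartAt J (f x)).symm B) _ ?_ hφ) hφ' hφ'
  have : writtenInExtChartAt I J x f (extChartAt I x x) = extChartAt J (f x) (f x) := by
    simp [writtenInExtChartAt]
  rw [this]; exact hB

end Calculus

/-! ### Partitions of unity, Čech cohomology and gluing -/

section Smoothness

variable {E H E' H' : Type*}
  [NormedAddCommGroup E] [NormedSpace ℝ E] [TopologicalSpace H]
  [NormedAddCommGroup E'] [NormedSpace ℝ E'] [TopologicalSpace H']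
  {I : ModelWithCorners ℝ E H} {J : ModelWithCorners ℝ E' H'}
  {M N : Type*} [TopologicalSpace M] [ChartedSpace H M] [TopologicalSpace N] [ChartedSpace H' N]
  {V : Type*} [NormedAddCommGroup V] [NormedSpace ℝ V]

/-- The properties of pointwise smoothness, for fields with values in a fixed vector space `W`,
on which arguments with partitions of unity rest: it is local, and stable under sums and under
multiplication by smooth functions. -/
structure IsSmoothness (I : ModelWithCorners ℝ E H) {W : Type*} [AddCommGroup W] [Module ℝ W]
    (S : (M → W) → M → Prop) : Prop where
  congr : ∀ {f g : M → W} {x : M}, S f x → g =ᶠ[𝓝 x] f → S g x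
  zero : ∀ x : M, S (fun _ => 0) x
  add : ∀ {f g : M → W} {x : M}, S f x → S g x → S (fun y => f y + g y) x
  smul : ∀ {c : M → ℝ} {f : M → W} {x : M}, ContMDiffAt I 𝓘(ℝ, ℝ) ∞ c x → S f x →
    S (fun y => c y • f y) x

namespace IsSmoothness

variable {W : Type*} [AddCommGroup W] [Module ℝ W] {S : (M → W) → M → Prop}

/-- A smoothness condition may be strengthened by a linear condition on the values. -/
theorem inf (hS : IsSmoothness I S) (Q : Submodule ℝ W) :
    IsSmoothness I (fun f x => S f x ∧ ∀ᶠ y in 𝓝 x, f y ∈ Q) where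
  congr h e := ⟨hS.congr h.1 e, by
    filter_upwards [h.2, e] with y hy hy'
    rwa [hy']⟩
  zero x := ⟨hS.zero x, Eventually.of_forall fun _ => Q.zero_mem⟩
  add h h' := ⟨hS.add h.1 h'.1, by
    filter_upwards [h.2, h'.2] with y hy hy' using Q.add_mem hy hy'⟩
  smul hc h := ⟨hS.smul hc h.1, by
    filter_upwards [h.2] with y hy using Q.smul_mem _ hy⟩

theorem neg (hS : IsSmoothness I S) {f : M → W} {x : M} (h : S f x) : S (fun y => -f y) x :=
  hS.congr (hS.smul (c := fun _ => -1) contMDiffAt_const h)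
    (Eventually.of_forall fun y => by simp)

theorem sub (hS : IsSmoothness I S) {f g : M → W} {x : M} (h : S f x) (h' : S g x) :
    S (fun y => f y - g y) x :=
  hS.congr (hS.add h (hS.neg h')) (Eventually.of_forall fun y => by simp [sub_eq_add_neg])

theorem sum (hS : IsSmoothness I S) {ι : Type*} (s : Finset ι) {f : ι → M → W} {x : M}
    (h : ∀ i ∈ s, S (f i) x) : S (fun y => ∑ i ∈ s, f i y) x := by
  classical
  induction s using Finset.induction_on with
  | empty => simpa using hS.zero x
  | insert i s hi ih =>
    simp only [Finset.sum_insert hi]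
    exact hS.add (h i (by simp)) (ih fun j hj => h j (by simp [hj]))

theorem finsum_smul (hS : IsSmoothness I S) {ι : Type*} {ψ : ι → M → ℝ}
    (hψ : ∀ i, ContMDiff I 𝓘(ℝ, ℝ) ∞ (ψ i)) (hfin : LocallyFinite fun i => Function.support (ψ i))
    {f : ι → M → W} {x : M} (h : ∀ i, x ∈ tsupport (ψ i) → S (f i) x) :
    S (fun y => ∑ᶠ i, ψ i y • f i y) x := by
  classical
  obtain ⟨t, ht, htf⟩ := hfin x
  have key : (fun y => ∑ᶠ i, ψ i y • f i y) =ᶠ[𝓝 x]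
      fun y => ∑ i ∈ htf.toFinset, ψ i y • f i y := by
    filter_upwards [ht] with y hy
    refine finsum_eq_sum_of_support_subset _ fun i hi => ?_
    simp only [Finite.coe_toFinset, mem_ofPred_eq]
    exact ⟨y, fun h0 => hi (by simp [h0]), hy⟩
  refine hS.congr (hS.sum _ fun i _ => ?_) key
  by_cases hx : x ∈ tsupport (ψ i)
  · exact hS.smul (hψ i).contMDiffAt (h i hx)
  · refine hS.congr (hS.zero x) ?_
    have : (tsupport (ψ i))ᶜ ∈ 𝓝 x := (isClosed_tsupport _).isOpen_compl.mem_nhds hx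
    filter_upwards [this] with y hy
    rw [image_eq_zero_of_notMem_tsupport hy, zero_smul]

section Cech

variable {ι : Type*} {U : ι → Set M}

theorem finite_support (ψ : SmoothPartitionOfUnity ι I M univ) (f : ι → W) (x : M) :
    (Function.support fun i => ψ i x • f i).Finite :=
  (ψ.locallyFinite.point_finite x).subset fun i hi h0 => hi (by
    have : ψ i x = 0 := by simpa using h0
    simp [this])

theorem finsum_smul_const (ψ : SmoothPartitionOfUnity ι I M univ) (w : W) (x : M) :
    ∑ᶠ i, ψ i x • w = w := by
  rw [← finsum_smul' (ψ.locallyFinite.point_finite x), ψ.sum_eq_one (mem_univ x), one_smul]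

/-- Sections on the members of an open cover that agree on the overlaps come from a global
section. -/
theorem exists_glue (hS : IsSmoothness I S) (hU : IsOpenCovering U) {h : ι → M → W}
    (hh : ∀ i, ∀ x ∈ U i, S (h i) x) (hagree : ∀ i j, ∀ x ∈ U i ∩ U j, h i x = h j x) :
    ∃ f : M → W, (∀ x, S f x) ∧ ∀ i, ∀ x ∈ U i, f x = h i x := by
  choose r hr using hU.covers
  refine ⟨fun x => h (r x) x, fun x => ?_, fun i x hx => hagree _ _ x ⟨hr x, hx⟩⟩
  refine hS.congr (hh (r x) x (hr x)) ?_
  filter_upwards [(hU.isOpen (r x)).mem_nhds (hr x)] with y hy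
  exact hagree _ _ y ⟨hr y, hy⟩

variable [FiniteDimensional ℝ E] [IsManifold I ∞ M] [T2Space M] [SigmaCompactSpace M]

theorem exists_partition (hU : IsOpenCovering U) :
    ∃ ψ : SmoothPartitionOfUnity ι I M univ, ψ.IsSubordinate U :=
  SmoothPartitionOfUnity.exists_isSubordinate I isClosed_univ U hU.isOpen fun x _ =>
    mem_iUnion.2 (hU.covers x)

/-- The first Čech cohomology of a sheaf of modules over smooth functions vanishes. -/
theorem exists_cech_primitive (hS : IsSmoothness I S) (hU : IsOpenCovering U)
    {c : ι → ι → M → W} (hc : ∀ i j, ∀ x ∈ U i ∩ U j, S (c i j) x)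
    (hcoc : ∀ i j k, ∀ x ∈ U i ∩ U j ∩ U k, c i j x - c i k x + c j k x = 0) :
    ∃ h : ι → M → W, (∀ i, ∀ x ∈ U i, S (h i) x) ∧
      ∀ i j, ∀ x ∈ U i ∩ U j, h i x - h j x = c i j x := by
  obtain ⟨ψ, hψ⟩ := exists_partition (I := I) hU
  refine ⟨fun i x => ∑ᶠ k, ψ k x • c i k x, fun i x hx => ?_, fun i j x hx => ?_⟩
  · exact hS.finsum_smul (fun k => (ψ k).contMDiff) ψ.locallyFinite
      fun k hk => hc i k x ⟨hx, hψ k hk⟩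
  · rw [← finsum_sub_distrib (finite_support ψ _ x) (finite_support ψ _ x),
      ← finsum_smul_const ψ (c i j x) x]
    refine finsum_congr fun k => ?_
    by_cases hk : x ∈ tsupport (ψ k)
    · rw [← smul_sub]
      congr 1
      rw [sub_eq_iff_eq_add]
      have := hcoc i j k x ⟨hx, hψ k hk⟩
      rw [← sub_eq_zero, ← neg_eq_zero, ← this]; abel
    · simp [image_eq_zero_of_notMem_tsupport hk]

/-- The second Čech cohomology of a sheaf of modules over smooth functions vanishes. -/
theorem exists_cech_primitive₂ (hS : IsSmoothness I S) (hU : IsOpenCovering U)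
    {c : ι → ι → ι → M → W} (hc : ∀ i j k, ∀ x ∈ U i ∩ U j ∩ U k, S (c i j k) x)
    (hcoc : ∀ i j k l, ∀ x ∈ U i ∩ U j ∩ U k ∩ U l,
      c i j k x - c i j l x + c i k l x - c j k l x = 0) :
    ∃ h : ι → ι → M → W, (∀ i j, ∀ x ∈ U i ∩ U j, S (h i j) x) ∧
      ∀ i j k, ∀ x ∈ U i ∩ U j ∩ U k, h i j x - h i k x + h j k x = c i j k x := by
  obtain ⟨ψ, hψ⟩ := exists_partition (I := I) hU
  refine ⟨fun i j x => ∑ᶠ k, ψ k x • c i j k x, fun i j x hx => ?_, fun i j k x hx => ?_⟩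
  · exact hS.finsum_smul (fun k => (ψ k).contMDiff) ψ.locallyFinite
      fun k hk => hc i j k x ⟨hx, hψ k hk⟩
  · rw [← finsum_sub_distrib (finite_support ψ _ x) (finite_support ψ _ x),
      ← finsum_add_distrib ?_ (finite_support ψ (fun l => c j k l x) x),
      ← finsum_smul_const ψ (c i j k x) x]
    · refine finsum_congr fun l => ?_
      by_cases hl : x ∈ tsupport (ψ l)
      · rw [← smul_sub, ← smul_add]
        congr 1
        have := hcoc i j k l x ⟨hx, hψ l hl⟩
        rw [← sub_eq_zero, ← neg_eq_zero, ← this]; abel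
      · simp [image_eq_zero_of_notMem_tsupport hl]
    · exact ((finite_support ψ (fun l => c i j l x) x).union
        (finite_support ψ (fun l => c i k l x) x)).subset (Function.support_sub _ _)

end Cech

end IsSmoothness

theorem eventually_chart_symm [I.Boundaryless] [IsManifold I ∞ M] {x : M} {p : M → Prop}
    (h : ∀ᶠ y in 𝓝 x, p y) :
    ∀ᶠ y in 𝓝 (extChartAt I x x), p ((extChartAt I x).symm y) := by
  have := (contMDiffAt_extChartAt_symm (I := I) (mem_extChartAt_target (I := I) x)).continuousAt
  rw [ContinuousAt, extChartAt_to_inv] at this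
  exact this.eventually h

theorem contDiffAt_comp_chart_symm {c : M → ℝ} {x : M} [I.Boundaryless]
    (hc : ContMDiffAt I 𝓘(ℝ, ℝ) ∞ c x) :
    ContDiffAt ℝ ∞ (fun y => c ((extChartAt I x).symm y)) (extChartAt I x x) := by
  have h := (contMDiffAt_iff.1 hc).2
  rw [I.range_eq_univ, contDiffWithinAt_univ] at h
  exact h

theorem contDiffAt_real_smul {W : Type*} [NormedAddCommGroup W] [NormedSpace ℝ W] {c : E → ℝ}
    {f : E → W} {x : E} (hc : ContDiffAt ℝ ∞ c x) (hf : ContDiffAt ℝ ∞ f x) :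
    ContDiffAt ℝ ∞ (fun y => c y • f y) x := hc.smul hf

variable [I.Boundaryless] [IsManifold I ∞ M] [J.Boundaryless] [IsManifold J ∞ N]

theorem isSmoothness₁ : IsSmoothness I (SmoothAt₁ I : (M → E →L[ℝ] V) → M → Prop) where
  congr h e := ContDiffAt.congr_of_eventuallyEq h (by
    filter_upwards [eventually_chart_symm e] with y hy
    simp only [pullback₁, hy])
  zero x := by
    have : pullback₁ 𝓘(ℝ, E) I (extChartAt I x).symm (fun _ : M => (0 : E →L[ℝ] V)) =
        fun _ => 0 := by
      funext y; ext v; simp [pullback₁]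
    rw [SmoothAt₁, this]; exact contDiffAt_const
  add {f g x} h h' := by
    have : pullback₁ 𝓘(ℝ, E) I (extChartAt I x).symm (fun y => f y + g y) =
        fun y => pullback₁ 𝓘(ℝ, E) I (extChartAt I x).symm f y +
          pullback₁ 𝓘(ℝ, E) I (extChartAt I x).symm g y := by
      funext y; ext v; simp [pullback₁]
    rw [SmoothAt₁, this]; exact ContDiffAt.add h h'
  smul {c f x} hc h := by
    have : pullback₁ 𝓘(ℝ, E) I (extChartAt I x).symm (fun y => c y • f y) =
        fun y => c ((extChartAt I x).symm y) • pullback₁ 𝓘(ℝ, E) I (extChartAt I x).symm f y := by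
      funext y; ext v; simp [pullback₁]
    rw [SmoothAt₁, this]; exact ContDiffAt.smul (contDiffAt_comp_chart_symm hc) h

theorem isSmoothness₂ : IsSmoothness I (SmoothAt₂ I : (M → E →L[ℝ] E →L[ℝ] V) → M → Prop) where
  congr h e := ContDiffAt.congr_of_eventuallyEq h (by
    filter_upwards [eventually_chart_symm e] with y hy
    simp only [pullback₂, hy])
  zero x := by
    have : pullback₂ 𝓘(ℝ, E) I (extChartAt I x).symm (fun _ : M => (0 : E →L[ℝ] E →L[ℝ] V)) =
        fun _ => 0 := by
      funext y; ext v w; simp [pullback₂]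
    rw [SmoothAt₂, this]; exact contDiffAt_const
  add {f g x} h h' := by
    have : pullback₂ 𝓘(ℝ, E) I (extChartAt I x).symm (fun y => f y + g y) =
        fun y => pullback₂ 𝓘(ℝ, E) I (extChartAt I x).symm f y +
          pullback₂ 𝓘(ℝ, E) I (extChartAt I x).symm g y := by
      funext y; ext v w; simp [pullback₂]
    rw [SmoothAt₂, this]; exact ContDiffAt.add h h'
  smul {c f x} hc h := by
    have : pullback₂ 𝓘(ℝ, E) I (extChartAt I x).symm (fun y => c y • f y) =
        fun y => c ((extChartAt I x).symm y) • pullback₂ 𝓘(ℝ, E) I (extChartAt I x).symm f y := by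
      funext y; ext v w; simp [pullback₂]
    rw [SmoothAt₂, this]
    exact contDiffAt_real_smul (W := E →L[ℝ] E →L[ℝ] V) (contDiffAt_comp_chart_symm hc) h

/-- Alternating bilinear forms. -/
def altForms (E V : Type*) [NormedAddCommGroup E] [NormedSpace ℝ E]
    [NormedAddCommGroup V] [NormedSpace ℝ V] : Submodule ℝ (E →L[ℝ] E →L[ℝ] V) where
  carrier := {B | ∀ u v, B u v = -B v u}
  zero_mem' := by intro u v; simp
  add_mem' := by
    intro a b ha hb u v
    simp only [add_apply, ha u v, hb u v, neg_add]
  smul_mem' := by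
    intro c a ha u v
    simp only [smul_apply, ha u v, smul_neg]

/-- Smoothness at a point of a field of bilinear forms that are alternating near the point. -/
def SmoothAltAt (I : ModelWithCorners ℝ E H) (B : M → E →L[ℝ] E →L[ℝ] V) (x : M) : Prop :=
  SmoothAt₂ I B x ∧ ∀ᶠ y in 𝓝 x, B y ∈ altForms E V

theorem isSmoothnessAlt :
    IsSmoothness I (SmoothAltAt I : (M → E →L[ℝ] E →L[ℝ] V) → M → Prop) :=
  isSmoothness₂.inf _

theorem SmoothAltAt.pullback {f : M → N} {x : M} {B : N → E' →L[ℝ] E' →L[ℝ] V}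
    (hB : SmoothAltAt J B (f x)) (hf : ContMDiffAt I J ∞ f x) :
    SmoothAltAt I (pullback₂ I J f B) x :=
  ⟨hB.1.pullback hf, by
    filter_upwards [hf.continuousAt.eventually hB.2] with y hy u v
    simp only [pullback₂_apply, hy (differential I J f y u)]⟩

theorem smoothAt₁_model_iff {a : E → E →L[ℝ] V} {x : E} :
    SmoothAt₁ 𝓘(ℝ, E) a x ↔ ContDiffAt ℝ ∞ a x := by
  have : pullback₁ 𝓘(ℝ, E) 𝓘(ℝ, E) (fun y : E => y) a = a := by
    funext y; ext v; simp [pullback₁, differential_id]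
  simp only [SmoothAt₁, extChartAt_model_space_eq_id, PartialEquiv.refl_symm,
    PartialEquiv.refl_coe]
  exact iff_of_eq (by rw [show (id : E → E) = fun y => y from rfl, this])

theorem smoothAt₂_model_iff {a : E → E →L[ℝ] E →L[ℝ] V} {x : E} :
    SmoothAt₂ 𝓘(ℝ, E) a x ↔ ContDiffAt ℝ ∞ a x := by
  have : pullback₂ 𝓘(ℝ, E) 𝓘(ℝ, E) (fun y : E => y) a = a := by
    funext y; ext v w; simp [pullback₂, differential_id]
  simp only [SmoothAt₂, extChartAt_model_space_eq_id, PartialEquiv.refl_symm,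
    PartialEquiv.refl_coe]
  exact iff_of_eq (by rw [show (id : E → E) = fun y => y from rfl, this])

/-- Smoothness on an open set, which is defined by all charts, may be tested at each point in the
preferred chart there. -/
theorem smoothOn₁_iff {U : Set M} (hU : IsOpen U) {a : M → E →L[ℝ] V} :
    SmoothOn₁ I U a ↔ ∀ x ∈ U, SmoothAt₁ I a x := by
  constructor
  · intro h x hx
    refine (h x).contDiffAt (((continuousOn_extChartAt_symm x).isOpen_inter_preimage
      (isOpen_extChartAt_target x) hU).mem_nhds ⟨mem_extChartAt_target x, ?_⟩)
    rwa [mem_preimage, extChartAt_to_inv]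
  · intro h x₀ y hy
    exact (smoothAt₁_model_iff.1
      ((h _ hy.2).pullback (contMDiffAt_extChartAt_symm hy.1))).contDiffWithinAt

theorem smoothOn₂_iff {U : Set M} (hU : IsOpen U) {a : M → E →L[ℝ] E →L[ℝ] V} :
    SmoothOn₂ I U a ↔ ∀ x ∈ U, SmoothAt₂ I a x := by
  constructor
  · intro h x hx
    refine (h x).contDiffAt (((continuousOn_extChartAt_symm x).isOpen_inter_preimage
      (isOpen_extChartAt_target x) hU).mem_nhds ⟨mem_extChartAt_target x, ?_⟩)
    rwa [mem_preimage, extChartAt_to_inv]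
  · intro h x₀ y hy
    exact (smoothAt₂_model_iff.1
      ((h _ hy.2).pullback (contMDiffAt_extChartAt_symm hy.1))).contDiffWithinAt

theorem smoothAt_of_mem_forms₁ {U : Set M} (hU : IsOpen U) (a : forms₁ I V U) {x : M}
    (hx : x ∈ U) : SmoothAt₁ I a.1 x := (smoothOn₁_iff hU).1 a.2.1 x hx

theorem smoothAt_of_mem_tensors₂ {U : Set M} (hU : IsOpen U) (a : tensors₂ I V U) {x : M}
    (hx : x ∈ U) : SmoothAt₂ I a.1 x := (smoothOn₂_iff hU).1 a.2.1 x hx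

theorem smoothAltAt_of_mem_forms₂ {U : Set M} (hU : IsOpen U) (a : forms₂ I V U) {x : M}
    (hx : x ∈ U) : SmoothAltAt I a.1 x :=
  ⟨(smoothOn₂_iff hU).1 a.2.1.1 x hx, Eventually.of_forall a.2.2⟩

/-- The extension by zero of a smooth field is a form on the open set. -/
theorem exists_mem_forms₁ {U : Set M} (hU : IsOpen U) {a : M → E →L[ℝ] V}
    (ha : ∀ x ∈ U, SmoothAt₁ I a x) : ∃ b : forms₁ I V U, ∀ x ∈ U, b.1 x = a x := by
  classical
  refine ⟨⟨U.indicator a, (smoothOn₁_iff hU).2 fun x hx => isSmoothness₁.congr (ha x hx) ?_,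
    fun x hx => indicator_of_notMem hx _⟩, fun x hx => indicator_of_mem hx _⟩
  filter_upwards [hU.mem_nhds hx] with y hy using indicator_of_mem hy _

theorem exists_mem_tensors₂ {U : Set M} (hU : IsOpen U) {a : M → E →L[ℝ] E →L[ℝ] V}
    (ha : ∀ x ∈ U, SmoothAt₂ I a x) : ∃ b : tensors₂ I V U, ∀ x ∈ U, b.1 x = a x := by
  classical
  refine ⟨⟨U.indicator a, (smoothOn₂_iff hU).2 fun x hx => isSmoothness₂.congr (ha x hx) ?_,
    fun x hx => indicator_of_notMem hx _⟩, fun x hx => indicator_of_mem hx _⟩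
  filter_upwards [hU.mem_nhds hx] with y hy using indicator_of_mem hy _

theorem exists_mem_forms₂ {U : Set M} (hU : IsOpen U) {a : M → E →L[ℝ] E →L[ℝ] V}
    (ha : ∀ x ∈ U, SmoothAltAt I a x) : ∃ b : forms₂ I V U, ∀ x ∈ U, b.1 x = a x := by
  obtain ⟨b, hb⟩ := exists_mem_tensors₂ hU fun x hx => (ha x hx).1
  refine ⟨⟨b.1, b.2, fun x u v => ?_⟩, hb⟩
  by_cases hx : x ∈ U
  · rw [hb x hx]; exact (ha x hx).2.self_of_nhds u v
  · simp [b.2.2 x hx]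

section Algebra

variable {F : Type*} [NormedAddCommGroup F] [NormedSpace ℝ F]

theorem pairTensor_apply (κ : F →L[ℝ] F →L[ℝ] V) (α β : M → E →L[ℝ] F) (x : M) (u v : E) :
    pairTensor κ α β x u v = κ (α x u) (β x v) := rfl

theorem pairWedge_apply (κ : F →L[ℝ] F →L[ℝ] V) (α β : M → E →L[ℝ] F) (x : M) (u v : E) :
    pairWedge κ α β x u v = κ (α x u) (β x v) - κ (α x v) (β x u) := rfl

theorem pairWedge_mem_altForms (κ : F →L[ℝ] F →L[ℝ] V) (α β : M → E →L[ℝ] F) (x : M) :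
    pairWedge κ α β x ∈ altForms E V := fun u v => by
  simp only [pairWedge_apply, neg_sub]

theorem SmoothAt₂.flip {B : M → E →L[ℝ] E →L[ℝ] V} {x : M} (h : SmoothAt₂ I B x) :
    SmoothAt₂ I (fun y => (B y).flip) x :=
  contDiffAt_flip h

theorem SmoothAt₁.pairTensor {κ : F →L[ℝ] F →L[ℝ] V} {α β : M → E →L[ℝ] F} {x : M}
    (hα : SmoothAt₁ I α x) (hβ : SmoothAt₁ I β x) : SmoothAt₂ I (pairTensor κ α β) x :=
  contDiffAt_bilinearComp (B := fun _ => κ) (L₁ := pullback₁ 𝓘(ℝ, E) I (extChartAt I x).symm α)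
    (L₂ := pullback₁ 𝓘(ℝ, E) I (extChartAt I x).symm β) contDiffAt_const hα hβ

theorem SmoothAt₁.pairWedge {κ : F →L[ℝ] F →L[ℝ] V} {α β : M → E →L[ℝ] F} {x : M}
    (hα : SmoothAt₁ I α x) (hβ : SmoothAt₁ I β x) : SmoothAltAt I (pairWedge κ α β) x :=
  ⟨isSmoothness₂.sub (hα.pairTensor hβ) (hα.pairTensor hβ).flip,
    Eventually.of_forall fun _ => pairWedge_mem_altForms _ _ _ _⟩

end Algebra

end Smoothness

/-! ### The exterior derivative of a field of covectors -/

section ExteriorDerivative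

variable {E H E' H' : Type*}
  [NormedAddCommGroup E] [NormedSpace ℝ E] [TopologicalSpace H]
  [NormedAddCommGroup E'] [NormedSpace ℝ E'] [TopologicalSpace H']
  {I : ModelWithCorners ℝ E H} {J : ModelWithCorners ℝ E' H'}
  {M N : Type*} [TopologicalSpace M] [ChartedSpace H M] [TopologicalSpace N] [ChartedSpace H' N]
  {V : Type*} [NormedAddCommGroup V] [NormedSpace ℝ V]
  [I.Boundaryless] [IsManifold I ∞ M] [J.Boundaryless] [IsManifold J ∞ N]

theorem extDeriv₁_apply (a : M → E →L[ℝ] V) (x : M) (u v : E) :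
    extDeriv₁ I a x u v =
      fderiv ℝ (pullback₁ 𝓘(ℝ, E) I (extChartAt I x).symm a) (extChartAt I x x) u v -
        fderiv ℝ (pullback₁ 𝓘(ℝ, E) I (extChartAt I x).symm a) (extChartAt I x x) v u := by
  have : IsManifold I 1 M := IsManifold.of_le (n := ∞) (by simp)
  simp only [extDeriv₁, pullback₂_apply, differential_extChartAt_self]
  rfl

theorem extDeriv₁_mem_altForms (a : M → E →L[ℝ] V) (x : M) :
    extDeriv₁ I a x ∈ altForms E V := fun u v => by
  simp only [extDeriv₁_apply, neg_sub]

theorem extDeriv₁_congr {a b : M → E →L[ℝ] V} {x : M} (h : a =ᶠ[𝓝 x] b) :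
    extDeriv₁ I a x = extDeriv₁ I b x := by
  have e : pullback₁ 𝓘(ℝ, E) I (extChartAt I x).symm a =ᶠ[𝓝 (extChartAt I x x)]
      pullback₁ 𝓘(ℝ, E) I (extChartAt I x).symm b := by
    filter_upwards [eventually_chart_symm (I := I) h] with y hy
    simp only [pullback₁, hy]
  ext u v
  simp only [extDeriv₁_apply, e.fderiv_eq]

theorem SmoothAt₁.differentiableAt {a : M → E →L[ℝ] V} {x : M} (h : SmoothAt₁ I a x) :
    DifferentiableAt ℝ (pullback₁ 𝓘(ℝ, E) I (extChartAt I x).symm a) (extChartAt I x x) :=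
  ContDiffAt.differentiableAt h (by simp)

theorem extDeriv₁_add {a b : M → E →L[ℝ] V} {x : M} (ha : SmoothAt₁ I a x)
    (hb : SmoothAt₁ I b x) :
    extDeriv₁ I (fun y => a y + b y) x = extDeriv₁ I a x + extDeriv₁ I b x := by
  have e : pullback₁ 𝓘(ℝ, E) I (extChartAt I x).symm (fun y => a y + b y) =
      pullback₁ 𝓘(ℝ, E) I (extChartAt I x).symm a +
        pullback₁ 𝓘(ℝ, E) I (extChartAt I x).symm b := by
    funext y; ext v; simp [pullback₁]
  ext u v
  simp only [add_apply, extDeriv₁_apply, e, fderiv_add ha.differentiableAt hb.differentiableAt]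
  abel

theorem extDeriv₁_neg (a : M → E →L[ℝ] V) (x : M) :
    extDeriv₁ I (fun y => -a y) x = -extDeriv₁ I a x := by
  have e : pullback₁ 𝓘(ℝ, E) I (extChartAt I x).symm (fun y => -a y) =
      -pullback₁ 𝓘(ℝ, E) I (extChartAt I x).symm a := by
    funext y; ext v; simp [pullback₁]
  ext u v
  simp only [neg_apply, extDeriv₁_apply, e, fderiv_neg]
  abel

theorem extDeriv₁_sub {a b : M → E →L[ℝ] V} {x : M} (ha : SmoothAt₁ I a x)
    (hb : SmoothAt₁ I b x) :
    extDeriv₁ I (fun y => a y - b y) x = extDeriv₁ I a x - extDeriv₁ I b x := by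
  simp only [sub_eq_add_neg]
  rw [extDeriv₁_add ha (isSmoothness₁.neg hb), extDeriv₁_neg]

/-- The exterior derivative commutes with pullback along smooth maps; this is the symmetry of the
second derivative of the map, read in charts. -/
theorem extDeriv₁_pullback {f : M → N} {x : M} (hf : ContMDiffAt I J ∞ f x)
    {a : N → E' →L[ℝ] V} (ha : SmoothAt₁ J a (f x)) :
    extDeriv₁ I (pullback₁ I J f a) x = pullback₂ I J f (extDeriv₁ J a) x := by
  set φ := writtenInExtChartAt I J x f with hφdef
  set b := pullback₁ 𝓘(ℝ, E') J (extChartAt J (f x)).symm a with hb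
  have hφx : φ (extChartAt I x x) = extChartAt J (f x) (f x) := by
    simp [hφdef, writtenInExtChartAt]
  have hφ : ContDiffAt ℝ ∞ φ (extChartAt I x x) := contDiffAt_writtenInExtChartAt hf
  have hsymm : IsSymmSndFDerivAt ℝ φ (extChartAt I x x) :=
    hφ.isSymmSndFDerivAt (by
      rw [minSmoothness_of_isRCLikeNormedField]; exact WithTop.coe_le_coe.2 (le_top : (2 : ℕ∞) ≤ ⊤))
  have hdφ : HasFDerivAt φ (fderiv ℝ φ (extChartAt I x x)) (extChartAt I x x) :=
    (hφ.differentiableAt (by simp)).hasFDerivAt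
  have hddφ : HasFDerivAt (fderiv ℝ φ) (fderiv ℝ (fderiv ℝ φ) (extChartAt I x x))
      (extChartAt I x x) :=
    ((hφ.fderiv_right (m := ∞) (by simp)).differentiableAt (by simp)).hasFDerivAt
  have hdb : HasFDerivAt b (fderiv ℝ b (extChartAt J (f x) (f x))) (φ (extChartAt I x x)) := by
    rw [hφx]; exact ha.differentiableAt.hasFDerivAt
  have key : HasFDerivAt (fun y => (b (φ y)).comp (fderiv ℝ φ y)) _ (extChartAt I x x) :=
    (hdb.comp _ hdφ).clm_comp hddφ
  have hD : differential I J f x = fderiv ℝ φ (extChartAt I x x) :=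
    differential_eq_fderiv (hf.mdifferentiableAt (by simp))
  ext u v
  rw [extDeriv₁_apply, pullback₂_apply, extDeriv₁_apply, hD,
    (eventually_pullback₁_chart hf a).fderiv_eq, key.fderiv, ← hb]
  simp only [Function.comp_apply, add_apply, ContinuousLinearMap.comp_apply,
    ContinuousLinearMap.compL_apply, ContinuousLinearMap.flip_apply, hsymm u v]
  abel

theorem extDeriv₁_model (a : E → E →L[ℝ] V) (x : E) :
    extDeriv₁ 𝓘(ℝ, E) a x = fderiv ℝ a x - (fderiv ℝ a x).flip := by
  have : pullback₁ 𝓘(ℝ, E) 𝓘(ℝ, E) (fun y : E => y) a = a := by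
    funext y; ext v; simp [pullback₁, differential_id]
  ext u v
  rw [extDeriv₁_apply]
  simp only [extChartAt_model_space_eq_id, PartialEquiv.refl_symm, PartialEquiv.refl_coe,
    show (id : E → E) = fun y => y from rfl, this]
  rfl

theorem SmoothAt₁.extDeriv₁ {a : M → E →L[ℝ] V} {x : M} (h : ∀ᶠ y in 𝓝 x, SmoothAt₁ I a y) :
    SmoothAltAt I (extDeriv₁ I a) x := by
  refine ⟨?_, Eventually.of_forall fun _ => extDeriv₁_mem_altForms _ _⟩
  have hd : ContDiffAt ℝ ∞ (fderiv ℝ (pullback₁ 𝓘(ℝ, E) I (extChartAt I x).symm a))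
      (extChartAt I x x) := ContDiffAt.fderiv_right h.self_of_nhds (by simp)
  refine (hd.sub (contDiffAt_flip hd)).congr_of_eventuallyEq ?_
  filter_upwards [eventually_chart_symm (I := I) h,
    (isOpen_extChartAt_target (I := I) x).mem_nhds (mem_extChartAt_target x)] with y hy hy'
  rw [← extDeriv₁_pullback (contMDiffAt_extChartAt_symm hy') hy, extDeriv₁_model]

end ExteriorDerivative

/-! ### Vertical components of forms on a product -/

section Vertical

variable {E H E' H' : Type*}
  [NormedAddCommGroup E] [NormedSpace ℝ E] [TopologicalSpace H]
  [NormedAddCommGroup E'] [NormedSpace ℝ E'] [TopologicalSpace H']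
  {I : ModelWithCorners ℝ E H} {J : ModelWithCorners ℝ E' H'}
  {M N : Type*} [TopologicalSpace M] [ChartedSpace H M] [TopologicalSpace N] [ChartedSpace H' N]
  {V : Type*} [NormedAddCommGroup V] [NormedSpace ℝ V]
  [I.Boundaryless] [IsManifold I ∞ M] [J.Boundaryless] [IsManifold J ∞ N]

variable (E E') in
/-- The projection of the tangent spaces of a product to the second factor. -/
def verticalProj : E × E' →L[ℝ] E × E' :=
  (ContinuousLinearMap.inr ℝ E E').comp (ContinuousLinearMap.snd ℝ E E')

theorem verticalProj_apply (w : E × E') : verticalProj E E' w = (0, w.2) := rfl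

/-- In the product chart at a point, the vertical projection is constant. -/
theorem eventually_differential_verticalProj (z : M × N) :
    ∀ᶠ y in 𝓝 (extChartAt (I.prod J) z z),
      (verticalProj E E').comp
          (differential 𝓘(ℝ, E × E') (I.prod J) (extChartAt (I.prod J) z).symm y) =
        (differential 𝓘(ℝ, E × E') (I.prod J) (extChartAt (I.prod J) z).symm y).comp
          (verticalProj E E') := by
  filter_upwards [(isOpen_extChartAt_target (I := I.prod J) z).mem_nhds
    (mem_extChartAt_target z)] with y hy
  rw [extChartAt_prod] at hy ⊢
  have h := mfderiv_prodMap (p := y)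
    ((contMDiffAt_extChartAt_symm (I := I) hy.1).mdifferentiableAt (by simp))
    ((contMDiffAt_extChartAt_symm (I := J) hy.2).mdifferentiableAt (by simp))
  rw [modelWithCornersSelf_prod, ← chartedSpaceSelf_prod]
  have h' : differential (𝓘(ℝ, E).prod 𝓘(ℝ, E')) (I.prod J)
      ((extChartAt I z.1).prod (extChartAt J z.2)).symm y =
      (differential 𝓘(ℝ, E) I (extChartAt I z.1).symm y.1).prodMap
        (differential 𝓘(ℝ, E') J (extChartAt J z.2).symm y.2) := h
  rw [h']
  refine ContinuousLinearMap.ext fun w => Prod.ext ?_ rfl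
  exact (map_zero (differential 𝓘(ℝ, E) I (extChartAt I z.1).symm y.1)).symm

/-- The vertical component of a smooth field of covectors on a product is smooth: in a product chart
it is the composition with a constant map. -/
theorem SmoothAt₁.vertical {a : M × N → E × E' →L[ℝ] V} {z : M × N}
    (h : SmoothAt₁ (I.prod J) a z) :
    SmoothAt₁ (I.prod J) (fun y => (a y).comp (verticalProj E E')) z := by
  refine (ContDiffAt.clm_comp (g := pullback₁ 𝓘(ℝ, E × E') (I.prod J)
    (extChartAt (I.prod J) z).symm a) h
    (contDiffAt_const (c := verticalProj E E'))).congr_of_eventuallyEq ?_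
  filter_upwards [eventually_differential_verticalProj (I := I) (J := J) z] with y hy
  simp only [pullback₁, ContinuousLinearMap.comp_assoc, hy]

theorem SmoothAltAt.vertical {B : M × N → E × E' →L[ℝ] E × E' →L[ℝ] V} {z : M × N}
    (h : SmoothAltAt (I.prod J) B z) :
    SmoothAltAt (I.prod J)
      (fun y => (B y).bilinearComp (verticalProj E E') (verticalProj E E')) z := by
  refine ⟨(contDiffAt_bilinearComp (B := pullback₂ 𝓘(ℝ, E × E') (I.prod J)
    (extChartAt (I.prod J) z).symm B) h.1 (contDiffAt_const (c := verticalProj E E'))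
    (contDiffAt_const (c := verticalProj E E'))).congr_of_eventuallyEq ?_, ?_⟩
  · filter_upwards [eventually_differential_verticalProj (I := I) (J := J) z] with y hy
    have hy' := fun w => DFunLike.congr_fun hy w
    simp only [ContinuousLinearMap.comp_apply] at hy'
    refine ContinuousLinearMap.ext fun u => ContinuousLinearMap.ext fun v => ?_
    simp only [pullback₂_apply, ContinuousLinearMap.bilinearComp_apply, hy']
  · filter_upwards [h.2] with y hy u v
    simp only [ContinuousLinearMap.bilinearComp_apply, hy (verticalProj E E' u)]

end Vertical

/-! ### The Maurer-Cartan forms of a Lie group -/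

section LieGroup

variable {E H E' H' : Type*}
  [NormedAddCommGroup E] [NormedSpace ℝ E] [TopologicalSpace H]
  [NormedAddCommGroup E'] [NormedSpace ℝ E'] [TopologicalSpace H']
  {I : ModelWithCorners ℝ E H} {J : ModelWithCorners ℝ E' H'}
  {G : Type*} [TopologicalSpace G] [ChartedSpace H G] [Group G] [LieGroup I ∞ G]
  {M : Type*} [TopologicalSpace M] [ChartedSpace H' M]

theorem contMDiff_mul_pair : ContMDiff (I.prod I) I ∞ fun z : G × G => z.1 * z.2 :=
  contMDiff_mul I ∞

theorem mdifferentiableAt_mul_left' (g h : G) : MDifferentiableAt I I (fun x : G => g * x) h :=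
  (contMDiff_mul_left (I := I) (n := ∞)).mdifferentiableAt (by simp)

theorem mdifferentiableAt_mul_right' (g h : G) : MDifferentiableAt I I (fun x : G => x * g) h :=
  (contMDiff_mul_right (I := I) (n := ∞)).mdifferentiableAt (by simp)

theorem mdifferentiableAt_conj (g h : G) :
    MDifferentiableAt I I (fun x : G => g * x * g⁻¹) h :=
  (((contMDiff_mul_right (I := I) (n := ∞) (a := g⁻¹)).comp
    (contMDiff_mul_left (I := I) (n := ∞) (a := g))).mdifferentiable (by simp)) h

theorem differential_mul {f g : M → G} {x : M} (hf : MDifferentiableAt J I f x)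
    (hg : MDifferentiableAt J I g x) :
    differential J I (fun y => f y * g y) x =
      (differential I I (fun a : G => a * g x) (f x)).comp (differential J I f x) +
        (differential I I (fun a : G => f x * a) (g x)).comp (differential J I g x) := by
  have hm : MDifferentiableAt (I.prod I) I (fun z : G × G => z.1 * z.2) (f x, g x) :=
    contMDiff_mul_pair.mdifferentiable (by simp) _
  have h := differential_comp (f := fun y => (f y, g y)) hm (hf.prodMk hg)
  change differential J I (fun y => f y * g y) x = _ at h
  rw [h, differential_prodMk hf hg]
  ext1 u
  exact mfderiv_prod_eq_add_apply hm

theorem adRep_one : adRep I (1 : G) = ContinuousLinearMap.id ℝ E := by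
  simp only [adRep, one_mul, inv_one, mul_one]
  exact differential_id _

theorem adRep_mul (g h : G) : adRep I (g * h) = (adRep I g).comp (adRep I h) := by
  have e : (fun x : G => g * h * x * (g * h)⁻¹) =
      (fun x => g * x * g⁻¹) ∘ (fun x => h * x * h⁻¹) := by
    funext x; simp [mul_assoc]
  rw [adRep, e, differential_comp (mdifferentiableAt_conj _ _) (mdifferentiableAt_conj _ _)]
  simp only [mul_one, mul_inv_cancel]
  rfl

theorem adRep_adRep_inv (g : G) (u : E) : adRep I g (adRep I g⁻¹ u) = u := by
  rw [← ContinuousLinearMap.comp_apply, ← adRep_mul, mul_inv_cancel, adRep_one]; rfl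

theorem adRep_inv_adRep (g : G) (u : E) : adRep I g⁻¹ (adRep I g u) = u := by
  rw [← ContinuousLinearMap.comp_apply, ← adRep_mul, inv_mul_cancel, adRep_one]; rfl

/-- The two Maurer-Cartan forms differ by the adjoint representation. -/
theorem thetaR_eq (g : G) : thetaR I g = (adRep I g).comp (thetaL I g) := by
  have e : (fun x : G => x * g⁻¹) = (fun x => g * x * g⁻¹) ∘ (fun x => g⁻¹ * x) := by
    funext x; simp
  rw [thetaR, e, differential_comp (mdifferentiableAt_conj _ _) (mdifferentiableAt_mul_left' _ _)]
  simp only [inv_mul_cancel]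
  rfl

theorem thetaL_one : thetaL I (1 : G) = ContinuousLinearMap.id ℝ E := by
  simp only [thetaL, inv_one, one_mul]; exact differential_id _

theorem thetaL_comp_mul_left (g h : G) :
    (thetaL I (g * h)).comp (differential I I (fun x : G => g * x) h) = thetaL I h := by
  have e : (fun x : G => h⁻¹ * x) = (fun x => (g * h)⁻¹ * x) ∘ (fun x => g * x) := by
    funext x; simp [mul_assoc]
  rw [thetaL, thetaL, e,
    differential_comp (mdifferentiableAt_mul_left' _ _) (mdifferentiableAt_mul_left' _ _)]

theorem thetaL_comp_mul_right (g h : G) :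
    (thetaL I (g * h)).comp (differential I I (fun x : G => x * h) g) =
      (adRep I h⁻¹).comp (thetaL I g) := by
  have e : (fun x : G => (g * h)⁻¹ * x) ∘ (fun x => x * h) =
      (fun x : G => h⁻¹ * x * h⁻¹⁻¹) ∘ (fun x => g⁻¹ * x) := by
    funext x; simp [mul_assoc]
  rw [thetaL, ← differential_comp (mdifferentiableAt_mul_left' _ _)
    (mdifferentiableAt_mul_right' _ _), e,
    differential_comp (mdifferentiableAt_conj _ _) (mdifferentiableAt_mul_left' _ _)]
  simp only [inv_mul_cancel]
  rfl

/-- The product rule for the logarithmic derivative. -/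
theorem pullback_thetaL_mul {f g : M → G} {x : M} (hf : MDifferentiableAt J I f x)
    (hg : MDifferentiableAt J I g x) :
    pullback₁ J I (fun y => f y * g y) (thetaL I) x =
      (adRep I (g x)⁻¹).comp (pullback₁ J I f (thetaL I) x) + pullback₁ J I g (thetaL I) x := by
  rw [pullback₁, differential_mul hf hg, ContinuousLinearMap.comp_add,
    ← ContinuousLinearMap.comp_assoc, ← ContinuousLinearMap.comp_assoc, thetaL_comp_mul_left,
    thetaL_comp_mul_right]
  rfl

theorem pullback_thetaR_mul {f g : M → G} {x : M} (hf : MDifferentiableAt J I f x)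
    (hg : MDifferentiableAt J I g x) :
    pullback₁ J I (fun y => f y * g y) (thetaR I) x =
      pullback₁ J I f (thetaR I) x + (adRep I (f x)).comp (pullback₁ J I g (thetaR I) x) := by
  have h := pullback_thetaL_mul hf hg
  ext u
  have hu := DFunLike.congr_fun h u
  simp only [pullback₁_apply, thetaR_eq, ContinuousLinearMap.comp_apply, add_apply] at hu ⊢
  rw [hu, map_add, adRep_mul]
  simp only [ContinuousLinearMap.comp_apply, adRep_adRep_inv]

variable [I.Boundaryless] [J.Boundaryless] [IsManifold J ∞ M]

/-- A smooth family of maps `Ψ (g, ·)` with `Ψ (g, g) = 1` has a smooth family of derivatives on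
the diagonal.  This is the vertical part of the differential of `Ψ`, read in the chart at `1`. -/
theorem smoothAt₁_partial_diagonal {Ψ : G × G → G} (hΨ : ContMDiff (I.prod I) I ∞ Ψ)
    (hdiag : ∀ g, Ψ (g, g) = 1) (g : G) :
    SmoothAt₁ I (fun g : G => differential I I (fun h => Ψ (g, h)) g) g := by
  have hχ : ∀ g : G, ContMDiffAt I 𝓘(ℝ, E) ∞ (extChartAt I (1 : G)) (Ψ (g, g)) := fun g => by
    rw [hdiag]; exact contMDiffAt_extChartAt
  have hcomp : ∀ g : G, ContMDiffAt (I.prod I) 𝓘(ℝ, E) ∞ (extChartAt I (1 : G) ∘ Ψ) (g, g) :=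
    fun g => (hχ g).comp (g, g) (hΨ (g, g))
  have hid : SmoothAt₁ 𝓘(ℝ, E) (fun _ : E => ContinuousLinearMap.id ℝ E)
      ((extChartAt I (1 : G) ∘ Ψ) (g, g)) := smoothAt₁_model_iff.2 contDiffAt_const
  have h1 := (hid.pullback (hcomp g)).vertical
  have hdg : ContMDiff I (I.prod I) ∞ fun g : G => (g, g) := contMDiff_id.prodMk contMDiff_id
  refine isSmoothness₁.congr (h1.pullback (f := fun g : G => (g, g)) hdg.contMDiffAt)
    (Eventually.of_forall fun k => ?_)
  ext1 u
  have hΨk := (hΨ (k, k)).mdifferentiableAt (by simp)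
  have e1 := differential_comp ((hχ k).mdifferentiableAt (by simp)) hΨk
  have e2 : differential I I (fun h => Ψ (k, h)) k =
      (differential (I.prod I) I Ψ (k, k)).comp (ContinuousLinearMap.inr ℝ E E) := by
    have := differential_comp (f := fun h : G => (k, h)) (x := k) hΨk
      (mdifferentiableAt_const.prodMk mdifferentiableAt_id)
    change differential I I (fun h => Ψ (k, h)) k = _ at this
    rw [this, differential_prodMk (g := fun h : G => h) mdifferentiableAt_const
      mdifferentiableAt_id, differential_const, differential_id]
    rfl
  have : IsManifold I 1 G := IsManifold.of_le (n := ∞) (by simp)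
  have e3 : differential I (I.prod I) (fun g : G => (g, g)) k u = (u, u) := by
    rw [differential_prodMk (f := fun g : G => g) (g := fun g : G => g) mdifferentiableAt_id
      mdifferentiableAt_id, differential_id]
    rfl
  rw [pullback₁_apply, e3]
  simp only [ContinuousLinearMap.comp_apply, verticalProj_apply, pullback₁_apply, e1, e2, hdiag,
    differential_extChartAt_self]
  rfl

theorem smoothAt₁_thetaL (g : G) : SmoothAt₁ I (thetaL I : G → E →L[ℝ] E) g :=
  smoothAt₁_partial_diagonal (Ψ := fun z : G × G => z.1⁻¹ * z.2)
    (contMDiff_fst.inv.mul contMDiff_snd) (fun g => inv_mul_cancel g) g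

theorem smoothAt₁_thetaR (g : G) : SmoothAt₁ I (thetaR I : G → E →L[ℝ] E) g :=
  smoothAt₁_partial_diagonal (Ψ := fun z : G × G => z.2 * z.1⁻¹)
    (contMDiff_snd.mul contMDiff_fst.inv) (fun g => mul_inv_cancel g) g

end LieGroup

/-! ### Logarithmic derivatives of maps to an abelian Lie group -/

section Abelian

variable {E H E' H' E'' H'' : Type*}
  [NormedAddCommGroup E] [NormedSpace ℝ E] [TopologicalSpace H]
  [NormedAddCommGroup E'] [NormedSpace ℝ E'] [TopologicalSpace H']
  [NormedAddCommGroup E''] [NormedSpace ℝ E''] [TopologicalSpace H'']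
  {I : ModelWithCorners ℝ E H} {J : ModelWithCorners ℝ E' H'} {K : ModelWithCorners ℝ E'' H''}
  {T : Type*} [TopologicalSpace T] [ChartedSpace H T] [CommGroup T] [LieGroup I ∞ T]
  {M N : Type*} [TopologicalSpace M] [ChartedSpace H' M]
  [TopologicalSpace N] [ChartedSpace H'' N]

theorem adRep_of_comm (t : T) : adRep I t = ContinuousLinearMap.id ℝ E := by
  simp only [adRep, mul_inv_cancel_comm]
  exact differential_id _

/-- For an abelian group the adjoint representation is trivial, and `f ↦ f*θ` is additive. -/
theorem logForm_mul {f g : M → T} {x : M} (hf : ContMDiffAt J I ∞ f x)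
    (hg : ContMDiffAt J I ∞ g x) :
    logForm I J (fun y => f y * g y) x = logForm I J f x + logForm I J g x := by
  have h := pullback_thetaL_mul (hf.mdifferentiableAt (by simp)) (hg.mdifferentiableAt (by simp))
  rw [adRep_of_comm, ContinuousLinearMap.id_comp] at h
  exact h

theorem logForm_const (c : T) (x : M) : logForm I J (fun _ => c) x = 0 := by
  simp [logForm, pullback₁, differential_const]

theorem logForm_inv {f : M → T} {x : M} (hf : ContMDiffAt J I ∞ f x) :
    logForm I J (fun y => (f y)⁻¹) x = -logForm I J f x := by
  have h := logForm_mul hf hf.inv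
  simp only [mul_inv_cancel, logForm_const] at h
  exact (neg_eq_of_add_eq_zero_right h.symm).symm

theorem logForm_congr {f g : M → T} {x : M} (h : f =ᶠ[𝓝 x] g) :
    logForm I J f x = logForm I J g x := pullback₁_congr_map h _

theorem logForm_comp {f : M → N} {g : N → T} {x : M} (hg : ContMDiffAt K I ∞ g (f x))
    (hf : ContMDiffAt J K ∞ f x) :
    logForm I J (fun y => g (f y)) x = pullback₁ J K f (logForm I K g) x :=
  pullback₁_comp (hg.mdifferentiableAt (by simp)) (hf.mdifferentiableAt (by simp)) _

variable [I.Boundaryless] [J.Boundaryless] [IsManifold J ∞ M]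

theorem SmoothAt₁.logForm {f : M → T} {x : M} (hf : ContMDiffAt J I ∞ f x) :
    SmoothAt₁ J (logForm I J f) x := (smoothAt₁_thetaL (f x)).pullback hf

/-- The Maurer-Cartan form of an abelian group is closed: it is additive under multiplication, so
its derivative at `1`, applied to vectors of the two factors of `T × T`, vanishes. -/
theorem extDeriv₁_thetaL (t : T) : extDeriv₁ I (thetaL I : T → E →L[ℝ] E) t = 0 := by
  have hmul : (pullback₁ (I.prod I) I (fun z : T × T => z.1 * z.2) (thetaL I) :
      T × T → E × E →L[ℝ] E) =
      fun z => pullback₁ (I.prod I) I Prod.fst (thetaL I) z +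
        pullback₁ (I.prod I) I Prod.snd (thetaL I) z := by
    funext z
    rw [pullback_thetaL_mul mdifferentiableAt_fst mdifferentiableAt_snd, adRep_of_comm,
      ContinuousLinearMap.id_comp]
  have hL := fun z : T × T => extDeriv₁_pullback (contMDiff_mul_pair (I := I) z)
    (smoothAt₁_thetaL (z.1 * z.2))
  have h1 : extDeriv₁ I (thetaL I : T → E →L[ℝ] E) 1 = 0 := by
    ext u v
    have h := hL 1
    rw [hmul, extDeriv₁_add ((smoothAt₁_thetaL _).pullback contMDiffAt_fst)
      ((smoothAt₁_thetaL _).pullback contMDiffAt_snd),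
      extDeriv₁_pullback contMDiffAt_fst (smoothAt₁_thetaL _),
      extDeriv₁_pullback contMDiffAt_snd (smoothAt₁_thetaL _)] at h
    have hd : differential (I.prod I) I (fun z : T × T => z.1 * z.2) 1 =
        ContinuousLinearMap.fst ℝ E E + ContinuousLinearMap.snd ℝ E E := by
      rw [differential_mul mdifferentiableAt_fst mdifferentiableAt_snd, differential_fst,
        differential_snd]
      simp only [Prod.fst_one, Prod.snd_one, mul_one, one_mul]
      rw [differential_id]
      rfl
    have h' := DFunLike.congr_fun (DFunLike.congr_fun h (u, 0)) (0, v)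
    simp only [add_apply, pullback₂_apply, hd, differential_fst, differential_snd,
      ContinuousLinearMap.coe_fst', ContinuousLinearMap.coe_snd', Prod.fst_one, Prod.snd_one,
      mul_one, map_zero, add_zero, zero_add, zero_apply] at h'
    exact h'.symm
  have hleft : (pullback₁ I I (fun s : T => t⁻¹ * s) (thetaL I) : T → E →L[ℝ] E) = thetaL I := by
    funext s
    exact thetaL_comp_mul_left _ _
  rw [← hleft, extDeriv₁_pullback (contMDiff_mul_left).contMDiffAt (smoothAt₁_thetaL _),
    pullback₂, inv_mul_cancel, h1]
  ext u v; rfl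

/-- Logarithmic derivatives of maps to an abelian group are closed. -/
theorem extDeriv₁_logForm {f : M → T} {x : M} (hf : ContMDiffAt J I ∞ f x) :
    extDeriv₁ J (logForm I J f) x = 0 := by
  unfold logForm
  rw [extDeriv₁_pullback hf (smoothAt₁_thetaL _), pullback₂, extDeriv₁_thetaL]
  ext u v; rfl

end Abelian

/-! ### Averages over a partition of unity -/

section Average

variable {E H E' H' E'' H'' EM HM : Type*}
  [NormedAddCommGroup E] [NormedSpace ℝ E] [TopologicalSpace H]
  [NormedAddCommGroup E'] [NormedSpace ℝ E'] [TopologicalSpace H']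
  [NormedAddCommGroup EM] [NormedSpace ℝ EM] [TopologicalSpace HM]
  {I : ModelWithCorners ℝ E H} {J : ModelWithCorners ℝ E' H'} {IM : ModelWithCorners ℝ EM HM}
  {M X Z : Type*} [TopologicalSpace M] [ChartedSpace HM M]
  [TopologicalSpace X] [ChartedSpace H X] [TopologicalSpace Z] [ChartedSpace H' Z]
  {V W : Type*} [NormedAddCommGroup V] [NormedSpace ℝ V] [AddCommGroup W] [Module ℝ W]
  {ι : Type*} (ψ : SmoothPartitionOfUnity ι IM M univ) (q : X → M)

/-- The average of the fields `f i` on `X`, with weights pulled back along `q : X → M` from a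
partition of unity on `M`. -/
def average (f : ι → X → W) : X → W := fun x => ∑ᶠ i, ψ i (q x) • f i x

variable {ψ q}

theorem average_eq_sum (f : ι → X → W) (x : X) :
    average ψ q f x = ∑ i ∈ ψ.finsupport (q x), ψ i (q x) • f i x :=
  (ψ.sum_finsupport_smul_eq_finsum (x₀ := q x) (fun i _ => f i x)).symm

theorem sum_finsupport_smul_eq {g : ι → W} {w : W} {m : M}
    (h : ∀ i, m ∈ tsupport (ψ i) → g i = w) : ∑ i ∈ ψ.finsupport m, ψ i m • g i = w := by
  rw [Finset.sum_congr rfl (g := fun i => ψ i m • w), ← Finset.sum_smul,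
    ψ.sum_finsupport m (mem_univ m), one_smul]
  intro i hi
  rw [h i (subset_tsupport _ ((ψ.mem_finsupport m).1 hi))]

/-- An average is smooth as soon as `f i` is smooth over the set to which `ψ i` is subordinate. -/
theorem IsSmoothness.average {S : (X → W) → X → Prop} (hS : IsSmoothness I S)
    (hq : ContMDiff I IM ∞ q) {U : ι → Set M} (hψ : ψ.IsSubordinate U) {f : ι → X → W} {x : X}
    (hf : ∀ i, q x ∈ U i → S (f i) x) : S (average ψ q f) x := by
  refine hS.finsum_smul (ψ := fun i x => ψ i (q x)) (fun i => (ψ i).contMDiff.comp hq)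
    (ψ.locallyFinite.preimage_continuous hq.continuous) fun i hi => hf i (hψ i ?_)
  have h : tsupport (fun x => ψ i (q x)) ⊆ q ⁻¹' tsupport (ψ i) :=
    closure_minimal (fun y hy => subset_tsupport (ψ i) hy)
      ((isClosed_tsupport (ψ i)).preimage hq.continuous)
  exact h hi

theorem pullback₁_average_apply (f : Z → X) (F : ι → X → E →L[ℝ] V) (z : Z) (u : E') :
    pullback₁ J I f (average ψ q F) z u =
      ∑ i ∈ ψ.finsupport (q (f z)), ψ i (q (f z)) • pullback₁ J I f (F i) z u := by
  rw [pullback₁_apply, average_eq_sum]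
  simp [pullback₁_apply]

theorem pullback₂_average_apply (f : Z → X) (F : ι → X → E →L[ℝ] E →L[ℝ] V) (z : Z) (u v : E') :
    pullback₂ J I f (average ψ q F) z u v =
      ∑ i ∈ ψ.finsupport (q (f z)), ψ i (q (f z)) • pullback₂ J I f (F i) z u v := by
  rw [pullback₂_apply, average_eq_sum]
  simp [pullback₂_apply]

end Average

/-! ### Principal bundles and forms on the nerve of the action groupoid -/

section Bundle

variable {EM HM EP HP EG HG : Type*}
  [NormedAddCommGroup EM] [NormedSpace ℝ EM] [TopologicalSpace HM]
  [NormedAddCommGroup EP] [NormedSpace ℝ EP] [TopologicalSpace HP]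
  [NormedAddCommGroup EG] [NormedSpace ℝ EG] [TopologicalSpace HG]
  {IM : ModelWithCorners ℝ EM HM} {IP : ModelWithCorners ℝ EP HP} {IG : ModelWithCorners ℝ EG HG}
  {M P G : Type*} [TopologicalSpace M] [ChartedSpace HM M] [TopologicalSpace P] [ChartedSpace HP P]
  [TopologicalSpace G] [ChartedSpace HG G] [Group G] [LieGroup IG ∞ G]
  {V : Type*} [NormedAddCommGroup V] [NormedSpace ℝ V]
  (Q : PrincipalBundle IM IP IG M P G)

namespace PrincipalBundle

/-- A local trivialization of a principal bundle over the open set `U`, given by the section `s`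
and the equivariant map `h : P → G` with `p = s (π p) · h p`. -/
structure LocalTriv where
  U : Set M
  s : M → P
  h : P → G
  isOpen : IsOpen U
  smooth_s : ∀ m ∈ U, ContMDiffAt IM IP ∞ s m
  smooth_h : ∀ p, Q.proj p ∈ U → ContMDiffAt IP IG ∞ h p
  proj_s : ∀ m ∈ U, Q.proj (s m) = m
  act_s_h : ∀ p, Q.proj p ∈ U → Q.act (s (Q.proj p), h p) = p
  h_act : ∀ p, Q.proj p ∈ U → ∀ g, h (Q.act (p, g)) = h p * g

/-- The equivariant trivializations of the definition give sections together with the comparison map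
`h` to the group. -/
theorem exists_localTriv (x : M) : ∃ t : Q.LocalTriv, x ∈ t.U := by
  obtain ⟨e, hx, he, he', hact⟩ := Q.locallyTrivial x
  have hsrc : ∀ p, Q.proj p ∈ e.baseSet → p ∈ e.source := fun p hp => e.mem_source.2 hp
  have htgt : ∀ m ∈ e.baseSet, ∀ g : G, (m, g) ∈ e.target := fun m hm g => e.mem_target.2 hm
  have hps : ∀ m ∈ e.baseSet, Q.proj (e.toOpenPartialHomeomorph.symm (m, 1)) = m :=
    fun m hm => e.proj_symm_apply (htgt m hm 1)
  refine ⟨⟨e.baseSet, fun m => e.toOpenPartialHomeomorph.symm (m, 1), fun p => (e p).2,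
    e.open_baseSet, fun m hm => ?_, fun p hp => ?_, hps, fun p hp => ?_,
    fun p hp g => hact p (hsrc p hp) g⟩, hx⟩
  · have h1 := he'.contMDiffAt (e.open_target.mem_nhds (htgt m hm 1))
    exact h1.comp m (contMDiffAt_id.prodMk contMDiffAt_const)
  · exact (he.contMDiffAt (e.open_source.mem_nhds (hsrc p hp))).snd
  · set p' := e.toOpenPartialHomeomorph.symm (Q.proj p, 1) with hp'
    have hpp : Q.proj p' = Q.proj p := hps _ hp
    have hps' : p' ∈ e.source := hsrc _ (hpp ▸ hp)
    have h2 : (e p').2 = 1 := by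
      rw [hp']; exact congrArg Prod.snd (e.apply_symm_apply (htgt _ hp 1))
    have hpr : Q.proj (Q.act (p', (e p).2)) = Q.proj p := by rw [Q.proj_act, hpp]
    have hs1 : Q.act (p', (e p).2) ∈ e.source := hsrc _ (hpr ▸ hp)
    refine e.injOn hs1 (hsrc p hp) (Prod.ext ?_ ?_)
    · exact ((e.coe_fst hs1).trans hpr).trans (e.coe_fst (hsrc p hp)).symm
    · exact (hact p' hps' _).trans (by rw [h2, one_mul]; rfl)

theorem contMDiff_face₁ (j : Fin 2) : ContMDiff (IP.prod IG) IP ∞ (Q.face₁ j) := by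
  fin_cases j
  · exact Q.smooth_act
  · exact contMDiff_fst

theorem contMDiff_face₂ (j : Fin 3) :
    ContMDiff (IP.prod (IG.prod IG)) (IP.prod IG) ∞ (Q.face₂ j) := by
  fin_cases j
  · exact (Q.smooth_act.comp (contMDiff_fst.prodMk (contMDiff_fst.comp contMDiff_snd))).prodMk
      (contMDiff_snd.comp contMDiff_snd)
  · exact contMDiff_fst.prodMk (contMDiff_mul_pair.comp contMDiff_snd)
  · exact contMDiff_fst.prodMk (contMDiff_fst.comp contMDiff_snd)

theorem contMDiff_face₃ (j : Fin 4) :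
    ContMDiff (IP.prod (IG.prod (IG.prod IG))) (IP.prod (IG.prod IG)) ∞ (Q.face₃ j) := by
  have h1 : ContMDiff (IP.prod (IG.prod (IG.prod IG))) IG ∞
      fun x : P × G × G × G => x.2.1 := contMDiff_fst.comp contMDiff_snd
  have h2 : ContMDiff (IP.prod (IG.prod (IG.prod IG))) IG ∞
      fun x : P × G × G × G => x.2.2.1 := contMDiff_fst.comp (contMDiff_snd.comp contMDiff_snd)
  have h3 : ContMDiff (IP.prod (IG.prod (IG.prod IG))) IG ∞
      fun x : P × G × G × G => x.2.2.2 := contMDiff_snd.comp (contMDiff_snd.comp contMDiff_snd)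
  fin_cases j
  · exact (Q.smooth_act.comp (contMDiff_fst.prodMk h1)).prodMk (h2.prodMk h3)
  · exact contMDiff_fst.prodMk ((h1.mul h2).prodMk h3)
  · exact contMDiff_fst.prodMk (h1.prodMk (h2.mul h3))
  · exact contMDiff_fst.prodMk (h1.prodMk h2)

namespace LocalTriv

variable {Q} (t : Q.LocalTriv)

/-- The extra degeneracy `P → P × G` defined by a local trivialization. -/
def homotopy₀ (p : P) : P × G := (t.s (Q.proj p), t.h p)

/-- The extra degeneracy `P × G → P × G²` defined by a local trivialization. -/
def homotopy₁ (z : P × G) : P × G × G := (t.s (Q.proj z.1), t.h z.1, z.2)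

/-- The extra degeneracy `P × G² → P × G³` defined by a local trivialization. -/
def homotopy₂ (z : P × G × G) : P × G × G × G := (t.s (Q.proj z.1), t.h z.1, z.2)

theorem smooth_homotopy₀ {p : P} (hp : Q.proj p ∈ t.U) :
    ContMDiffAt IP (IP.prod IG) ∞ t.homotopy₀ p :=
  ((t.smooth_s _ hp).comp p (Q.smooth_proj p)).prodMk (t.smooth_h p hp)

theorem smooth_homotopy₁ {z : P × G} (hz : Q.proj z.1 ∈ t.U) :
    ContMDiffAt (IP.prod IG) (IP.prod (IG.prod IG)) ∞ t.homotopy₁ z :=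
  (((t.smooth_s _ hz).comp z.1 (Q.smooth_proj z.1)).comp z contMDiffAt_fst).prodMk
    (((t.smooth_h _ hz).comp z contMDiffAt_fst).prodMk contMDiffAt_snd)

theorem smooth_homotopy₂ {z : P × G × G} (hz : Q.proj z.1 ∈ t.U) :
    ContMDiffAt (IP.prod (IG.prod IG)) (IP.prod (IG.prod (IG.prod IG))) ∞ t.homotopy₂ z :=
  (((t.smooth_s _ hz).comp z.1 (Q.smooth_proj z.1)).comp z contMDiffAt_fst).prodMk
    (((t.smooth_h _ hz).comp z contMDiffAt_fst).prodMk contMDiffAt_snd)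

theorem eventually_mem {p : P} (hp : Q.proj p ∈ t.U) : ∀ᶠ y in 𝓝 p, Q.proj y ∈ t.U :=
  Q.smooth_proj.continuous.continuousAt (t.isOpen.mem_nhds hp)

theorem eventually_mem_prod {X : Type*} [TopologicalSpace X] {z : P × X}
    (hz : Q.proj z.1 ∈ t.U) : ∀ᶠ y in 𝓝 z, Q.proj y.1 ∈ t.U :=
  continuous_fst.continuousAt (t.eventually_mem hz)

/-- The maps `homotopy₀`, `homotopy₁` and `homotopy₂` form an extra degeneracy of the part of the
action groupoid over `U`: the face `d₀` undoes them, and they commute with the other faces up to a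
shift of the degree. -/
theorem face_homotopy₀ {p : P} (hp : Q.proj p ∈ t.U) :
    Q.act ∘ t.homotopy₀ =ᶠ[𝓝 p] fun p => p := by
  filter_upwards [t.eventually_mem hp] with y hy using t.act_s_h y hy

theorem face_zero_homotopy₁ {z : P × G} (hz : Q.proj z.1 ∈ t.U) :
    Q.face₂ 0 ∘ t.homotopy₁ =ᶠ[𝓝 z] fun z => z := by
  filter_upwards [t.eventually_mem_prod hz] with y hy
  exact Prod.ext (t.act_s_h y.1 hy) rfl

theorem face_one_homotopy₁ {z : P × G} (hz : Q.proj z.1 ∈ t.U) :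
    Q.face₂ 1 ∘ t.homotopy₁ =ᶠ[𝓝 z] t.homotopy₀ ∘ Q.face₁ 0 := by
  filter_upwards [t.eventually_mem_prod hz] with y hy
  exact Prod.ext (congrArg t.s (Q.proj_act y.1 y.2).symm) (t.h_act y.1 hy y.2).symm

theorem face_two_homotopy₁ : Q.face₂ 2 ∘ t.homotopy₁ = t.homotopy₀ ∘ Q.face₁ 1 := rfl

theorem face_zero_homotopy₂ {z : P × G × G} (hz : Q.proj z.1 ∈ t.U) :
    Q.face₃ 0 ∘ t.homotopy₂ =ᶠ[𝓝 z] fun z => z := by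
  filter_upwards [t.eventually_mem_prod hz] with y hy
  exact Prod.ext (t.act_s_h y.1 hy) rfl

theorem face_one_homotopy₂ {z : P × G × G} (hz : Q.proj z.1 ∈ t.U) :
    Q.face₃ 1 ∘ t.homotopy₂ =ᶠ[𝓝 z] t.homotopy₁ ∘ Q.face₂ 0 := by
  filter_upwards [t.eventually_mem_prod hz] with y hy
  exact Prod.ext (congrArg t.s (Q.proj_act y.1 y.2.1).symm)
    (Prod.ext (t.h_act y.1 hy y.2.1).symm rfl)

theorem face_two_homotopy₂ : Q.face₃ 2 ∘ t.homotopy₂ = t.homotopy₁ ∘ Q.face₂ 1 := rfl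

theorem face_three_homotopy₂ : Q.face₃ 3 ∘ t.homotopy₂ = t.homotopy₁ ∘ Q.face₂ 2 := rfl

end LocalTriv

/-- The differential of `π` has a right inverse over each point of `M`, given by a local section, so
that pullback along `π` is injective. -/
theorem exists_section_differential (m : M) : ∃ p, Q.proj p = m ∧ ∃ L : EM →L[ℝ] EP,
    (differential IP IM Q.proj p).comp L = ContinuousLinearMap.id ℝ EM := by
  obtain ⟨t, hm⟩ := Q.exists_localTriv m
  refine ⟨t.s m, t.proj_s m hm, differential IM IP t.s m, ?_⟩
  rw [← differential_comp (Q.smooth_proj.mdifferentiableAt (by simp))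
    ((t.smooth_s m hm).mdifferentiableAt (by simp)), ← differential_id (I := IM) m]
  refine differential_congr ?_
  filter_upwards [t.isOpen.mem_nhds hm] with y hy using t.proj_s y hy

theorem pullback₁_proj_injective {τ τ' : M → EM →L[ℝ] V}
    (h : ∀ p, pullback₁ IP IM Q.proj τ p = pullback₁ IP IM Q.proj τ' p) : τ = τ' := by
  funext m
  obtain ⟨p, rfl, L, hL⟩ := Q.exists_section_differential m
  ext u
  have := DFunLike.congr_fun (h p) (L u)
  have hL' : differential IP IM Q.proj p (L u) = u := DFunLike.congr_fun hL u
  simpa only [pullback₁_apply, hL'] using this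

theorem pullback₂_proj_injective {τ τ' : M → EM →L[ℝ] EM →L[ℝ] V}
    (h : ∀ p, pullback₂ IP IM Q.proj τ p = pullback₂ IP IM Q.proj τ' p) : τ = τ' := by
  funext m
  obtain ⟨p, rfl, L, hL⟩ := Q.exists_section_differential m
  ext u v
  have := DFunLike.congr_fun (DFunLike.congr_fun (h p) (L u)) (L v)
  have hL' : ∀ u, differential IP IM Q.proj p (L u) = u := fun u => DFunLike.congr_fun hL u
  simpa only [pullback₂_apply, hL'] using this

variable [IM.Boundaryless] [IP.Boundaryless] [IG.Boundaryless]
  [IsManifold IM ∞ M] [IsManifold IP ∞ P]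
  [FiniteDimensional ℝ EM] [T2Space M] [SigmaCompactSpace M]

/-- A partition of unity of `M` subordinate to a cover by the bases of local trivializations. -/
theorem exists_trivializing_partition : ∃ (t : M → Q.LocalTriv)
    (ψ : SmoothPartitionOfUnity M IM M univ), ψ.IsSubordinate fun i => (t i).U := by
  choose t ht using Q.exists_localTriv
  obtain ⟨ψ, hψ⟩ := IsSmoothness.exists_partition (I := IM) (U := fun i => (t i).U)
    ⟨fun i => (t i).isOpen, fun x => ⟨x, ht x⟩⟩
  exact ⟨t, ψ, hψ⟩

/-- A `1`-form on `P` with equal pullbacks to `P × G` descends to `M`. -/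
theorem descend₁ {a : P → EP →L[ℝ] V} (ha : ∀ p, SmoothAt₁ IP a p)
    (h : ∀ z, pullback₁ (IP.prod IG) IP Q.act a z = pullback₁ (IP.prod IG) IP Prod.fst a z) :
    ∃ τ : M → EM →L[ℝ] V, (∀ m, SmoothAt₁ IM τ m) ∧ ∀ p, pullback₁ IP IM Q.proj τ p = a p := by
  obtain ⟨t, ψ, hψ⟩ := Q.exists_trivializing_partition
  refine ⟨average ψ (fun m => m) fun i => pullback₁ IM IP (t i).s a, fun m => ?_, fun p => ?_⟩
  · exact isSmoothness₁.average contMDiff_id hψ fun i hi => (ha _).pullback ((t i).smooth_s m hi)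
  · ext u
    rw [pullback₁_average_apply]
    refine sum_finsupport_smul_eq fun i hi => ?_
    have hU : Q.proj p ∈ (t i).U := hψ i hi
    have hS := ((t i).smooth_homotopy₀ hU).mdifferentiableAt (by simp)
    have hs : (t i).s ∘ Q.proj = Prod.fst ∘ (t i).homotopy₀ := rfl
    rw [← pullback₁_comp (((t i).smooth_s _ hU).mdifferentiableAt (by simp))
      (Q.smooth_proj.mdifferentiableAt (by simp)), hs,
      pullback₁_comp mdifferentiableAt_fst hS, pullback₁_apply, ← h, ← pullback₁_apply,
      ← pullback₁_comp (Q.smooth_act.mdifferentiableAt (by simp)) hS,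
      pullback₁_congr_map ((t i).face_homotopy₀ hU), pullback₁_apply, differential_id]
    rfl

/-- A field of bilinear forms on `P` with equal pullbacks to `P × G` descends to `M`. -/
theorem descend₂ {a : P → EP →L[ℝ] EP →L[ℝ] V} (ha : ∀ p, SmoothAt₂ IP a p)
    (h : ∀ z, pullback₂ (IP.prod IG) IP Q.act a z = pullback₂ (IP.prod IG) IP Prod.fst a z) :
    ∃ τ : M → EM →L[ℝ] EM →L[ℝ] V, (∀ m, SmoothAt₂ IM τ m) ∧
      ∀ p, pullback₂ IP IM Q.proj τ p = a p := by
  obtain ⟨t, ψ, hψ⟩ := Q.exists_trivializing_partition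
  refine ⟨average ψ (fun m => m) fun i => pullback₂ IM IP (t i).s a, fun m => ?_, fun p => ?_⟩
  · exact isSmoothness₂.average contMDiff_id hψ fun i hi => (ha _).pullback ((t i).smooth_s m hi)
  · ext u v
    rw [pullback₂_average_apply]
    refine sum_finsupport_smul_eq fun i hi => ?_
    have hU : Q.proj p ∈ (t i).U := hψ i hi
    have hS := ((t i).smooth_homotopy₀ hU).mdifferentiableAt (by simp)
    have hs : (t i).s ∘ Q.proj = Prod.fst ∘ (t i).homotopy₀ := rfl
    rw [← pullback₂_comp (((t i).smooth_s _ hU).mdifferentiableAt (by simp))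
      (Q.smooth_proj.mdifferentiableAt (by simp)), hs,
      pullback₂_comp mdifferentiableAt_fst hS, pullback₂_apply, ← h, ← pullback₂_apply,
      ← pullback₂_comp (Q.smooth_act.mdifferentiableAt (by simp)) hS,
      pullback₂_congr_map ((t i).face_homotopy₀ hU), pullback₂_apply, differential_id]
    rfl

/-- Exactness of the complex of `1`-forms on the nerve of the action groupoid at `P × G`. -/
theorem exists_primitive₁ {a : P × G → EP × EG →L[ℝ] V} (ha : ∀ z, SmoothAt₁ (IP.prod IG) a z)
    (h : ∀ z, pullback₁ (IP.prod (IG.prod IG)) (IP.prod IG) (Q.face₂ 1) a z =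
      pullback₁ (IP.prod (IG.prod IG)) (IP.prod IG) (Q.face₂ 0) a z +
        pullback₁ (IP.prod (IG.prod IG)) (IP.prod IG) (Q.face₂ 2) a z) :
    ∃ e : P → EP →L[ℝ] V, (∀ p, SmoothAt₁ IP e p) ∧
      ∀ z, pullback₁ (IP.prod IG) IP (Q.face₁ 0) e z =
        pullback₁ (IP.prod IG) IP (Q.face₁ 1) e z + a z := by
  obtain ⟨t, ψ, hψ⟩ := Q.exists_trivializing_partition
  refine ⟨average ψ Q.proj fun i => pullback₁ IP (IP.prod IG) (t i).homotopy₀ a, fun p => ?_,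
    fun z => ?_⟩
  · exact isSmoothness₁.average Q.smooth_proj hψ fun i hi =>
      (ha _).pullback ((t i).smooth_homotopy₀ hi)
  · refine ContinuousLinearMap.ext fun u => ?_
    rw [add_apply, ← sub_eq_iff_eq_add', pullback₁_average_apply, pullback₁_average_apply]
    have hz0 : Q.proj (Q.face₁ 0 z) = Q.proj z.1 := Q.proj_act z.1 z.2
    have hz1 : Q.proj (Q.face₁ 1 z) = Q.proj z.1 := rfl
    rw [hz0, hz1, ← Finset.sum_sub_distrib]
    simp only [← smul_sub]
    refine sum_finsupport_smul_eq fun i hi => ?_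
    have hU : Q.proj z.1 ∈ (t i).U := hψ i hi
    have hS := ((t i).smooth_homotopy₁ hU).mdifferentiableAt (by simp)
    have hd := fun j => (Q.contMDiff_face₁ j).mdifferentiableAt (x := z) (by simp)
    have hD := fun j => (Q.contMDiff_face₂ j).mdifferentiableAt (x := (t i).homotopy₁ z) (by simp)
    rw [← pullback₁_comp (((t i).smooth_homotopy₀ (hz0 ▸ hU)).mdifferentiableAt (by simp)) (hd 0),
      ← pullback₁_comp (((t i).smooth_homotopy₀ (hz1 ▸ hU)).mdifferentiableAt (by simp)) (hd 1),
      ← pullback₁_congr_map ((t i).face_one_homotopy₁ hU), ← (t i).face_two_homotopy₁,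
      pullback₁_comp (hD 1) hS, pullback₁_comp (hD 2) hS]
    have h0 : pullback₁ (IP.prod IG) (IP.prod IG) (Q.face₂ 0 ∘ (t i).homotopy₁) a z u = a z u := by
      rw [pullback₁_congr_map ((t i).face_zero_homotopy₁ hU), pullback₁_apply, differential_id]
      rfl
    rw [pullback₁_comp (hD 0) hS] at h0
    rw [← h0]
    simp only [pullback₁_apply _ (pullback₁ _ _ (Q.face₂ _) a), h, add_apply]
    abel

/-- Exactness of the complex of `2`-forms on the nerve of the action groupoid at `P × G`. -/
theorem exists_primitive₂ {a : P × G → EP × EG →L[ℝ] EP × EG →L[ℝ] V}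
    (ha : ∀ z, SmoothAltAt (IP.prod IG) a z)
    (h : ∀ z, pullback₂ (IP.prod (IG.prod IG)) (IP.prod IG) (Q.face₂ 1) a z =
      pullback₂ (IP.prod (IG.prod IG)) (IP.prod IG) (Q.face₂ 0) a z +
        pullback₂ (IP.prod (IG.prod IG)) (IP.prod IG) (Q.face₂ 2) a z) :
    ∃ e : P → EP →L[ℝ] EP →L[ℝ] V, (∀ p, SmoothAltAt IP e p) ∧
      ∀ z, pullback₂ (IP.prod IG) IP (Q.face₁ 0) e z =
        pullback₂ (IP.prod IG) IP (Q.face₁ 1) e z + a z := by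
  obtain ⟨t, ψ, hψ⟩ := Q.exists_trivializing_partition
  refine ⟨average ψ Q.proj fun i => pullback₂ IP (IP.prod IG) (t i).homotopy₀ a, fun p => ?_,
    fun z => ?_⟩
  · exact isSmoothnessAlt.average Q.smooth_proj hψ fun i hi =>
      (ha _).pullback ((t i).smooth_homotopy₀ hi)
  · refine ContinuousLinearMap.ext fun u => ContinuousLinearMap.ext fun v => ?_
    rw [add_apply, add_apply, ← sub_eq_iff_eq_add', pullback₂_average_apply,
      pullback₂_average_apply]
    have hz0 : Q.proj (Q.face₁ 0 z) = Q.proj z.1 := Q.proj_act z.1 z.2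
    have hz1 : Q.proj (Q.face₁ 1 z) = Q.proj z.1 := rfl
    rw [hz0, hz1, ← Finset.sum_sub_distrib]
    simp only [← smul_sub]
    refine sum_finsupport_smul_eq fun i hi => ?_
    have hU : Q.proj z.1 ∈ (t i).U := hψ i hi
    have hS := ((t i).smooth_homotopy₁ hU).mdifferentiableAt (by simp)
    have hd := fun j => (Q.contMDiff_face₁ j).mdifferentiableAt (x := z) (by simp)
    have hD := fun j => (Q.contMDiff_face₂ j).mdifferentiableAt (x := (t i).homotopy₁ z) (by simp)
    rw [← pullback₂_comp (((t i).smooth_homotopy₀ (hz0 ▸ hU)).mdifferentiableAt (by simp)) (hd 0),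
      ← pullback₂_comp (((t i).smooth_homotopy₀ (hz1 ▸ hU)).mdifferentiableAt (by simp)) (hd 1),
      ← pullback₂_congr_map ((t i).face_one_homotopy₁ hU), ← (t i).face_two_homotopy₁,
      pullback₂_comp (hD 1) hS, pullback₂_comp (hD 2) hS]
    have h0 : pullback₂ (IP.prod IG) (IP.prod IG) (Q.face₂ 0 ∘ (t i).homotopy₁) a z u v =
        a z u v := by
      rw [pullback₂_congr_map ((t i).face_zero_homotopy₁ hU), pullback₂_apply, differential_id]
      rfl
    rw [pullback₂_comp (hD 0) hS] at h0
    rw [← h0]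
    simp only [pullback₂_apply _ (pullback₂ _ _ (Q.face₂ _) a), h, add_apply]
    abel

/-- Exactness of the complex of `1`-forms on the nerve of the action groupoid at `P × G²`. -/
theorem exists_primitive₁_double {a : P × G × G → EP × EG × EG →L[ℝ] V}
    (ha : ∀ z, SmoothAt₁ (IP.prod (IG.prod IG)) a z)
    (h : ∀ z, pullback₁ (IP.prod (IG.prod (IG.prod IG))) (IP.prod (IG.prod IG)) (Q.face₃ 0) a z +
        pullback₁ (IP.prod (IG.prod (IG.prod IG))) (IP.prod (IG.prod IG)) (Q.face₃ 2) a z =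
      pullback₁ (IP.prod (IG.prod (IG.prod IG))) (IP.prod (IG.prod IG)) (Q.face₃ 1) a z +
        pullback₁ (IP.prod (IG.prod (IG.prod IG))) (IP.prod (IG.prod IG)) (Q.face₃ 3) a z) :
    ∃ e : P × G → EP × EG →L[ℝ] V, (∀ z, SmoothAt₁ (IP.prod IG) e z) ∧
      ∀ z, pullback₁ (IP.prod (IG.prod IG)) (IP.prod IG) (Q.face₂ 0) e z +
          pullback₁ (IP.prod (IG.prod IG)) (IP.prod IG) (Q.face₂ 2) e z =
        pullback₁ (IP.prod (IG.prod IG)) (IP.prod IG) (Q.face₂ 1) e z + a z := by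
  obtain ⟨t, ψ, hψ⟩ := Q.exists_trivializing_partition
  have hπ : ContMDiff (IP.prod IG) IM ∞ fun z : P × G => Q.proj z.1 :=
    Q.smooth_proj.comp contMDiff_fst
  refine ⟨average ψ (fun z => Q.proj z.1) fun i =>
    pullback₁ (IP.prod IG) (IP.prod (IG.prod IG)) (t i).homotopy₁ a, fun p => ?_, fun z => ?_⟩
  · exact isSmoothness₁.average hπ hψ fun i hi => (ha _).pullback ((t i).smooth_homotopy₁ hi)
  · refine ContinuousLinearMap.ext fun u => ?_
    rw [add_apply, add_apply, ← sub_eq_iff_eq_add', pullback₁_average_apply,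
      pullback₁_average_apply, pullback₁_average_apply]
    have hz0 : Q.proj (Q.face₂ 0 z).1 = Q.proj z.1 := Q.proj_act z.1 z.2.1
    have hz1 : Q.proj (Q.face₂ 1 z).1 = Q.proj z.1 := rfl
    have hz2 : Q.proj (Q.face₂ 2 z).1 = Q.proj z.1 := rfl
    rw [hz0, hz1, hz2, ← Finset.sum_add_distrib, ← Finset.sum_sub_distrib]
    simp only [← smul_sub, ← smul_add]
    refine sum_finsupport_smul_eq fun i hi => ?_
    have hU : Q.proj z.1 ∈ (t i).U := hψ i hi
    have hS := ((t i).smooth_homotopy₂ hU).mdifferentiableAt (by simp)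
    have hd := fun j => (Q.contMDiff_face₂ j).mdifferentiableAt (x := z) (by simp)
    have hD := fun j => (Q.contMDiff_face₃ j).mdifferentiableAt (x := (t i).homotopy₂ z) (by simp)
    rw [← pullback₁_comp (((t i).smooth_homotopy₁ (hz0 ▸ hU)).mdifferentiableAt (by simp)) (hd 0),
      ← pullback₁_comp (((t i).smooth_homotopy₁ (hz1 ▸ hU)).mdifferentiableAt (by simp)) (hd 1),
      ← pullback₁_comp (((t i).smooth_homotopy₁ (hz2 ▸ hU)).mdifferentiableAt (by simp)) (hd 2),
      ← pullback₁_congr_map ((t i).face_one_homotopy₂ hU), ← (t i).face_two_homotopy₂,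
      ← (t i).face_three_homotopy₂,
      pullback₁_comp (hD 1) hS, pullback₁_comp (hD 2) hS, pullback₁_comp (hD 3) hS]
    have h0 : pullback₁ (IP.prod (IG.prod IG)) (IP.prod (IG.prod IG))
        (Q.face₃ 0 ∘ (t i).homotopy₂) a z u = a z u := by
      rw [pullback₁_congr_map ((t i).face_zero_homotopy₂ hU), pullback₁_apply, differential_id]
      rfl
    rw [pullback₁_comp (hD 0) hS] at h0
    rw [← h0]
    have h' := DFunLike.congr_fun (h ((t i).homotopy₂ z))
      (differential (IP.prod (IG.prod IG)) (IP.prod (IG.prod (IG.prod IG))) (t i).homotopy₂ z u)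
    simp only [add_apply] at h'
    simp only [pullback₁_apply _ (pullback₁ _ _ (Q.face₃ _) a)]
    rw [sub_eq_iff_eq_add, h']

variable [FiniteDimensional ℝ EP] [T2Space P]

/-- A principal bundle admits a connection: average the flat connections of local
trivializations. -/
theorem nonempty_connection : Nonempty Q.Connection := by
  obtain ⟨t, ψ, hψ⟩ := Q.exists_trivializing_partition
  set A : P → EP →L[ℝ] EG := average ψ Q.proj fun i => pullback₁ IP IG (t i).h (thetaL IG) with hA
  have hAs : ∀ p, SmoothAt₁ IP A p := fun p =>
    isSmoothness₁.average Q.smooth_proj hψ fun i hi =>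
      (smoothAt₁_thetaL _).pullback ((t i).smooth_h p hi)
  refine ⟨⟨⟨A, (smoothOn₁_iff isOpen_univ).2 fun p _ => hAs p, fun p hp => (hp trivial).elim⟩,
    fun z => ?_⟩⟩
  refine ContinuousLinearMap.ext fun u => ?_
  change pullback₁ (IP.prod IG) IP Q.act A z u =
    adRep IG z.2⁻¹ (pullback₁ (IP.prod IG) IP Prod.fst A z u) +
      pullback₁ (IP.prod IG) IG Prod.snd (thetaL IG) z u
  have hz0 : Q.proj (Q.act z) = Q.proj z.1 := Q.proj_act z.1 z.2
  rw [← sub_eq_iff_eq_add', hA, pullback₁_average_apply, pullback₁_average_apply, hz0, map_sum,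
    ← Finset.sum_sub_distrib]
  simp only [map_smul, ← smul_sub]
  refine sum_finsupport_smul_eq fun i hi => ?_
  have hU : Q.proj z.1 ∈ (t i).U := hψ i hi
  have hh := ((t i).smooth_h _ hU).mdifferentiableAt (by simp)
  have e : (t i).h ∘ Q.act =ᶠ[𝓝 z] fun z => (t i).h z.1 * z.2 := by
    filter_upwards [(t i).eventually_mem_prod hU] with y hy using (t i).h_act y.1 hy y.2
  rw [← pullback₁_comp (((t i).smooth_h _ (hz0 ▸ hU)).mdifferentiableAt (by simp))
    (Q.smooth_act.mdifferentiableAt (by simp)), pullback₁_congr_map e,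
    pullback_thetaL_mul (f := fun z : P × G => (t i).h z.1) (hh.comp z mdifferentiableAt_fst)
      mdifferentiableAt_snd, ← pullback₁_comp hh mdifferentiableAt_fst, add_apply,
    ContinuousLinearMap.comp_apply, sub_eq_iff_eq_add']
  rfl

end PrincipalBundle

end Bundle

/-! ### Cocycles of bilinear forms on a group -/

section Cocycle

variable {Γ E V : Type*} [Group Γ] [NormedAddCommGroup E] [NormedSpace ℝ E]
  [NormedAddCommGroup V] [NormedSpace ℝ V]

/-- Left-trivialized form of the condition that a field of bilinear forms on `Γ × Γ` is closed for
the simplicial differential of the nerve of `Γ`, where `r h` plays the role of `Ad(h⁻¹)`. -/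
def IsTrivializedCocycle (r : Γ → E →L[ℝ] E) (B : Γ → Γ → E × E →L[ℝ] E × E →L[ℝ] V) : Prop :=
  ∀ g h k X₁ X₂ X₃ Y₁ Y₂ Y₃,
    B h k (X₂, X₃) (Y₂, Y₃) - B (g * h) k (r h X₁ + X₂, X₃) (r h Y₁ + Y₂, Y₃) +
      B g (h * k) (X₁, r k X₂ + X₃) (Y₁, r k Y₂ + Y₃) - B g h (X₁, X₂) (Y₁, Y₂) = 0

variable {r : Γ → E →L[ℝ] E} {B : Γ → Γ → E × E →L[ℝ] E × E →L[ℝ] V}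

theorem IsTrivializedCocycle.apply_one_left (hr : ∀ X, r 1 X = X)
    (hB : IsTrivializedCocycle r B) (h : Γ) (X Y : E) : B 1 h (0, X) (0, Y) = 0 := by
  simpa [hr, ← Prod.zero_eq_mk] using hB 1 1 h 0 0 X 0 0 Y

/-- Expansion of a bilinear form on `E × E` into its four components. -/
theorem prod_bilinear_expand (b : E × E →L[ℝ] E × E →L[ℝ] V) (X₁ X₂ Y₁ Y₂ : E) :
    b (X₁, X₂) (Y₁, Y₂) = b (X₁, 0) (Y₁, 0) + b (X₁, 0) (0, Y₂) + b (0, X₂) (Y₁, 0) +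
      b (0, X₂) (0, Y₂) := by
  have h : ∀ X Y : E, (X, Y) = (X, 0) + (0, Y) := fun X Y => by simp
  rw [h X₁, h Y₁]
  simp only [map_add, add_apply]
  abel

/-- A cocycle of alternating forms that vanishes on `{g} × {1}` in the direction of the second
factor is determined by its mixed component `f` at `(1, 1)`, whose symmetrization is invariant. -/
theorem IsTrivializedCocycle.eq_of_normalized (hr : ∀ X, r 1 X = X)
    (hB : IsTrivializedCocycle r B) (halt : ∀ g h u v, B g h u v = -B g h v u)
    (hn : ∀ g X Y, B g 1 (0, X) (0, Y) = 0) (g h : Γ) (X₁ X₂ Y₁ Y₂ : E) :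
    B g h (X₁, X₂) (Y₁, Y₂) =
      B 1 1 (r h X₁, 0) (0, r h Y₁) - B 1 1 (X₁, 0) (0, Y₁) +
        B 1 1 (r h X₁, 0) (0, Y₂) - B 1 1 (r h Y₁, 0) (0, X₂) := by
  -- The cocycle condition at `(g, h, 1)`, then at `(g, 1, h)` and at `(1, h, 1)`, reduces `B g h`
  -- to `B 1 1` and the first component of `B 1 h`, which the condition at `(1, 1, h)` computes.
  have h2 : ∀ g h X Y, B g h (0, X) (0, Y) = 0 := fun g h X Y => by
    simpa [hr, hn, ← Prod.zero_eq_mk] using hB g h 1 0 0 X 0 0 Y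
  have h3 : ∀ g h X₁ X₂ Y₁ Y₂, B g h (X₁, X₂) (Y₁, Y₂) = B 1 h (X₁, X₂) (Y₁, Y₂) :=
    fun g h X₁ X₂ Y₁ Y₂ => by
      have := hB g 1 h 0 X₁ X₂ 0 Y₁ Y₂
      simp only [map_zero, zero_add, mul_one, one_mul, h2, add_zero, sub_zero] at this
      exact (sub_eq_zero.1 this).symm
  have h4 : ∀ h X₁ X₂ Y₁ Y₂, B 1 h (X₁, X₂) (Y₁, Y₂) =
      B 1 h (X₁, 0) (Y₁, 0) + B 1 1 (r h X₁, X₂) (r h Y₁, Y₂) := fun h X₁ X₂ Y₁ Y₂ => by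
    have := hB 1 h 1 X₁ 0 X₂ Y₁ 0 Y₂
    simp only [zero_add, mul_one, one_mul, h2, add_zero, hr] at this
    rw [h3 h 1] at this
    rw [zero_sub, neg_add_eq_sub, sub_sub, sub_eq_zero] at this
    rw [this, add_comm]
  have h5 : ∀ X Y, B 1 1 (X, 0) (Y, 0) = 0 := fun X Y => by
    simpa [hr, ← Prod.zero_eq_mk] using hB 1 1 1 X 0 0 Y 0 0
  have h11 : ∀ X₁ X₂ Y₁ Y₂, B 1 1 (X₁, X₂) (Y₁, Y₂) =
      B 1 1 (X₁, 0) (0, Y₂) - B 1 1 (Y₁, 0) (0, X₂) := fun X₁ X₂ Y₁ Y₂ => by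
    rw [prod_bilinear_expand, h5, h2, halt 1 1 (0, X₂)]; abel
  have h6 : ∀ h X Y, B 1 h (X, 0) (Y, 0) = B 1 1 (r h X, 0) (0, r h Y) - B 1 1 (X, 0) (0, Y) :=
    fun h X Y => by
      have := hB 1 1 h X 0 0 0 Y 0
      simp only [map_zero, zero_add, mul_one, one_mul, add_zero, hr, ← Prod.zero_eq_mk,
        zero_apply, zero_sub] at this
      rw [h4 h X 0 0 (r h Y)] at this
      simp only [map_zero, ← Prod.zero_eq_mk, zero_add] at this
      rw [sub_eq_zero, neg_add_eq_iff_eq_add] at this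
      rw [eq_sub_iff_add_eq, ← this]
  rw [h3, h4, h6, h11 (r h X₁) X₂]
  abel

/-- A cocycle of alternating bilinear forms is, up to the coboundary of a family of alternating
forms, given by an invariant symmetric form: the component of `B` in the direction of the second
factor on `{g} × {1}`, together with the antisymmetric part of the mixed component at `(1, 1)`,
is a primitive of the rest. -/
theorem IsTrivializedCocycle.exists_primitive
    {F : Γ → Γ → E × E →L[ℝ] E × E →L[ℝ] V} (hr : ∀ X, r 1 X = X)
    (hrm : ∀ h k X, r (h * k) X = r k (r h X)) (hF : IsTrivializedCocycle r F)
    (halt : ∀ g h u v, F g h u v = -F g h v u) :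
    ∃ s a : E →L[ℝ] E →L[ℝ] V, (∀ X Y, s X Y = s Y X) ∧ (∀ X Y, a X Y = -a Y X) ∧
      (∀ h X Y, s (r h X) (r h Y) = s X Y) ∧
      ∀ g h X₁ X₂ Y₁ Y₂, F g h (X₁, X₂) (Y₁, Y₂) +
        (F g 1 (0, X₁) (0, Y₁) + a X₁ Y₁) + (F h 1 (0, X₂) (0, Y₂) + a X₂ Y₂) -
        (F (g * h) 1 (0, r h X₁ + X₂) (0, r h Y₁ + Y₂) + a (r h X₁ + X₂) (r h Y₁ + Y₂)) =
          s (r h X₁) Y₂ - s (r h Y₁) X₂ := by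
  -- Adding the coboundary of the second component `W` of `F` along `{g} × {1}` normalizes `F`.
  set W : Γ → E →L[ℝ] E →L[ℝ] V := fun g =>
    (F g 1).bilinearComp (ContinuousLinearMap.inr ℝ E E) (ContinuousLinearMap.inr ℝ E E)
  have hW : ∀ g X Y, W g X Y = F g 1 (0, X) (0, Y) := fun g X Y => rfl
  set B : Γ → Γ → E × E →L[ℝ] E × E →L[ℝ] V := fun g h =>
    F g h + (W h).bilinearComp (ContinuousLinearMap.snd ℝ E E) (ContinuousLinearMap.snd ℝ E E) -
      (W (g * h)).bilinearComp
        ((r h).comp (ContinuousLinearMap.fst ℝ E E) + ContinuousLinearMap.snd ℝ E E)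
        ((r h).comp (ContinuousLinearMap.fst ℝ E E) + ContinuousLinearMap.snd ℝ E E) +
      (W g).bilinearComp (ContinuousLinearMap.fst ℝ E E) (ContinuousLinearMap.fst ℝ E E)
  have hBapp : ∀ g h X₁ X₂ Y₁ Y₂, B g h (X₁, X₂) (Y₁, Y₂) = F g h (X₁, X₂) (Y₁, Y₂) +
      W h X₂ Y₂ - W (g * h) (r h X₁ + X₂) (r h Y₁ + Y₂) + W g X₁ Y₁ := fun _ _ _ _ _ _ => rfl
  have hWalt : ∀ g X Y, W g X Y = -W g Y X := fun g X Y => halt _ _ _ _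
  have hBalt : ∀ g h u v, B g h u v = -B g h v u := fun g h u v => by
    obtain ⟨X₁, X₂⟩ := u
    obtain ⟨Y₁, Y₂⟩ := v
    rw [hBapp, hBapp, halt, hWalt h, hWalt (g * h), hWalt g]
    abel
  have hB : IsTrivializedCocycle r B := by
    intro g h k X₁ X₂ X₃ Y₁ Y₂ Y₃
    have h0 := hF g h k X₁ X₂ X₃ Y₁ Y₂ Y₃
    simp only [hBapp, hrm, map_add (r k), mul_assoc, ← add_assoc]
    rw [← h0]
    simp only [← mul_assoc]
    abel
  have hn : ∀ g X Y, B g 1 (0, X) (0, Y) = 0 := fun g X Y => by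
    rw [hBapp]
    simp only [map_zero, zero_add, mul_one, add_zero, hW, hF.apply_one_left hr]
    exact sub_self _
  have hf := hB.eq_of_normalized hr hBalt hn
  set f : E →L[ℝ] E →L[ℝ] V := (B 1 1).bilinearComp (ContinuousLinearMap.inl ℝ E E)
    (ContinuousLinearMap.inr ℝ E E)
  have hfapp : ∀ X Y, B 1 1 (X, 0) (0, Y) = f X Y := fun _ _ => rfl
  simp only [hfapp] at hf
  -- Since `B 1 h` is alternating, the symmetric part of its mixed component `f` is invariant.
  have hinv : ∀ h X Y, f (r h X) (r h Y) + f (r h Y) (r h X) = f X Y + f Y X := fun h X Y => by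
    have h1 := hBalt 1 h (X, 0) (Y, 0)
    rw [hf, hf] at h1
    simp only [map_zero, add_zero, sub_zero] at h1
    linear_combination (norm := module) h1
  refine ⟨(1 / 2 : ℝ) • (f + f.flip), (1 / 2 : ℝ) • (f - f.flip), fun X Y => ?_, fun X Y => ?_,
    fun h X Y => ?_, fun g h X₁ X₂ Y₁ Y₂ => ?_⟩
  · simp only [smul_apply, add_apply, ContinuousLinearMap.flip_apply, add_comm]
  · simp only [smul_apply, sub_apply, ContinuousLinearMap.flip_apply, ← smul_neg, neg_sub]
  · simp only [smul_apply, add_apply, ContinuousLinearMap.flip_apply, hinv]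
  · have h1 := hf g h X₁ X₂ Y₁ Y₂
    rw [hBapp] at h1
    have h2 := hinv h X₁ Y₁
    simp only [← hW, smul_apply, sub_apply, add_apply, ContinuousLinearMap.flip_apply, map_add]
      at h1 ⊢
    linear_combination (norm := module) h1 + (1 / 2 : ℝ) • h2

end Cocycle

/-! ### Two-forms on the nerve of a Lie group -/

section Bott

variable {E H : Type*} [NormedAddCommGroup E] [NormedSpace ℝ E] [TopologicalSpace H]
  {I : ModelWithCorners ℝ E H}
  {G : Type*} [TopologicalSpace G] [ChartedSpace H G] [Group G] [LieGroup I ∞ G]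
  {V : Type*} [NormedAddCommGroup V] [NormedSpace ℝ V]

variable (I) in
/-- The left translation `T₁ G → T_g G`. -/
def leftTranslation (g : G) : E →L[ℝ] E := differential I I (fun x : G => g * x) 1

theorem thetaL_leftTranslation (g : G) (X : E) : thetaL I g (leftTranslation I g X) = X := by
  have := thetaL_comp_mul_left (I := I) g 1
  rw [mul_one, thetaL_one] at this
  exact DFunLike.congr_fun this X

/-- Left translation is inverse to `θᴸ`, so that every vector at `g` is a left translation. -/
theorem leftTranslation_thetaL (g : G) (X : E) : leftTranslation I g (thetaL I g X) = X := by
  have h : (fun x : G => g * x) ∘ (fun x => g⁻¹ * x) = fun x => x := by funext x; simp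
  have h' := differential_comp (f := fun x : G => g⁻¹ * x) (x := g)
    (mdifferentiableAt_mul_left' (I := I) g _) (mdifferentiableAt_mul_left' g⁻¹ g)
  rw [h, differential_id, inv_mul_cancel] at h'
  exact (DFunLike.congr_fun h' X).symm

theorem leftTranslation_one (X : E) : leftTranslation I (1 : G) X = X := by
  simp only [leftTranslation, one_mul]
  exact DFunLike.congr_fun (differential_id _) X

theorem differential_mul_leftTranslation (g h : G) (X Y : E) :
    differential (I.prod I) I (fun z : G × G => z.1 * z.2) (g, h)
        (leftTranslation I g X, leftTranslation I h Y) =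
      leftTranslation I (g * h) (adRep I h⁻¹ X + Y) := by
  have h' := DFunLike.congr_fun (pullback_thetaL_mul (I := I) (x := (g, h)) mdifferentiableAt_fst
    mdifferentiableAt_snd) (leftTranslation I g X, leftTranslation I h Y)
  simp only [pullback₁_apply, add_apply, ContinuousLinearMap.comp_apply, differential_fst,
    differential_snd, ContinuousLinearMap.coe_fst', ContinuousLinearMap.coe_snd',
    thetaL_leftTranslation] at h'
  rw [← h', leftTranslation_thetaL]

theorem contMDiff_nerveFace₂ (j : Fin 3) :
    ContMDiff (I.prod I) I ∞ (nerveFace₂ j : G × G → G) := by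
  fin_cases j
  · exact contMDiff_snd
  · exact contMDiff_mul_pair
  · exact contMDiff_fst

theorem contMDiff_nerveFace₃ (j : Fin 4) :
    ContMDiff (I.prod (I.prod I)) (I.prod I) ∞ (nerveFace₃ j : G × G × G → G × G) := by
  have h1 : ContMDiff (I.prod (I.prod I)) I ∞ fun x : G × G × G => x.1 := contMDiff_fst
  have h2 : ContMDiff (I.prod (I.prod I)) I ∞ fun x : G × G × G => x.2.1 :=
    contMDiff_fst.comp contMDiff_snd
  have h3 : ContMDiff (I.prod (I.prod I)) I ∞ fun x : G × G × G => x.2.2 :=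
    contMDiff_snd.comp contMDiff_snd
  fin_cases j
  · exact h2.prodMk h3
  · exact (h1.mul h2).prodMk h3
  · exact h1.prodMk (h2.mul h3)
  · exact h1.prodMk h2

/-- A field of bilinear forms on `G × G` in the left trivialization of the tangent bundle. -/
def leftTrivialize (I : ModelWithCorners ℝ E H) (F : G × G → E × E →L[ℝ] E × E →L[ℝ] V)
    (g h : G) : E × E →L[ℝ] E × E →L[ℝ] V :=
  (F (g, h)).bilinearComp ((leftTranslation I g).prodMap (leftTranslation I h))
    ((leftTranslation I g).prodMap (leftTranslation I h))

theorem leftTrivialize_apply (F : G × G → E × E →L[ℝ] E × E →L[ℝ] V) (g h : G)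
    (X₁ X₂ Y₁ Y₂ : E) :
    leftTrivialize I F g h (X₁, X₂) (Y₁, Y₂) =
      F (g, h) (leftTranslation I g X₁, leftTranslation I h X₂)
        (leftTranslation I g Y₁, leftTranslation I h Y₂) := rfl

/-- In the left trivialization, the simplicial closedness of a form on `G²` becomes the algebraic
cocycle condition; the operators `Ad(h⁻¹)` come from the differential of the product. -/
theorem isTrivializedCocycle_leftTrivialize {F : G × G → E × E →L[ℝ] E × E →L[ℝ] V}
    (hF : ∀ z, pullback₂ (I.prod (I.prod I)) (I.prod I) (nerveFace₃ 0) F z +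
        pullback₂ (I.prod (I.prod I)) (I.prod I) (nerveFace₃ 2) F z =
      pullback₂ (I.prod (I.prod I)) (I.prod I) (nerveFace₃ 1) F z +
        pullback₂ (I.prod (I.prod I)) (I.prod I) (nerveFace₃ 3) F z) :
    IsTrivializedCocycle (fun h => adRep I h⁻¹) (leftTrivialize I F) := by
  intro g h k X₁ X₂ X₃ Y₁ Y₂ Y₃
  set τ : E → E → E → E × E × E := fun X₁ X₂ X₃ =>
    (leftTranslation I g X₁, leftTranslation I h X₂, leftTranslation I k X₃) with hτ
  have hs : differential (I.prod (I.prod I)) (I.prod I) (Prod.snd : G × G × G → G × G) (g, h, k) =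
      ContinuousLinearMap.snd ℝ E (E × E) := differential_snd _
  have hf : differential (I.prod (I.prod I)) I (Prod.fst : G × G × G → G) (g, h, k) =
      ContinuousLinearMap.fst ℝ E (E × E) := differential_fst _
  have hsnd : MDifferentiableAt (I.prod (I.prod I)) (I.prod I) (Prod.snd : G × G × G → G × G)
    (g, h, k) := mdifferentiableAt_snd
  have hfst : MDifferentiableAt (I.prod (I.prod I)) I (Prod.fst : G × G × G → G)
    (g, h, k) := mdifferentiableAt_fst
  have hm : ∀ z : G × G, MDifferentiableAt (I.prod I) I (fun z : G × G => z.1 * z.2) z :=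
    contMDiff_mul_pair.mdifferentiable (by simp)
  have hsf : differential (I.prod (I.prod I)) I (fun x : G × G × G => x.2.1) (g, h, k) =
      (ContinuousLinearMap.fst ℝ E E).comp (ContinuousLinearMap.snd ℝ E (E × E)) := by
    rw [← hs, ← differential_fst (I := I) (J := I) (h, k)]
    exact differential_comp (g := Prod.fst) mdifferentiableAt_fst hsnd
  have hss : differential (I.prod (I.prod I)) I (fun x : G × G × G => x.2.2) (g, h, k) =
      (ContinuousLinearMap.snd ℝ E E).comp (ContinuousLinearMap.snd ℝ E (E × E)) := by
    rw [← hs, ← differential_snd (I := I) (J := I) (h, k)]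
    exact differential_comp (g := Prod.snd) mdifferentiableAt_snd hsnd
  have hsf' : MDifferentiableAt (I.prod (I.prod I)) I (fun x : G × G × G => x.2.1) (g, h, k) :=
    mdifferentiableAt_fst.comp (g, h, k) hsnd
  have hss' : MDifferentiableAt (I.prod (I.prod I)) I (fun x : G × G × G => x.2.2) (g, h, k) :=
    mdifferentiableAt_snd.comp (g, h, k) hsnd
  have e0 : ∀ X₁ X₂ X₃, differential (I.prod (I.prod I)) (I.prod I) (nerveFace₃ 0) (g, h, k)
      (τ X₁ X₂ X₃) = (leftTranslation I h X₂, leftTranslation I k X₃) := fun X₁ X₂ X₃ => by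
    change differential _ _ (fun x : G × G × G => (x.2.1, x.2.2)) _ _ = _
    rw [differential_prodMk hsf' hss', hsf, hss]
    rfl
  have e3 : ∀ X₁ X₂ X₃, differential (I.prod (I.prod I)) (I.prod I) (nerveFace₃ 3) (g, h, k)
      (τ X₁ X₂ X₃) = (leftTranslation I g X₁, leftTranslation I h X₂) := fun X₁ X₂ X₃ => by
    change differential _ _ (fun x : G × G × G => (Prod.fst x, x.2.1)) _ _ = _
    rw [differential_prodMk hfst hsf', hsf, hf]
    rfl
  have e1 : ∀ X₁ X₂ X₃, differential (I.prod (I.prod I)) (I.prod I) (nerveFace₃ 1) (g, h, k)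
      (τ X₁ X₂ X₃) = (leftTranslation I (g * h) (adRep I h⁻¹ X₁ + X₂), leftTranslation I k X₃) :=
    fun X₁ X₂ X₃ => by
    change differential _ _ (fun x : G × G × G => (x.1 * x.2.1, x.2.2)) _ _ = _
    have hc := differential_comp (f := fun x : G × G × G => (Prod.fst x, x.2.1)) (hm (g, h))
      (hfst.prodMk hsf')
    have hc' : MDifferentiableAt (I.prod (I.prod I)) I (fun x : G × G × G => x.1 * x.2.1)
      (g, h, k) := (hm (g, h)).comp (g, h, k) (hfst.prodMk hsf')
    rw [differential_prodMk hc' hss', hss]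
    change ((differential _ _ ((fun z : G × G => z.1 * z.2) ∘
      fun x : G × G × G => (Prod.fst x, x.2.1)) (g, h, k)) (τ X₁ X₂ X₃), _) = _
    rw [hc, differential_prodMk hfst hsf', hsf, hf, ← differential_mul_leftTranslation]
    rfl
  have e2 : ∀ X₁ X₂ X₃, differential (I.prod (I.prod I)) (I.prod I) (nerveFace₃ 2) (g, h, k)
      (τ X₁ X₂ X₃) = (leftTranslation I g X₁, leftTranslation I (h * k) (adRep I k⁻¹ X₂ + X₃)) :=
    fun X₁ X₂ X₃ => by
    have hc := differential_comp (f := (Prod.snd : G × G × G → G × G)) (hm (h, k)) hsnd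
    have hc' : MDifferentiableAt (I.prod (I.prod I)) I (fun x : G × G × G => x.2.1 * x.2.2)
      (g, h, k) := (hm (h, k)).comp (g, h, k) hsnd
    change differential _ _ (fun x : G × G × G => (Prod.fst x, x.2.1 * x.2.2)) _ _ = _
    rw [differential_prodMk hfst hc', hf]
    change (_, (differential _ _ ((fun z : G × G => z.1 * z.2) ∘
      (Prod.snd : G × G × G → G × G)) (g, h, k)) (τ X₁ X₂ X₃)) = _
    rw [hc, hs, ← differential_mul_leftTranslation]
    rfl
  have key := DFunLike.congr_fun (DFunLike.congr_fun (hF (g, h, k)) (τ X₁ X₂ X₃)) (τ Y₁ Y₂ Y₃)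
  simp only [add_apply, pullback₂_apply, e0, e1, e2, e3] at key
  simp only [leftTrivialize_apply]
  change F (h, k) _ _ + F (g, h * k) _ _ = F (g * h, k) _ _ + F (g, h) _ _ at key
  rw [sub_add_eq_add_sub, key]
  abel

variable [I.Boundaryless]

/-- Smoothness of the component of a `2`-form on `G × G` along `{g} × {1}` in the direction of the
second factor: it is the vertical part, on the diagonal, of its pullback under
`(g, h) ↦ (g, g⁻¹h)`. -/
theorem SmoothAltAt.second_component {F : G × G → E × E →L[ℝ] E × E →L[ℝ] V}
    (hF : ∀ z, SmoothAltAt (I.prod I) F z) (g : G) :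
    SmoothAltAt I (fun g : G => (F (g, 1)).bilinearComp
      ((ContinuousLinearMap.inr ℝ E E).comp (thetaL I g))
      ((ContinuousLinearMap.inr ℝ E E).comp (thetaL I g))) g := by
  set Φ : G × G → G × G := fun z => (z.1, z.1⁻¹ * z.2)
  have hΦ : ContMDiff (I.prod I) (I.prod I) ∞ Φ :=
    contMDiff_fst.prodMk (contMDiff_fst.inv.mul contMDiff_snd)
  have hdg : ContMDiff I (I.prod I) ∞ fun g : G => (g, g) := contMDiff_id.prodMk contMDiff_id
  refine isSmoothnessAlt.congr (((hF _).pullback (hΦ (g, g))).vertical.pullback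
    (f := fun g : G => (g, g)) hdg.contMDiffAt) (Eventually.of_forall fun k => ?_)
  have e1 : ∀ u, differential I (I.prod I) (fun g : G => (g, g)) k u = (u, u) := fun u => by
    rw [differential_prodMk (f := fun g : G => g) (g := fun g : G => g) mdifferentiableAt_id
      mdifferentiableAt_id, differential_id]
    rfl
  have hmk : MDifferentiableAt I (I.prod I) (fun h : G => (k, h)) k :=
    mdifferentiableAt_const.prodMk mdifferentiableAt_id
  have e2 : ∀ u : E, differential (I.prod I) (I.prod I) Φ (k, k) (0, u) = (0, thetaL I k u) := by
    intro u
    have h0 : differential I (I.prod I) (fun h : G => (k, h)) k u = (0, u) := by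
      rw [differential_prodMk (g := fun h : G => h) mdifferentiableAt_const mdifferentiableAt_id,
        differential_const, differential_id]
      rfl
    have h1 := DFunLike.congr_fun (differential_comp (f := fun h : G => (k, h)) (x := k)
      ((hΦ (k, k)).mdifferentiableAt (by simp)) hmk) u
    rw [ContinuousLinearMap.comp_apply, h0] at h1
    rw [← h1]
    change differential I (I.prod I) (fun h : G => (k, k⁻¹ * h)) k u = _
    rw [differential_prodMk mdifferentiableAt_const (mdifferentiableAt_mul_left' _ _),
      differential_const]
    rfl
  refine ContinuousLinearMap.ext fun u => ContinuousLinearMap.ext fun v => ?_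
  rw [pullback₂_apply, e1, e1]
  simp only [ContinuousLinearMap.bilinearComp_apply, verticalProj_apply]
  rw [pullback₂_apply, e2, e2]
  simp only [Φ, inv_mul_cancel]
  rfl

/-- The part of the theorem of Bott on the forms on the nerve of a Lie group that is relevant for
multiplicative gerbes: a simplicially closed `2`-form on `G²` equals `-⟨g₁*θᴸ ∧ g₂*θᴿ⟩`, for an
invariant symmetric pairing, up to the simplicial differential of a `2`-form on `G`. -/
theorem exists_pairing_primitive {F : G × G → E × E →L[ℝ] E × E →L[ℝ] V}
    (hF : ∀ z, SmoothAltAt (I.prod I) F z)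
    (hclosed : ∀ z, pullback₂ (I.prod (I.prod I)) (I.prod I) (nerveFace₃ 0) F z +
        pullback₂ (I.prod (I.prod I)) (I.prod I) (nerveFace₃ 2) F z =
      pullback₂ (I.prod (I.prod I)) (I.prod I) (nerveFace₃ 1) F z +
        pullback₂ (I.prod (I.prod I)) (I.prod I) (nerveFace₃ 3) F z) :
    ∃ (κ : E →L[ℝ] E →L[ℝ] V) (w : G → E →L[ℝ] E →L[ℝ] V), (∀ X Y, κ X Y = κ Y X) ∧
      (∀ (g : G) X Y, κ (adRep I g X) (adRep I g Y) = κ X Y) ∧ (∀ g, SmoothAltAt I w g) ∧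
      ∀ z, F z - (pullback₂ (I.prod I) I Prod.fst w z + pullback₂ (I.prod I) I Prod.snd w z) +
          pullback₂ (I.prod I) I (fun z : G × G => z.1 * z.2) w z =
        -pairWedge κ (pullback₁ (I.prod I) I Prod.fst (thetaL I))
          (pullback₁ (I.prod I) I Prod.snd (thetaR I)) z := by
  have hFalt : ∀ z u v, F z u v = -F z v u := fun z => (hF z).2.self_of_nhds
  obtain ⟨s, a, hs, ha, hinv, hsa⟩ :=
    (isTrivializedCocycle_leftTrivialize hclosed).exists_primitive
      (fun X => by simp only [inv_one, adRep_one]; rfl)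
      (fun h k X => by simp only [mul_inv_rev, adRep_mul]; rfl)
      (fun g h u v => hFalt _ _ _)
  set w : G → E →L[ℝ] E →L[ℝ] V := fun g => -((F (g, 1)).bilinearComp
      ((ContinuousLinearMap.inr ℝ E E).comp (thetaL I g))
      ((ContinuousLinearMap.inr ℝ E E).comp (thetaL I g)) +
    pairTensor a (thetaL I) (thetaL I) g)
  have hwapp : ∀ g X Y, w g (leftTranslation I g X) (leftTranslation I g Y) =
      -(leftTrivialize I F g 1 (0, X) (0, Y) + a X Y) := fun g X Y => by
    change -(F (g, 1) (0, thetaL I g (leftTranslation I g X))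
      (0, thetaL I g (leftTranslation I g Y)) + a (thetaL I g (leftTranslation I g X))
        (thetaL I g (leftTranslation I g Y))) = _
    rw [leftTrivialize_apply, thetaL_leftTranslation, thetaL_leftTranslation, leftTranslation_one,
      leftTranslation_one, map_zero]
  have hinv' : ∀ (g : G) X Y, s (adRep I g X) (adRep I g Y) = s X Y := fun g X Y => by
    simpa using hinv g⁻¹ X Y
  refine ⟨-s, w, fun X Y => by simp only [neg_apply, hs X Y],
    fun g X Y => by simp only [neg_apply, hinv'], fun g => ?_, fun z => ?_⟩
  · refine isSmoothnessAlt.neg (isSmoothnessAlt.add (SmoothAltAt.second_component hF g)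
      ⟨(smoothAt₁_thetaL g).pairTensor (smoothAt₁_thetaL g), Eventually.of_forall fun y u v => ?_⟩)
    exact ha _ _
  · obtain ⟨g, h⟩ := z
    refine ContinuousLinearMap.ext fun u => ContinuousLinearMap.ext fun v => ?_
    obtain ⟨X₁, X₂, rfl⟩ : ∃ X₁ X₂, u = (leftTranslation I g X₁, leftTranslation I h X₂) :=
      ⟨thetaL I g u.1, thetaL I h u.2, by rw [leftTranslation_thetaL, leftTranslation_thetaL]⟩
    obtain ⟨Y₁, Y₂, rfl⟩ : ∃ Y₁ Y₂, v = (leftTranslation I g Y₁, leftTranslation I h Y₂) :=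
      ⟨thetaL I g v.1, thetaL I h v.2, by rw [leftTranslation_thetaL, leftTranslation_thetaL]⟩
    have hk := hsa g h X₁ X₂ Y₁ Y₂
    simp only [add_apply, sub_apply, neg_apply, pullback₂_apply, pairWedge_apply, pullback₁_apply,
      differential_fst, differential_snd, ContinuousLinearMap.coe_fst',
      ContinuousLinearMap.coe_snd', differential_mul_leftTranslation, thetaL_leftTranslation,
      thetaR_eq, ContinuousLinearMap.comp_apply, hwapp]
    have h1 : ∀ X Y, s X (adRep I h Y) = s (adRep I h⁻¹ X) Y := fun X Y => by
      rw [← hinv' h⁻¹ X, adRep_inv_adRep]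
    rw [h1, h1]
    rw [leftTrivialize_apply] at hk
    linear_combination (norm := module) hk

end Bott

/-! ### Curvings and curvatures -/

section Curvings

variable {E H ET HT : Type*}
  [NormedAddCommGroup E] [NormedSpace ℝ E] [TopologicalSpace H]
  [NormedAddCommGroup ET] [NormedSpace ℝ ET] [TopologicalSpace HT]
  {I : ModelWithCorners ℝ E H} {IT : ModelWithCorners ℝ ET HT}
  {X T : Type*} [TopologicalSpace X] [ChartedSpace H X]
  [TopologicalSpace T] [ChartedSpace HT T] [CommGroup T] [LieGroup IT ∞ T]
  [I.Boundaryless] [IT.Boundaryless] [IsManifold I ∞ X]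

theorem smoothAltAt_extDeriv₁ {U : Set X} (hU : IsOpen U) (a : forms₁ I ET U) {x : X}
    (hx : x ∈ U) : SmoothAltAt I (extDeriv₁ I a.1) x :=
  SmoothAt₁.extDeriv₁ (by
    filter_upwards [hU.mem_nhds hx] with y hy using smoothAt_of_mem_forms₁ hU a hy)

/-- A gerbe with connective structure admits a curving. -/
theorem exists_curving [FiniteDimensional ℝ E] [T2Space X] [SigmaCompactSpace X] {ι : Type*}
    {U : ι → Set X} (hU : IsOpenCovering U) (A : ∀ i j, forms₁ I ET (U i ∩ U j))
    {lam : ι → ι → ι → X → T}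
    (hlam : ∀ i j k, ContMDiffOn I IT ∞ (lam i j k) (U i ∩ U j ∩ U k))
    (hA : ∀ i j k, ∀ x ∈ U i ∩ U j ∩ U k,
      (A i j).1 x - (A i k).1 x + (A j k).1 x = logForm IT I (lam i j k) x) :
    ∃ Θ : ∀ i, forms₂ I ET (U i), ∀ i j, ∀ x ∈ U i ∩ U j,
      (Θ i).1 x - (Θ j).1 x = extDeriv₁ I (A i j).1 x := by
  have hU₂ := fun i j => (hU.isOpen i).inter (hU.isOpen j)
  have hU₃ := fun i j k => (hU₂ i j).inter (hU.isOpen k)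
  obtain ⟨h, hh, hd⟩ := isSmoothnessAlt.exists_cech_primitive (I := I) hU
    (c := fun i j => extDeriv₁ I (A i j).1)
    (fun i j x hx => smoothAltAt_extDeriv₁ (hU₂ i j) (A i j) hx) (by
      intro i j k x hx
      have h1 := smoothAt_of_mem_forms₁ (hU₂ i j) (A i j) hx.1
      have h2 := smoothAt_of_mem_forms₁ (hU₂ i k) (A i k) ⟨hx.1.1, hx.2⟩
      have h3 := smoothAt_of_mem_forms₁ (hU₂ j k) (A j k) ⟨hx.1.2, hx.2⟩
      have hopen := (hU₃ i j k).mem_nhds hx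
      rw [← extDeriv₁_sub h1 h2, ← extDeriv₁_add (isSmoothness₁.sub h1 h2) h3,
        ← extDeriv₁_logForm ((hlam i j k).contMDiffAt hopen)]
      refine extDeriv₁_congr ?_
      filter_upwards [hopen] with y hy using hA i j k y hy)
  choose Θ hΘ using fun i => exists_mem_forms₂ (hU.isOpen i) (hh i)
  exact ⟨Θ, fun i j x hx => by rw [hΘ i x hx.1, hΘ j x hx.2, hd i j x hx]⟩

variable {E₀ H₀ E₁ H₁ E₂ H₂ E₃ H₃ : Type*}
  [NormedAddCommGroup E₀] [NormedSpace ℝ E₀] [TopologicalSpace H₀]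
  [NormedAddCommGroup E₁] [NormedSpace ℝ E₁] [TopologicalSpace H₁]
  [NormedAddCommGroup E₂] [NormedSpace ℝ E₂] [TopologicalSpace H₂]
  [NormedAddCommGroup E₃] [NormedSpace ℝ E₃] [TopologicalSpace H₃]
  {I₀ : ModelWithCorners ℝ E₀ H₀} {I₁ : ModelWithCorners ℝ E₁ H₁}
  {I₂ : ModelWithCorners ℝ E₂ H₂} {I₃ : ModelWithCorners ℝ E₃ H₃}
  {Y₀ Y₁ Y₂ Y₃ : Type*}
  [TopologicalSpace Y₀] [ChartedSpace H₀ Y₀] [TopologicalSpace Y₁] [ChartedSpace H₁ Y₁]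
  [TopologicalSpace Y₂] [ChartedSpace H₂ Y₂] [TopologicalSpace Y₃] [ChartedSpace H₃ Y₃]
  [I₀.Boundaryless] [IsManifold I₀ ∞ Y₀] [I₁.Boundaryless] [IsManifold I₁ ∞ Y₁]
  [I₂.Boundaryless] [IsManifold I₂ ∞ Y₂] [I₃.Boundaryless] [IsManifold I₃ ∞ Y₃]

/-- The exterior derivative of the equation of a flat `2`-isomorphism. -/
theorem extDeriv₁_flat {W : Set X} (hW : IsOpen W) {c : X → T}
    (hc : ContMDiffOn I IT ∞ c W) {f₀ : X → Y₀} {f₁ : X → Y₁} {f₂ : X → Y₂} {f₃ : X → Y₃}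
    (hf₀ : ContMDiff I I₀ ∞ f₀) (hf₁ : ContMDiff I I₁ ∞ f₁) (hf₂ : ContMDiff I I₂ ∞ f₂)
    (hf₃ : ContMDiff I I₃ ∞ f₃) {a₀ : Y₀ → E₀ →L[ℝ] ET} {a₁ : Y₁ → E₁ →L[ℝ] ET}
    {a₂ : Y₂ → E₂ →L[ℝ] ET} {a₃ : Y₃ → E₃ →L[ℝ] ET}
    (ha₀ : ∀ x ∈ W, SmoothAt₁ I₀ a₀ (f₀ x)) (ha₁ : ∀ x ∈ W, SmoothAt₁ I₁ a₁ (f₁ x))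
    (ha₂ : ∀ x ∈ W, SmoothAt₁ I₂ a₂ (f₂ x)) (ha₃ : ∀ x ∈ W, SmoothAt₁ I₃ a₃ (f₃ x))
    (h : ∀ x ∈ W, logForm IT I c x + pullback₁ I I₀ f₀ a₀ x + pullback₁ I I₁ f₁ a₁ x =
      pullback₁ I I₂ f₂ a₂ x + pullback₁ I I₃ f₃ a₃ x) (x : X) (hx : x ∈ W) :
    pullback₂ I I₀ f₀ (extDeriv₁ I₀ a₀) x + pullback₂ I I₁ f₁ (extDeriv₁ I₁ a₁) x =
      pullback₂ I I₂ f₂ (extDeriv₁ I₂ a₂) x + pullback₂ I I₃ f₃ (extDeriv₁ I₃ a₃) x := by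
  have e : (fun y => logForm IT I c y + pullback₁ I I₀ f₀ a₀ y + pullback₁ I I₁ f₁ a₁ y) =ᶠ[𝓝 x]
      fun y => pullback₁ I I₂ f₂ a₂ y + pullback₁ I I₃ f₃ a₃ y := by
    filter_upwards [hW.mem_nhds hx] with y hy using h y hy
  have hc' := hc.contMDiffAt (hW.mem_nhds hx)
  have s₀ := (ha₀ x hx).pullback (hf₀ x)
  have s₁ := (ha₁ x hx).pullback (hf₁ x)
  have s₂ := (ha₂ x hx).pullback (hf₂ x)
  have s₃ := (ha₃ x hx).pullback (hf₃ x)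
  have e' := extDeriv₁_congr (I := I) e
  rwa [extDeriv₁_add (isSmoothness₁.add (SmoothAt₁.logForm hc') s₀) s₁,
    extDeriv₁_add (SmoothAt₁.logForm hc') s₀, extDeriv₁_logForm hc', zero_add,
    extDeriv₁_add s₂ s₃, extDeriv₁_pullback (hf₀ x) (ha₀ x hx),
    extDeriv₁_pullback (hf₁ x) (ha₁ x hx), extDeriv₁_pullback (hf₂ x) (ha₂ x hx),
    extDeriv₁_pullback (hf₃ x) (ha₃ x hx)] at e'

/-- The difference `dη - (f₁*B₁ + f₂*B₂) + f₀*B₀`, which is the curvature of a connection `η` on an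
isomorphism between `f₁*𝒢₁ ⊗ f₂*𝒢₂` and `f₀*𝒢₀`, does not change under passage to another open set
of the cover. -/
theorem curvature_eq_of_connection {W : Set X} (hW : IsOpen W) {c : X → T}
    (hc : ContMDiffOn I IT ∞ c W) {f₀ : X → Y₀} {f₁ : X → Y₁} {f₂ : X → Y₂}
    (hf₀ : ContMDiff I I₀ ∞ f₀) (hf₁ : ContMDiff I I₁ ∞ f₁) (hf₂ : ContMDiff I I₂ ∞ f₂)
    {a₀ : Y₀ → E₀ →L[ℝ] ET} {a₁ : Y₁ → E₁ →L[ℝ] ET} {a₂ : Y₂ → E₂ →L[ℝ] ET}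
    {η η' : X → E →L[ℝ] ET}
    (ha₀ : ∀ x ∈ W, SmoothAt₁ I₀ a₀ (f₀ x)) (ha₁ : ∀ x ∈ W, SmoothAt₁ I₁ a₁ (f₁ x))
    (ha₂ : ∀ x ∈ W, SmoothAt₁ I₂ a₂ (f₂ x)) (hη : ∀ x ∈ W, SmoothAt₁ I η x)
    (hη' : ∀ x ∈ W, SmoothAt₁ I η' x)
    (h : ∀ x ∈ W, η x + pullback₁ I I₀ f₀ a₀ x + logForm IT I c x =
      pullback₁ I I₁ f₁ a₁ x + pullback₁ I I₂ f₂ a₂ x + η' x)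
    {B₀ B₀' : Y₀ → E₀ →L[ℝ] E₀ →L[ℝ] ET} {B₁ B₁' : Y₁ → E₁ →L[ℝ] E₁ →L[ℝ] ET}
    {B₂ B₂' : Y₂ → E₂ →L[ℝ] E₂ →L[ℝ] ET} {x : X} (hx : x ∈ W)
    (hB₀ : B₀ (f₀ x) - B₀' (f₀ x) = extDeriv₁ I₀ a₀ (f₀ x))
    (hB₁ : B₁ (f₁ x) - B₁' (f₁ x) = extDeriv₁ I₁ a₁ (f₁ x))
    (hB₂ : B₂ (f₂ x) - B₂' (f₂ x) = extDeriv₁ I₂ a₂ (f₂ x)) :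
    extDeriv₁ I η x - (pullback₂ I I₁ f₁ B₁ x + pullback₂ I I₂ f₂ B₂ x) +
        pullback₂ I I₀ f₀ B₀ x =
      extDeriv₁ I η' x - (pullback₂ I I₁ f₁ B₁' x + pullback₂ I I₂ f₂ B₂' x) +
        pullback₂ I I₀ f₀ B₀' x := by
  have s₁ := (ha₁ x hx).pullback (hf₁ x)
  have s₂ := (ha₂ x hx).pullback (hf₂ x)
  have s₀ := (ha₀ x hx).pullback (hf₀ x)
  have hc' := hc.contMDiffAt (hW.mem_nhds hx)
  have e : (fun y => η y + pullback₁ I I₀ f₀ a₀ y + logForm IT I c y) =ᶠ[𝓝 x]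
      fun y => pullback₁ I I₁ f₁ a₁ y + pullback₁ I I₂ f₂ a₂ y + η' y := by
    filter_upwards [hW.mem_nhds hx] with y hy using h y hy
  have e' := extDeriv₁_congr (I := I) e
  rw [extDeriv₁_add (isSmoothness₁.add (hη x hx) s₀) (SmoothAt₁.logForm hc'),
    extDeriv₁_add (hη x hx) s₀, extDeriv₁_logForm hc', add_zero,
    extDeriv₁_add (isSmoothness₁.add s₁ s₂) (hη' x hx), extDeriv₁_add s₁ s₂,
    extDeriv₁_pullback (hf₀ x) (ha₀ x hx), extDeriv₁_pullback (hf₁ x) (ha₁ x hx),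
    extDeriv₁_pullback (hf₂ x) (ha₂ x hx)] at e'
  refine ContinuousLinearMap.ext fun u => ContinuousLinearMap.ext fun v => ?_
  have e'' := DFunLike.congr_fun (DFunLike.congr_fun e' u) v
  simp only [add_apply, sub_apply, pullback₂_apply, ← hB₀, ← hB₁, ← hB₂] at e'' ⊢
  linear_combination (norm := module) e''

end Curvings

/-! ### Existence and uniqueness of the Maurer-Cartan data -/

section Nerve

variable {G : Type*} [Group G]

theorem nerveFace₂_nerveFace₃ {j k : Fin 3} (h : j ≤ k) :
    (nerveFace₂ j : G × G → G) ∘ nerveFace₃ k.succ = nerveFace₂ k ∘ nerveFace₃ j.castSucc := by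
  funext x
  fin_cases j <;> fin_cases k <;>
    first
    | rfl
    | exact absurd h (by decide)
    | exact mul_assoc _ _ _
    | exact (mul_assoc _ _ _).symm

end Nerve

section MaurerCartan

variable {EG HG ET HT : Type*}
  [NormedAddCommGroup EG] [NormedSpace ℝ EG] [TopologicalSpace HG]
  [NormedAddCommGroup ET] [NormedSpace ℝ ET] [TopologicalSpace HT]
  {IG : ModelWithCorners ℝ EG HG} {IT : ModelWithCorners ℝ ET HT}
  {G T : Type*} [TopologicalSpace G] [ChartedSpace HG G] [Group G] [LieGroup IG ∞ G]
  [TopologicalSpace T] [ChartedSpace HT T] [CommGroup T] [LieGroup IT ∞ T]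
  [IG.Boundaryless] [IT.Boundaryless]
  {𝒢 : MultiplicativeGerbe IG IT G T} (D : MultConnectiveStructure 𝒢)

/-- Maurer-Cartan data exist. -/
theorem nonempty_maurerCartanData [FiniteDimensional ℝ EG] [T2Space G] [SigmaCompactSpace G] :
    Nonempty (MaurerCartanData D) := by
  obtain ⟨Θ, hΘ⟩ := exists_curving 𝒢.cover.cover₁ D.A 𝒢.smooth_lam D.A_cocycle
  have hU₁ := 𝒢.cover.cover₁.isOpen
  have hU₂ := 𝒢.cover.cover₂.isOpen
  -- The curvature of the product with respect to an arbitrary curving is a global `2`-form `F`.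
  set Fl : 𝒢.cover.I₂ → G × G → EG × EG →L[ℝ] EG × EG →L[ℝ] ET := fun i x =>
    extDeriv₁ (IG.prod IG) (D.M i).1 x -
      (pullback₂ (IG.prod IG) IG (nerveFace₂ 0) (Θ (𝒢.cover.d₂ 0 i)).1 x +
        pullback₂ (IG.prod IG) IG (nerveFace₂ 2) (Θ (𝒢.cover.d₂ 2 i)).1 x) +
      pullback₂ (IG.prod IG) IG (nerveFace₂ 1) (Θ (𝒢.cover.d₂ 1 i)).1 x with hFl
  have hd := contMDiff_nerveFace₂ (I := IG) (G := G)
  have hs : ∀ j i, ∀ x ∈ 𝒢.cover.U₂ i, SmoothAltAt (IG.prod IG)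
      (pullback₂ (IG.prod IG) IG (nerveFace₂ j) (Θ (𝒢.cover.d₂ j i)).1) x := fun j i x hx =>
    (smoothAltAt_of_mem_forms₂ (hU₁ _) _ (𝒢.cover.mapsTo₂ j i hx)).pullback (hd j x)
  have ha : ∀ k i j x, x ∈ 𝒢.cover.U₂ i ∩ 𝒢.cover.U₂ j → nerveFace₂ k x ∈
      𝒢.cover.U₁ (𝒢.cover.d₂ k i) ∩ 𝒢.cover.U₁ (𝒢.cover.d₂ k j) := fun k i j x hx =>
    ⟨𝒢.cover.mapsTo₂ k i hx.1, 𝒢.cover.mapsTo₂ k j hx.2⟩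
  obtain ⟨F, hF, hFeq⟩ := isSmoothnessAlt.exists_glue (I := IG.prod IG) 𝒢.cover.cover₂ (h := Fl)
    (fun i x hx => isSmoothnessAlt.add (isSmoothnessAlt.sub
      (smoothAltAt_extDeriv₁ (hU₂ i) (D.M i) hx) (isSmoothnessAlt.add (hs 0 i x hx) (hs 2 i x hx)))
      (hs 1 i x hx)) (fun i j x hx => by
        have hA : ∀ k, ∀ y ∈ 𝒢.cover.U₂ i ∩ 𝒢.cover.U₂ j,
            SmoothAt₁ IG (D.A (𝒢.cover.d₂ k i) (𝒢.cover.d₂ k j)).1 (nerveFace₂ k y) :=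
          fun k y hy => smoothAt_of_mem_forms₁ ((hU₁ _).inter (hU₁ _)) _ (ha k i j y hy)
        exact curvature_eq_of_connection ((hU₂ i).inter (hU₂ j)) (𝒢.smooth_m i j) (hd 1) (hd 0)
          (hd 2) (hA 1) (hA 0) (hA 2) (fun y hy => smoothAt_of_mem_forms₁ (hU₂ i) _ hy.1)
          (fun y hy => smoothAt_of_mem_forms₁ (hU₂ j) _ hy.2) (D.M_connection i j) hx
          (hΘ _ _ _ (ha 1 i j x hx)) (hΘ _ _ _ (ha 0 i j x hx)) (hΘ _ _ _ (ha 2 i j x hx)))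
  have hd' := contMDiff_nerveFace₃ (I := IG) (G := G)
  -- The curvature is simplicially closed: the curvings cancel by the simplicial identities, and the
  -- rest is the exterior derivative of the flatness of `α`.
  obtain ⟨κ, w, hκ, hinv, hw, hFw⟩ := exists_pairing_primitive hF (fun z => by
    obtain ⟨i, hi⟩ := 𝒢.cover.cover₃.covers z
    have hm := fun k => 𝒢.cover.mapsTo₃ k i hi
    set Z : Fin 4 → Fin 3 → EG × EG × EG →L[ℝ] EG × EG × EG →L[ℝ] ET := fun k j =>
      pullback₂ (IG.prod (IG.prod IG)) (IG.prod IG) (nerveFace₃ k)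
        (pullback₂ (IG.prod IG) IG (nerveFace₂ j) (Θ (𝒢.cover.d₂ j (𝒢.cover.d₃ k i))).1) z with hZ
    have hZeq : ∀ j k : Fin 3, j ≤ k → Z k.succ j = Z j.castSucc k := fun j k hjk => by
      rw [hZ]
      simp only
      rw [
        ← pullback₂_comp ((hd _).mdifferentiableAt (by simp)) ((hd' _).mdifferentiableAt (by simp)),
        ← pullback₂_comp ((hd _).mdifferentiableAt (by simp)) ((hd' _).mdifferentiableAt (by simp)),
        nerveFace₂_nerveFace₃ hjk, 𝒢.cover.d₂_d₃ j k hjk]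
    have hface : ∀ k, pullback₂ (IG.prod (IG.prod IG)) (IG.prod IG) (nerveFace₃ k) F z =
        pullback₂ (IG.prod (IG.prod IG)) (IG.prod IG) (nerveFace₃ k)
          (extDeriv₁ (IG.prod IG) (D.M (𝒢.cover.d₃ k i)).1) z - (Z k 0 + Z k 2) + Z k 1 :=
      fun k => by
        rw [pullback₂, hFeq _ _ (hm k)]
        exact ContinuousLinearMap.ext fun u => ContinuousLinearMap.ext fun v => rfl
    have hflat := extDeriv₁_flat (𝒢.cover.cover₃.isOpen i) (𝒢.smooth_α i) (hd' 0) (hd' 2) (hd' 1)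
      (hd' 3) (fun y hy => smoothAt_of_mem_forms₁ (hU₂ _) _ (𝒢.cover.mapsTo₃ 0 i hy))
      (fun y hy => smoothAt_of_mem_forms₁ (hU₂ _) _ (𝒢.cover.mapsTo₃ 2 i hy))
      (fun y hy => smoothAt_of_mem_forms₁ (hU₂ _) _ (𝒢.cover.mapsTo₃ 1 i hy))
      (fun y hy => smoothAt_of_mem_forms₁ (hU₂ _) _ (𝒢.cover.mapsTo₃ 3 i hy)) (D.α_flat i) z hi
    rw [hface, hface, hface, hface]
    have z00 : Z 1 0 = Z 0 0 := hZeq 0 0 le_rfl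
    have z01 : Z 2 0 = Z 0 1 := hZeq 0 1 (by decide)
    have z02 : Z 3 0 = Z 0 2 := hZeq 0 2 (by decide)
    have z11 : Z 2 1 = Z 1 1 := hZeq 1 1 le_rfl
    have z12 : Z 3 1 = Z 1 2 := hZeq 1 2 (by decide)
    have z22 : Z 3 2 = Z 2 2 := hZeq 2 2 le_rfl
    rw [z00, z01, z02, z11, z12, z22]
    linear_combination (norm := module) hflat)
  choose Θ' hΘ' using fun i => exists_mem_forms₂ (hU₁ i) (a := fun x => (Θ i).1 x + w x)
    fun x hx => isSmoothnessAlt.add (smoothAltAt_of_mem_forms₂ (hU₁ i) _ hx) (hw x)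
  refine ⟨⟨κ, Θ', hκ, hinv, fun i j x hx => ?_, fun i x hx => ?_⟩⟩
  · rw [hΘ' i x hx.1, hΘ' j x hx.2, ← hΘ i j x hx]
    abel
  · rw [← hFw x, hFeq i x hx]
    have hp : ∀ k, pullback₂ (IG.prod IG) IG (nerveFace₂ k) (Θ' (𝒢.cover.d₂ k i)).1 x =
        pullback₂ (IG.prod IG) IG (nerveFace₂ k) (Θ (𝒢.cover.d₂ k i)).1 x +
          pullback₂ (IG.prod IG) IG (nerveFace₂ k) w x := fun k => by
      rw [pullback₂, hΘ' _ _ (𝒢.cover.mapsTo₂ k i hx)]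
      exact ContinuousLinearMap.ext fun u => ContinuousLinearMap.ext fun v => rfl
    change extDeriv₁ (IG.prod IG) (D.M i).1 x -
        (pullback₂ (IG.prod IG) IG (nerveFace₂ 2) (Θ' (𝒢.cover.d₂ 2 i)).1 x +
          pullback₂ (IG.prod IG) IG (nerveFace₂ 0) (Θ' (𝒢.cover.d₂ 0 i)).1 x) +
        pullback₂ (IG.prod IG) IG (nerveFace₂ 1) (Θ' (𝒢.cover.d₂ 1 i)).1 x = Fl i x -
        (pullback₂ (IG.prod IG) IG (nerveFace₂ 2) w x +
          pullback₂ (IG.prod IG) IG (nerveFace₂ 0) w x) +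
        pullback₂ (IG.prod IG) IG (nerveFace₂ 1) w x
    rw [hp, hp, hp, hFl]
    module

/-- Maurer-Cartan data are unique.  The difference of the curvings is a `2`-form `w` on `G`, and at
`(1, 1)` the curvature equation identifies the alternating form `w 1` with the symmetric difference
of the pairings; so both vanish, and along `{g} × {1}` the equation says that `w` is
left-invariant. -/
theorem maurerCartanData_eq (mc mc' : MaurerCartanData D) : mc = mc' := by
  have hdiff : ∀ i j, ∀ x ∈ 𝒢.cover.U₁ i ∩ 𝒢.cover.U₁ j,
      (mc.Θ i).1 x - (mc'.Θ i).1 x = (mc.Θ j).1 x - (mc'.Θ j).1 x := fun i j x hx => by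
    have h := (mc.Θ_curving i j x hx).trans (mc'.Θ_curving i j x hx).symm
    linear_combination (norm := module) h
  choose r hr using 𝒢.cover.cover₁.covers
  set w : G → EG →L[ℝ] EG →L[ℝ] ET := fun x => (mc.Θ (r x)).1 x - (mc'.Θ (r x)).1 x with hw
  have hwi : ∀ i, ∀ x ∈ 𝒢.cover.U₁ i, (mc.Θ i).1 x - (mc'.Θ i).1 x = w x := fun i x hx =>
    hdiff i (r x) x ⟨hx, hr x⟩
  have hwalt : ∀ x u v, w x u v = -w x v u := fun x u v => by
    simp only [hw, sub_apply, (mc.Θ _).2.2 x u v, (mc'.Θ _).2.2 x u v]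
    abel
  set κ := mc.pairing - mc'.pairing with hκ
  have hκs : ∀ u v, κ u v = κ v u := fun u v => by
    simp only [hκ, sub_apply, mc.symm u v, mc'.symm u v]
  have key : ∀ g h X₁ X₂ Y₁ Y₂, w (g * h) (leftTranslation IG (g * h) (adRep IG h⁻¹ X₁ + X₂))
      (leftTranslation IG (g * h) (adRep IG h⁻¹ Y₁ + Y₂)) -
        w g (leftTranslation IG g X₁) (leftTranslation IG g Y₁) -
        w h (leftTranslation IG h X₂) (leftTranslation IG h Y₂) =
      -(κ X₁ (adRep IG h Y₂) - κ Y₁ (adRep IG h X₂)) := by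
    intro g h X₁ X₂ Y₁ Y₂
    obtain ⟨i, hi⟩ := 𝒢.cover.cover₂.covers (g, h)
    have h1 := DFunLike.congr_fun (DFunLike.congr_fun (mc.curvature i _ hi)
      (leftTranslation IG g X₁, leftTranslation IG h X₂))
      (leftTranslation IG g Y₁, leftTranslation IG h Y₂)
    have h2 := DFunLike.congr_fun (DFunLike.congr_fun (mc'.curvature i _ hi)
      (leftTranslation IG g X₁, leftTranslation IG h X₂))
      (leftTranslation IG g Y₁, leftTranslation IG h Y₂)
    have w1 := hwi _ (g * h) (𝒢.cover.mapsTo₂ 1 i hi)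
    have w2 := hwi _ g (𝒢.cover.mapsTo₂ 2 i hi)
    have w0 := hwi _ h (𝒢.cover.mapsTo₂ 0 i hi)
    rw [← w1, ← w2, ← w0]
    simp only [add_apply, sub_apply, neg_apply, pullback₂_apply, pairWedge_apply, pullback₁_apply,
      differential_fst, differential_snd, ContinuousLinearMap.coe_fst',
      ContinuousLinearMap.coe_snd', differential_mul_leftTranslation, thetaL_leftTranslation,
      thetaR_eq, ContinuousLinearMap.comp_apply] at h1 h2
    simp only [hκ, sub_apply]
    linear_combination (norm := module) h1 - h2
  -- The left-hand side is alternating and the right-hand side symmetric.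
  have h11 : ∀ X Y, w 1 X Y = -κ X Y := fun X Y => by
    have h := key 1 1 X 0 0 Y
    simpa [leftTranslation_one, adRep_one] using h
  have hκ0 : ∀ X Y, κ X Y = 0 := fun X Y => by
    have h := hwalt 1 X Y
    rw [h11, h11, hκs Y X] at h
    have h2 : (2 : ℝ) • κ X Y = 0 := by linear_combination (norm := module) -h
    simpa using h2
  have hw0 : ∀ g, w g = 0 := fun g => by
    refine ContinuousLinearMap.ext fun u => ContinuousLinearMap.ext fun v => ?_
    have h := key g 1 0 (thetaL IG g u) 0 (thetaL IG g v)
    simpa [leftTranslation_one, adRep_one, h11, hκ0, leftTranslation_thetaL] using h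
  refine MaurerCartanData.ext (ContinuousLinearMap.ext fun u => ContinuousLinearMap.ext fun v => ?_)
    (funext fun i => Subtype.ext (funext fun x => ?_))
  · exact sub_eq_zero.1 (hκ0 u v)
  · by_cases hx : x ∈ 𝒢.cover.U₁ i
    · exact sub_eq_zero.1 ((hwi i x hx).trans (hw0 x))
    · rw [(mc.Θ i).2.1.2 x hx, (mc'.Θ i).2.1.2 x hx]

theorem nonempty_unique_maurerCartanData [FiniteDimensional ℝ EG] [T2Space G]
    [SigmaCompactSpace G] : Nonempty (Unique (MaurerCartanData D)) := by
  obtain ⟨mc⟩ := nonempty_maurerCartanData D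
  exact ⟨⟨⟨mc⟩, fun mc' => maurerCartanData_eq D mc' mc⟩⟩

end MaurerCartan

/-! ### Pullbacks along commutative squares -/

section CommSq

variable {E₀ H₀ E₁ H₁ E₂ H₂ E₃ H₃ V : Type*}
  [NormedAddCommGroup E₀] [NormedSpace ℝ E₀] [TopologicalSpace H₀]
  [NormedAddCommGroup E₁] [NormedSpace ℝ E₁] [TopologicalSpace H₁]
  [NormedAddCommGroup E₂] [NormedSpace ℝ E₂] [TopologicalSpace H₂]
  [NormedAddCommGroup E₃] [NormedSpace ℝ E₃] [TopologicalSpace H₃]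
  [NormedAddCommGroup V] [NormedSpace ℝ V]
  {I₀ : ModelWithCorners ℝ E₀ H₀} {I₁ : ModelWithCorners ℝ E₁ H₁}
  {I₂ : ModelWithCorners ℝ E₂ H₂} {I₃ : ModelWithCorners ℝ E₃ H₃}
  {X Y Y' Z : Type*}
  [TopologicalSpace X] [ChartedSpace H₀ X] [TopologicalSpace Y] [ChartedSpace H₁ Y]
  [TopologicalSpace Y'] [ChartedSpace H₂ Y'] [TopologicalSpace Z] [ChartedSpace H₃ Z]
  {f : X → Y} {g : Y → Z} {f' : X → Y'} {g' : Y' → Z}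

theorem pullback₁_comm_sq (hf : ContMDiff I₀ I₁ ∞ f) (hg : ContMDiff I₁ I₃ ∞ g)
    (hf' : ContMDiff I₀ I₂ ∞ f') (hg' : ContMDiff I₂ I₃ ∞ g') (h : g ∘ f = g' ∘ f')
    (a : Z → E₃ →L[ℝ] V) (x : X) :
    pullback₁ I₀ I₁ f (pullback₁ I₁ I₃ g a) x = pullback₁ I₀ I₂ f' (pullback₁ I₂ I₃ g' a) x := by
  rw [← pullback₁_comp (hg.mdifferentiableAt (by simp)) (hf.mdifferentiableAt (by simp)),
    ← pullback₁_comp (hg'.mdifferentiableAt (by simp)) (hf'.mdifferentiableAt (by simp)), h]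

theorem pullback₂_comm_sq (hf : ContMDiff I₀ I₁ ∞ f) (hg : ContMDiff I₁ I₃ ∞ g)
    (hf' : ContMDiff I₀ I₂ ∞ f') (hg' : ContMDiff I₂ I₃ ∞ g') (h : g ∘ f = g' ∘ f')
    (a : Z → E₃ →L[ℝ] E₃ →L[ℝ] V) (x : X) :
    pullback₂ I₀ I₁ f (pullback₂ I₁ I₃ g a) x = pullback₂ I₀ I₂ f' (pullback₂ I₂ I₃ g' a) x := by
  rw [← pullback₂_comp (hg.mdifferentiableAt (by simp)) (hf.mdifferentiableAt (by simp)),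
    ← pullback₂_comp (hg'.mdifferentiableAt (by simp)) (hf'.mdifferentiableAt (by simp)), h]

end CommSq

/-! ### Alternating products and connective structures on gerbes -/

section LogForm

variable {E H ET HT : Type*}
  [NormedAddCommGroup E] [NormedSpace ℝ E] [TopologicalSpace H]
  [NormedAddCommGroup ET] [NormedSpace ℝ ET] [TopologicalSpace HT]
  {I : ModelWithCorners ℝ E H} {IT : ModelWithCorners ℝ ET HT}
  {X T : Type*} [TopologicalSpace X] [ChartedSpace H X]
  [TopologicalSpace T] [ChartedSpace HT T] [CommGroup T] [LieGroup IT ∞ T]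

theorem logForm_div {a b : X → T} {x : X} (ha : ContMDiffAt I IT ∞ a x)
    (hb : ContMDiffAt I IT ∞ b x) :
    logForm IT I (fun y => a y * (b y)⁻¹) x = logForm IT I a x - logForm IT I b x := by
  rw [logForm_mul (g := fun y => (b y)⁻¹) ha hb.inv, logForm_inv hb, sub_eq_add_neg]

theorem logForm_alternating_three {a b c : X → T} {x : X} (ha : ContMDiffAt I IT ∞ a x)
    (hb : ContMDiffAt I IT ∞ b x) (hc : ContMDiffAt I IT ∞ c x) :
    logForm IT I (fun y => a y * (b y)⁻¹ * c y) x =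
      logForm IT I a x - logForm IT I b x + logForm IT I c x := by
  rw [logForm_mul (f := fun y => a y * (b y)⁻¹) (ha.mul hb.inv) hc, logForm_div ha hb]

theorem logForm_alternating_four {a b c d : X → T} {x : X} (ha : ContMDiffAt I IT ∞ a x)
    (hb : ContMDiffAt I IT ∞ b x) (hc : ContMDiffAt I IT ∞ c x) (hd : ContMDiffAt I IT ∞ d x) :
    logForm IT I (fun y => a y * (b y)⁻¹ * c y * (d y)⁻¹) x =
      logForm IT I a x - logForm IT I b x + logForm IT I c x - logForm IT I d x := by
  rw [logForm_div (a := fun y => a y * (b y)⁻¹ * c y) ((ha.mul hb.inv).mul hc) hd,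
    logForm_alternating_three ha hb hc]

theorem logForm_alternating_five {a b c d e : X → T} {x : X} (ha : ContMDiffAt I IT ∞ a x)
    (hb : ContMDiffAt I IT ∞ b x) (hc : ContMDiffAt I IT ∞ c x) (hd : ContMDiffAt I IT ∞ d x)
    (he : ContMDiffAt I IT ∞ e x) :
    logForm IT I (fun y => a y * (b y)⁻¹ * c y * (d y)⁻¹ * e y) x =
      logForm IT I a x - logForm IT I b x + logForm IT I c x - logForm IT I d x +
        logForm IT I e x := by
  rw [logForm_mul (f := fun y => a y * (b y)⁻¹ * c y * (d y)⁻¹)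
    (((ha.mul hb.inv).mul hc).mul hd.inv) he, logForm_alternating_four ha hb hc hd]

/-- A gerbe on a manifold admits a connective structure. -/
theorem exists_connective [I.Boundaryless] [IT.Boundaryless] [IsManifold I ∞ X]
    [FiniteDimensional ℝ E] [T2Space X] [SigmaCompactSpace X] {ι : Type*}
    {U : ι → Set X} (hU : IsOpenCovering U) {lam : ι → ι → ι → X → T}
    (hlam : ∀ i j k, ContMDiffOn I IT ∞ (lam i j k) (U i ∩ U j ∩ U k))
    (hcoc : ∀ i j k l, ∀ x ∈ U i ∩ U j ∩ U k ∩ U l,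
      lam i j k x * (lam i j l x)⁻¹ * lam i k l x * (lam j k l x)⁻¹ = 1) :
    ∃ A : ∀ i j, forms₁ I ET (U i ∩ U j), ∀ i j k, ∀ x ∈ U i ∩ U j ∩ U k,
      (A i j).1 x - (A i k).1 x + (A j k).1 x = logForm IT I (lam i j k) x := by
  have hU₂ := fun i j => (hU.isOpen i).inter (hU.isOpen j)
  have hU₃ := fun i j k => (hU₂ i j).inter (hU.isOpen k)
  have hs : ∀ i j k, ∀ x ∈ U i ∩ U j ∩ U k, ContMDiffAt I IT ∞ (lam i j k) x :=
    fun i j k x hx => (hlam i j k).contMDiffAt ((hU₃ i j k).mem_nhds hx)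
  obtain ⟨h, hh, hd⟩ := isSmoothness₁.exists_cech_primitive₂ (I := I) hU
    (c := fun i j k => logForm IT I (lam i j k))
    (fun i j k x hx => SmoothAt₁.logForm (hs i j k x hx))
    (by
      intro i j k l x hx
      have e : (fun y => lam i j k y * (lam i j l y)⁻¹ * lam i k l y * (lam j k l y)⁻¹) =ᶠ[𝓝 x]
          fun _ => 1 := by
        filter_upwards [((hU₃ i j k).inter (hU.isOpen l)).mem_nhds hx] with y hy
          using hcoc i j k l y hy
      have s1 := hs i j k x hx.1
      have s2 := hs i j l x ⟨hx.1.1, hx.2⟩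
      have s3 := hs i k l x ⟨⟨hx.1.1.1, hx.1.2⟩, hx.2⟩
      have s4 := hs j k l x ⟨⟨hx.1.1.2, hx.1.2⟩, hx.2⟩
      have e' := logForm_congr (I := IT) (J := I) e
      rwa [logForm_alternating_four s1 s2 s3 s4, logForm_const] at e')
  choose A hA using fun i j => exists_mem_forms₁ (hU₂ i j) (hh i j)
  refine ⟨A, fun i j k x hx => ?_⟩
  rw [hA i j x hx.1, hA i k x ⟨hx.1.1, hx.2⟩, hA j k x ⟨hx.1.2, hx.2⟩, hd i j k x hx]

end LogForm

/-! ### Simplicial identities of the action groupoid -/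

section ActionGroupoid

variable {EM HM EP HP EG HG : Type*}
  [NormedAddCommGroup EM] [NormedSpace ℝ EM] [TopologicalSpace HM]
  [NormedAddCommGroup EP] [NormedSpace ℝ EP] [TopologicalSpace HP]
  [NormedAddCommGroup EG] [NormedSpace ℝ EG] [TopologicalSpace HG]
  {IM : ModelWithCorners ℝ EM HM} {IP : ModelWithCorners ℝ EP HP} {IG : ModelWithCorners ℝ EG HG}
  {M P G : Type*} [TopologicalSpace M] [ChartedSpace HM M] [TopologicalSpace P] [ChartedSpace HP P]
  [TopologicalSpace G] [ChartedSpace HG G] [Group G]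
  (Q : PrincipalBundle IM IP IG M P G)

namespace PrincipalBundle

theorem face₁_face₂ {j k : Fin 2} (h : j ≤ k) :
    Q.face₁ j ∘ Q.face₂ k.succ = Q.face₁ k ∘ Q.face₂ j.castSucc := by
  funext x
  fin_cases j <;> fin_cases k <;>
    first | rfl | exact absurd h (by decide) | exact (Q.act_mul _ _ _).symm

theorem face₂_face₃ {j k : Fin 3} (h : j ≤ k) :
    Q.face₂ j ∘ Q.face₃ k.succ = Q.face₂ k ∘ Q.face₃ j.castSucc := by
  funext x
  fin_cases j <;> fin_cases k <;>
    first
    | rfl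
    | exact absurd h (by decide)
    | exact Prod.ext (Q.act_mul _ _ _).symm rfl
    | exact Prod.ext rfl (mul_assoc _ _ _)
    | exact Prod.ext rfl (mul_assoc _ _ _).symm

theorem snd_face₂ (k : Fin 3) : Prod.snd ∘ Q.face₂ k = nerveFace₂ k ∘ Prod.snd := by
  funext x
  fin_cases k <;> rfl

theorem snd_face₃ (k : Fin 4) : Prod.snd ∘ Q.face₃ k = nerveFace₃ k ∘ Prod.snd := by
  funext x
  fin_cases k <;> rfl

theorem proj_face₁ : Q.proj ∘ Q.face₁ 0 = Q.proj ∘ Q.face₁ 1 :=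
  funext fun z => Q.proj_act z.1 z.2

end PrincipalBundle

end ActionGroupoid

/-! ### Connective structures and their isomorphisms -/

section ConnectiveStructures

variable {EM HM EP HP EG HG ET HT : Type*}
  [NormedAddCommGroup EM] [NormedSpace ℝ EM] [TopologicalSpace HM]
  [NormedAddCommGroup EP] [NormedSpace ℝ EP] [TopologicalSpace HP]
  [NormedAddCommGroup EG] [NormedSpace ℝ EG] [TopologicalSpace HG]
  [NormedAddCommGroup ET] [NormedSpace ℝ ET] [TopologicalSpace HT]
  {IM : ModelWithCorners ℝ EM HM} {IP : ModelWithCorners ℝ EP HP}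
  {IG : ModelWithCorners ℝ EG HG} {IT : ModelWithCorners ℝ ET HT}
  {M P G T : Type*}
  [TopologicalSpace M] [ChartedSpace HM M] [IsManifold IM ∞ M]
  [TopologicalSpace P] [ChartedSpace HP P] [IsManifold IP ∞ P]
  [TopologicalSpace G] [ChartedSpace HG G] [Group G] [LieGroup IG ∞ G]
  [TopologicalSpace T] [ChartedSpace HT T] [CommGroup T] [LieGroup IT ∞ T]
  [IM.Boundaryless] [IP.Boundaryless] [IG.Boundaryless] [IT.Boundaryless]
  {𝒢 : MultiplicativeGerbe IG IT G T} {D : MultConnectiveStructure 𝒢}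
  {𝒳 : PrincipalTwoBundle IM IP M P 𝒢}

/-- For a connective structure `σ` on the gerbe over `P`, the isomorphism `ρ` admits a
connection. -/
theorem PrincipalTwoBundle.exists_connection [FiniteDimensional ℝ EP] [FiniteDimensional ℝ EG]
    [T2Space P] [T2Space G] [SigmaCompactSpace P] [SigmaCompactSpace G]
    (D : MultConnectiveStructure 𝒢) (𝒳 : PrincipalTwoBundle IM IP M P 𝒢)
    (σ : ∀ r s, forms₁ IP ET (𝒳.cover.V₀ r ∩ 𝒳.cover.V₀ s))
    (hσ : ∀ r s t, ∀ x ∈ 𝒳.cover.V₀ r ∩ 𝒳.cover.V₀ s ∩ 𝒳.cover.V₀ t,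
      (σ r s).1 x - (σ r t).1 x + (σ s t).1 x = logForm IT IP (𝒳.b r s t) x) :
    ∃ η : ∀ r, forms₁ (IP.prod IG) ET (𝒳.cover.V₁ r),
      ∀ r s, ∀ x ∈ 𝒳.cover.V₁ r ∩ 𝒳.cover.V₁ s,
        (η r).1 x - (η s).1 x =
          pullback₁ (IP.prod IG) IG Prod.snd (D.A (𝒳.cover.π₁ r) (𝒳.cover.π₁ s)).1 x +
            pullback₁ (IP.prod IG) IP (𝒳.toBundle.face₁ 1)
              (σ (𝒳.cover.d₁ 1 r) (𝒳.cover.d₁ 1 s)).1 x -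
            pullback₁ (IP.prod IG) IP (𝒳.toBundle.face₁ 0)
              (σ (𝒳.cover.d₁ 0 r) (𝒳.cover.d₁ 0 s)).1 x -
            logForm IT (IP.prod IG) (𝒳.ρ r s) x := by
  have hU₁ := 𝒢.cover.cover₁.isOpen
  have hV₀ := 𝒳.cover.cover₀.isOpen
  have hV₁ := 𝒳.cover.cover₁.isOpen
  have hf := 𝒳.toBundle.contMDiff_face₁
  have hsnd : ContMDiff (IP.prod IG) IG ∞ (Prod.snd : P × G → G) := contMDiff_snd
  have hρ : ∀ r s, ∀ x ∈ 𝒳.cover.V₁ r ∩ 𝒳.cover.V₁ s,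
      ContMDiffAt (IP.prod IG) IT ∞ (𝒳.ρ r s) x := fun r s x hx =>
    (𝒳.smooth_ρ r s).contMDiffAt (((hV₁ r).inter (hV₁ s)).mem_nhds hx)
  have hσs : ∀ j r s, ∀ x ∈ 𝒳.cover.V₁ r ∩ 𝒳.cover.V₁ s, SmoothAt₁ (IP.prod IG)
      (pullback₁ (IP.prod IG) IP (𝒳.toBundle.face₁ j)
        (σ (𝒳.cover.d₁ j r) (𝒳.cover.d₁ j s)).1) x := fun j r s x hx =>
    (smoothAt_of_mem_forms₁ ((hV₀ _).inter (hV₀ _)) _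
      ⟨𝒳.cover.mapsTo₁ j r hx.1, 𝒳.cover.mapsTo₁ j s hx.2⟩).pullback (hf j x)
  have hAs : ∀ r s, ∀ x ∈ 𝒳.cover.V₁ r ∩ 𝒳.cover.V₁ s, SmoothAt₁ (IP.prod IG)
      (pullback₁ (IP.prod IG) IG Prod.snd (D.A (𝒳.cover.π₁ r) (𝒳.cover.π₁ s)).1) x :=
    fun r s x hx => (smoothAt_of_mem_forms₁ ((hU₁ _).inter (hU₁ _)) _
      ⟨𝒳.cover.mapsTo_π₁ r hx.1, 𝒳.cover.mapsTo_π₁ s hx.2⟩).pullback (hsnd x)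
  obtain ⟨h, hh, hd⟩ := isSmoothness₁.exists_cech_primitive (I := IP.prod IG) 𝒳.cover.cover₁
    (c := fun r s x =>
      pullback₁ (IP.prod IG) IG Prod.snd (D.A (𝒳.cover.π₁ r) (𝒳.cover.π₁ s)).1 x +
        pullback₁ (IP.prod IG) IP (𝒳.toBundle.face₁ 1)
          (σ (𝒳.cover.d₁ 1 r) (𝒳.cover.d₁ 1 s)).1 x -
        pullback₁ (IP.prod IG) IP (𝒳.toBundle.face₁ 0)
          (σ (𝒳.cover.d₁ 0 r) (𝒳.cover.d₁ 0 s)).1 x -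
        logForm IT (IP.prod IG) (𝒳.ρ r s) x)
    (fun r s x hx => isSmoothness₁.sub (isSmoothness₁.sub (isSmoothness₁.add (hAs r s x hx)
      (hσs 1 r s x hx)) (hσs 0 r s x hx)) (SmoothAt₁.logForm (hρ r s x hx)))
    (by
      intro r s t x hx
      have hopen := (((hV₁ r).inter (hV₁ s)).inter (hV₁ t)).mem_nhds hx
      have hb : ∀ j, 𝒳.toBundle.face₁ j x ∈ 𝒳.cover.V₀ (𝒳.cover.d₁ j r) ∩
          𝒳.cover.V₀ (𝒳.cover.d₁ j s) ∩ 𝒳.cover.V₀ (𝒳.cover.d₁ j t) := fun j =>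
        ⟨⟨𝒳.cover.mapsTo₁ j r hx.1.1, 𝒳.cover.mapsTo₁ j s hx.1.2⟩, 𝒳.cover.mapsTo₁ j t hx.2⟩
      have hl : x.2 ∈ 𝒢.cover.U₁ (𝒳.cover.π₁ r) ∩ 𝒢.cover.U₁ (𝒳.cover.π₁ s) ∩
          𝒢.cover.U₁ (𝒳.cover.π₁ t) :=
        ⟨⟨𝒳.cover.mapsTo_π₁ r hx.1.1, 𝒳.cover.mapsTo_π₁ s hx.1.2⟩, 𝒳.cover.mapsTo_π₁ t hx.2⟩
      have e : (fun y => 𝒳.ρ r s y * (𝒳.ρ r t y)⁻¹ * 𝒳.ρ s t y) =ᶠ[𝓝 x] fun y =>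
          𝒳.b (𝒳.cover.d₁ 1 r) (𝒳.cover.d₁ 1 s) (𝒳.cover.d₁ 1 t) (𝒳.toBundle.face₁ 1 y) *
          (𝒳.b (𝒳.cover.d₁ 0 r) (𝒳.cover.d₁ 0 s) (𝒳.cover.d₁ 0 t) (𝒳.toBundle.face₁ 0 y))⁻¹ *
          𝒢.lam (𝒳.cover.π₁ r) (𝒳.cover.π₁ s) (𝒳.cover.π₁ t) y.2 := by
        filter_upwards [hopen] with y hy using 𝒳.ρ_cocycle r s t y hy
      have s1 := hρ r s x hx.1
      have s2 := hρ r t x ⟨hx.1.1, hx.2⟩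
      have s3 := hρ s t x ⟨hx.1.2, hx.2⟩
      have sb := fun j => (𝒳.smooth_b _ _ _).contMDiffAt
        ((((hV₀ (𝒳.cover.d₁ j r)).inter (hV₀ (𝒳.cover.d₁ j s))).inter
          (hV₀ (𝒳.cover.d₁ j t))).mem_nhds (hb j))
      have sl := (𝒢.smooth_lam _ _ _).contMDiffAt
        ((((hU₁ (𝒳.cover.π₁ r)).inter (hU₁ (𝒳.cover.π₁ s))).inter
          (hU₁ (𝒳.cover.π₁ t))).mem_nhds hl)
      have sb' := fun j => (sb j).comp x (hf j x)
      have sl' := sl.comp x (hsnd x)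
      have e' := logForm_congr (I := IT) (J := IP.prod IG) e
      have e'' := (logForm_alternating_three s1 s2 s3).symm.trans
        (e'.trans (logForm_alternating_three (sb' 1) (sb' 0) sl'))
      have c0 : ∀ j, logForm IT (IP.prod IG) (fun y => 𝒳.b (𝒳.cover.d₁ j r)
          (𝒳.cover.d₁ j s) (𝒳.cover.d₁ j t) (𝒳.toBundle.face₁ j y)) x =
          pullback₁ (IP.prod IG) IP (𝒳.toBundle.face₁ j)
            (σ (𝒳.cover.d₁ j r) (𝒳.cover.d₁ j s)).1 x -
          pullback₁ (IP.prod IG) IP (𝒳.toBundle.face₁ j)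
            (σ (𝒳.cover.d₁ j r) (𝒳.cover.d₁ j t)).1 x +
          pullback₁ (IP.prod IG) IP (𝒳.toBundle.face₁ j)
            (σ (𝒳.cover.d₁ j s) (𝒳.cover.d₁ j t)).1 x := fun j => by
        refine (logForm_comp (sb j) (hf j x)).trans ?_
        rw [pullback₁, ← hσ _ _ _ _ (hb j)]
        exact ContinuousLinearMap.ext fun u => rfl
      have cl : logForm IT (IP.prod IG) (fun y => 𝒢.lam (𝒳.cover.π₁ r) (𝒳.cover.π₁ s)
          (𝒳.cover.π₁ t) y.2) x =
          pullback₁ (IP.prod IG) IG Prod.snd (D.A (𝒳.cover.π₁ r) (𝒳.cover.π₁ s)).1 x -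
          pullback₁ (IP.prod IG) IG Prod.snd (D.A (𝒳.cover.π₁ r) (𝒳.cover.π₁ t)).1 x +
          pullback₁ (IP.prod IG) IG Prod.snd (D.A (𝒳.cover.π₁ s) (𝒳.cover.π₁ t)).1 x := by
        refine (logForm_comp sl (hsnd x)).trans ?_
        rw [pullback₁, ← D.A_cocycle _ _ _ _ hl]
        exact ContinuousLinearMap.ext fun u => rfl
      rw [c0, c0, cl] at e''
      linear_combination (norm := module) -e'')
  choose η hη using fun r => exists_mem_forms₁ (hV₁ r) (hh r)
  exact ⟨η, fun r s x hx => by rw [hη r x hx.1, hη s x hx.2, hd r s x hx]⟩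

/-- The failure of `β` to be flat for a connection `η` on `ρ`. -/
def flatnessDefect (D : MultConnectiveStructure 𝒢) (𝒳 : PrincipalTwoBundle IM IP M P 𝒢)
    (η : ∀ r, forms₁ (IP.prod IG) ET (𝒳.cover.V₁ r)) (r : 𝒳.cover.R₂) (x : P × G × G) :
    EP × EG × EG →L[ℝ] ET :=
  logForm IT (IP.prod (IG.prod IG)) (𝒳.β r) x +
    pullback₁ (IP.prod (IG.prod IG)) (IG.prod IG) Prod.snd (D.M (𝒳.cover.π₂ r)).1 x +
    pullback₁ (IP.prod (IG.prod IG)) (IP.prod IG) (𝒳.toBundle.face₂ 1)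
      (η (𝒳.cover.d₂ 1 r)).1 x -
    pullback₁ (IP.prod (IG.prod IG)) (IP.prod IG) (𝒳.toBundle.face₂ 0)
      (η (𝒳.cover.d₂ 0 r)).1 x -
    pullback₁ (IP.prod (IG.prod IG)) (IP.prod IG) (𝒳.toBundle.face₂ 2)
      (η (𝒳.cover.d₂ 2 r)).1 x

/-- The failure of `β` to be flat does not depend on the member of the cover: its change is the
logarithmic derivative of the cocycle equation of `β`, which is matched by the changes of the
connections on `m` and on `ρ`. -/
theorem flatnessDefect_eq {σ : ∀ r s, forms₁ IP ET (𝒳.cover.V₀ r ∩ 𝒳.cover.V₀ s)}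
    {η : ∀ r, forms₁ (IP.prod IG) ET (𝒳.cover.V₁ r)}
    (hη : ∀ r s, ∀ x ∈ 𝒳.cover.V₁ r ∩ 𝒳.cover.V₁ s,
      (η r).1 x - (η s).1 x =
        pullback₁ (IP.prod IG) IG Prod.snd (D.A (𝒳.cover.π₁ r) (𝒳.cover.π₁ s)).1 x +
          pullback₁ (IP.prod IG) IP (𝒳.toBundle.face₁ 1)
            (σ (𝒳.cover.d₁ 1 r) (𝒳.cover.d₁ 1 s)).1 x -
          pullback₁ (IP.prod IG) IP (𝒳.toBundle.face₁ 0)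
            (σ (𝒳.cover.d₁ 0 r) (𝒳.cover.d₁ 0 s)).1 x -
          logForm IT (IP.prod IG) (𝒳.ρ r s) x) (r s : 𝒳.cover.R₂) (x : P × G × G)
    (hx : x ∈ 𝒳.cover.V₂ r ∩ 𝒳.cover.V₂ s) :
    flatnessDefect D 𝒳 η r x = flatnessDefect D 𝒳 η s x := by
  have hU₂ := 𝒢.cover.cover₂.isOpen
  have hV₁ := 𝒳.cover.cover₁.isOpen
  have hV₂ := 𝒳.cover.cover₂.isOpen
  have hf₁ := 𝒳.toBundle.contMDiff_face₁
  have hf₂ := 𝒳.toBundle.contMDiff_face₂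
  have hn₂ := contMDiff_nerveFace₂ (I := IG) (G := G)
  have hs₁ : ContMDiff (IP.prod IG) IG ∞ (Prod.snd : P × G → G) := contMDiff_snd
  have hs₂ : ContMDiff (IP.prod (IG.prod IG)) (IG.prod IG) ∞
    (Prod.snd : P × G × G → G × G) := contMDiff_snd
  have sβ : ∀ r, ∀ x ∈ 𝒳.cover.V₂ r, ContMDiffAt (IP.prod (IG.prod IG)) IT ∞ (𝒳.β r) x :=
    fun r x hx => (𝒳.smooth_β r).contMDiffAt ((hV₂ r).mem_nhds hx)
  have m₂ : ∀ k, 𝒳.toBundle.face₂ k x ∈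
      𝒳.cover.V₁ (𝒳.cover.d₂ k r) ∩ 𝒳.cover.V₁ (𝒳.cover.d₂ k s) := fun k =>
    ⟨𝒳.cover.mapsTo₂ k r hx.1, 𝒳.cover.mapsTo₂ k s hx.2⟩
  have mM : x.2 ∈ 𝒢.cover.U₂ (𝒳.cover.π₂ r) ∩ 𝒢.cover.U₂ (𝒳.cover.π₂ s) :=
    ⟨𝒳.cover.mapsTo_π₂ r hx.1, 𝒳.cover.mapsTo_π₂ s hx.2⟩
  have sρ := fun k => (𝒳.smooth_ρ _ _).contMDiffAt
    (((hV₁ (𝒳.cover.d₂ k r)).inter (hV₁ (𝒳.cover.d₂ k s))).mem_nhds (m₂ k))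
  have sm := (𝒢.smooth_m _ _).contMDiffAt
    (((hU₂ (𝒳.cover.π₂ r)).inter (hU₂ (𝒳.cover.π₂ s))).mem_nhds mM)
  have sρ' := fun k => (sρ k).comp x (hf₂ k x)
  have sm' := sm.comp x (hs₂ x)
  have e : (fun y => 𝒳.β r y * (𝒳.β s y)⁻¹) =ᶠ[𝓝 x] fun y =>
      𝒳.ρ (𝒳.cover.d₂ 1 r) (𝒳.cover.d₂ 1 s) (𝒳.toBundle.face₂ 1 y) *
      (𝒳.ρ (𝒳.cover.d₂ 2 r) (𝒳.cover.d₂ 2 s) (𝒳.toBundle.face₂ 2 y))⁻¹ *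
      𝒢.m (𝒳.cover.π₂ r) (𝒳.cover.π₂ s) y.2 *
      (𝒳.ρ (𝒳.cover.d₂ 0 r) (𝒳.cover.d₂ 0 s) (𝒳.toBundle.face₂ 0 y))⁻¹ := by
    filter_upwards [((hV₂ r).inter (hV₂ s)).mem_nhds hx] with y hy
    rw [𝒳.β_cocycle r s y hy, mul_comm (𝒳.ρ (𝒳.cover.d₂ 2 r) _ _)⁻¹, mul_right_comm _ _ (𝒢.m _ _ _)]
  have e' := (logForm_div (sβ r x hx.1) (sβ s x hx.2)).symm.trans
    ((logForm_congr (I := IT) (J := IP.prod (IG.prod IG)) e).trans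
      (logForm_alternating_four (sρ' 1) (sρ' 2) sm' (sρ' 0)))
  set L : Fin 3 → EP × EG × EG →L[ℝ] ET := fun k => logForm IT (IP.prod (IG.prod IG)) (fun y =>
    𝒳.ρ (𝒳.cover.d₂ k r) (𝒳.cover.d₂ k s) (𝒳.toBundle.face₂ k y)) x with hL
  set S : Fin 3 → Fin 2 → EP × EG × EG →L[ℝ] ET := fun k j =>
    pullback₁ (IP.prod (IG.prod IG)) (IP.prod IG) (𝒳.toBundle.face₂ k)
      (pullback₁ (IP.prod IG) IP (𝒳.toBundle.face₁ j)
        (σ (𝒳.cover.d₁ j (𝒳.cover.d₂ k r)) (𝒳.cover.d₁ j (𝒳.cover.d₂ k s))).1) x with hS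
  set R : Fin 3 → EP × EG × EG →L[ℝ] ET := fun k =>
    pullback₁ (IP.prod (IG.prod IG)) (IP.prod IG) (𝒳.toBundle.face₂ k)
      (pullback₁ (IP.prod IG) IG Prod.snd
        (D.A (𝒳.cover.π₁ (𝒳.cover.d₂ k r)) (𝒳.cover.π₁ (𝒳.cover.d₂ k s))).1) x with hR
  have hηk : ∀ k, pullback₁ (IP.prod (IG.prod IG)) (IP.prod IG) (𝒳.toBundle.face₂ k)
        (η (𝒳.cover.d₂ k r)).1 x -
      pullback₁ (IP.prod (IG.prod IG)) (IP.prod IG) (𝒳.toBundle.face₂ k)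
        (η (𝒳.cover.d₂ k s)).1 x = R k + S k 1 - S k 0 - L k := fun k => by
    rw [hL]
    simp only
    rw [logForm_comp (sρ k) (hf₂ k x)]
    exact ContinuousLinearMap.ext fun u => DFunLike.congr_fun (hη _ _ _ (m₂ k)) _
  have hSeq : ∀ j k : Fin 2, j ≤ k → S k.succ j = S j.castSucc k := fun j k hjk => by
    rw [hS]
    simp only
    rw [pullback₁_comm_sq (hf₂ _) (hf₁ _) (hf₂ _) (hf₁ _) (𝒳.toBundle.face₁_face₂ hjk),
      𝒳.cover.d₁_d₂ j k hjk, 𝒳.cover.d₁_d₂ j k hjk]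
  have hReq : ∀ k, R k = pullback₁ (IP.prod (IG.prod IG)) (IG.prod IG) Prod.snd
      (pullback₁ (IG.prod IG) IG (nerveFace₂ k)
        (D.A (𝒢.cover.d₂ k (𝒳.cover.π₂ r)) (𝒢.cover.d₂ k (𝒳.cover.π₂ s))).1) x := fun k => by
    rw [hR]
    simp only
    rw [pullback₁_comm_sq (hf₂ k) hs₁ hs₂ (hn₂ k) (𝒳.toBundle.snd_face₂ k),
      𝒳.cover.π_d₂, 𝒳.cover.π_d₂]
  have hM : pullback₁ (IP.prod (IG.prod IG)) (IG.prod IG) Prod.snd (D.M (𝒳.cover.π₂ r)).1 x +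
      R 1 + logForm IT (IP.prod (IG.prod IG)) (fun y => 𝒢.m (𝒳.cover.π₂ r) (𝒳.cover.π₂ s) y.2) x =
      R 0 + R 2 +
      pullback₁ (IP.prod (IG.prod IG)) (IG.prod IG) Prod.snd (D.M (𝒳.cover.π₂ s)).1 x := by
    rw [hReq, hReq, hReq, logForm_comp sm (hs₂ x)]
    exact ContinuousLinearMap.ext fun u => DFunLike.congr_fun (D.M_connection _ _ _ mM) _
  have s00 : S 1 0 = S 0 0 := hSeq 0 0 le_rfl
  have s01 : S 2 0 = S 0 1 := hSeq 0 1 (by decide)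
  have s11 : S 2 1 = S 1 1 := hSeq 1 1 le_rfl
  have h0 := hηk 0
  have h1 := hηk 1
  have h2 := hηk 2
  rw [s00] at h1
  rw [s01, s11] at h2
  have e'' : logForm IT (IP.prod (IG.prod IG)) (𝒳.β r) x -
    logForm IT (IP.prod (IG.prod IG)) (𝒳.β s) x = L 1 - L 2 +
      logForm IT (IP.prod (IG.prod IG)) (fun y => 𝒢.m (𝒳.cover.π₂ r) (𝒳.cover.π₂ s) y.2) x -
      L 0 := e'
  unfold flatnessDefect
  linear_combination (norm := module) e'' + hM + h1 - h0 - h2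

/-- The failure of `β` to be flat is simplicially closed: this is the logarithmic derivative of the
pentagon identity of `β`, together with the flatness of `α`. -/
theorem flatnessDefect_closed {η : ∀ r, forms₁ (IP.prod IG) ET (𝒳.cover.V₁ r)}
    {F : P × G × G → EP × EG × EG →L[ℝ] ET}
    (hFeq : ∀ r, ∀ x ∈ 𝒳.cover.V₂ r, F x = flatnessDefect D 𝒳 η r x) (x : P × G × G × G) :
    pullback₁ (IP.prod (IG.prod (IG.prod IG))) (IP.prod (IG.prod IG)) (𝒳.toBundle.face₃ 0) F x +
        pullback₁ (IP.prod (IG.prod (IG.prod IG))) (IP.prod (IG.prod IG))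
          (𝒳.toBundle.face₃ 2) F x =
      pullback₁ (IP.prod (IG.prod (IG.prod IG))) (IP.prod (IG.prod IG))
          (𝒳.toBundle.face₃ 1) F x +
        pullback₁ (IP.prod (IG.prod (IG.prod IG))) (IP.prod (IG.prod IG))
          (𝒳.toBundle.face₃ 3) F x := by
  have hU₃ := 𝒢.cover.cover₃.isOpen
  have hV₂ := 𝒳.cover.cover₂.isOpen
  have hV₃ := 𝒳.cover.cover₃.isOpen
  have hf₂ := 𝒳.toBundle.contMDiff_face₂
  have hf₃ := 𝒳.toBundle.contMDiff_face₃
  have hn₃ := contMDiff_nerveFace₃ (I := IG) (G := G)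
  have hs₂ : ContMDiff (IP.prod (IG.prod IG)) (IG.prod IG) ∞
    (Prod.snd : P × G × G → G × G) := contMDiff_snd
  have hs₃ : ContMDiff (IP.prod (IG.prod (IG.prod IG))) (IG.prod (IG.prod IG)) ∞
    (Prod.snd : P × G × G × G → G × G × G) := contMDiff_snd
  have sβ : ∀ r, ∀ x ∈ 𝒳.cover.V₂ r, ContMDiffAt (IP.prod (IG.prod IG)) IT ∞ (𝒳.β r) x :=
    fun r x hx => (𝒳.smooth_β r).contMDiffAt ((hV₂ r).mem_nhds hx)
  obtain ⟨r, hr⟩ := 𝒳.cover.cover₃.covers x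
  have m₃ := fun k => 𝒳.cover.mapsTo₃ k r hr
  have mα := 𝒳.cover.mapsTo_π₃ r hr
  have sβk := fun k => sβ _ _ (m₃ k)
  have sα := (𝒢.smooth_α _).contMDiffAt ((hU₃ (𝒳.cover.π₃ r)).mem_nhds mα)
  have sβk' := fun k => (sβk k).comp x (hf₃ k x)
  have sα' := sα.comp x (hs₃ x)
  set L : Fin 4 → EP × EG × EG × EG →L[ℝ] ET := fun k =>
    logForm IT (IP.prod (IG.prod (IG.prod IG))) (fun y =>
      𝒳.β (𝒳.cover.d₃ k r) (𝒳.toBundle.face₃ k y)) x with hL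
  set N : Fin 4 → Fin 3 → EP × EG × EG × EG →L[ℝ] ET := fun k j =>
    pullback₁ (IP.prod (IG.prod (IG.prod IG))) (IP.prod (IG.prod IG)) (𝒳.toBundle.face₃ k)
      (pullback₁ (IP.prod (IG.prod IG)) (IP.prod IG) (𝒳.toBundle.face₂ j)
        (η (𝒳.cover.d₂ j (𝒳.cover.d₃ k r))).1) x with hN
  set R : Fin 4 → EP × EG × EG × EG →L[ℝ] ET := fun k =>
    pullback₁ (IP.prod (IG.prod (IG.prod IG))) (IP.prod (IG.prod IG)) (𝒳.toBundle.face₃ k)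
      (pullback₁ (IP.prod (IG.prod IG)) (IG.prod IG) Prod.snd
        (D.M (𝒳.cover.π₂ (𝒳.cover.d₃ k r))).1) x with hR
  have hface : ∀ k, pullback₁ (IP.prod (IG.prod (IG.prod IG))) (IP.prod (IG.prod IG))
      (𝒳.toBundle.face₃ k) F x = L k + R k + N k 1 - N k 0 - N k 2 := fun k => by
    rw [pullback₁, hFeq _ _ (m₃ k), hL]
    simp only
    rw [logForm_comp (sβk k) (hf₃ k x)]
    exact ContinuousLinearMap.ext fun u => rfl
  have hNeq : ∀ j k : Fin 3, j ≤ k → N k.succ j = N j.castSucc k := fun j k hjk => by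
    rw [hN]
    simp only
    rw [pullback₁_comm_sq (hf₃ _) (hf₂ _) (hf₃ _) (hf₂ _) (𝒳.toBundle.face₂_face₃ hjk),
      𝒳.cover.d₂_d₃ j k hjk]
  have hReq : ∀ k, R k = pullback₁ (IP.prod (IG.prod (IG.prod IG))) (IG.prod (IG.prod IG))
      Prod.snd (pullback₁ (IG.prod (IG.prod IG)) (IG.prod IG) (nerveFace₃ k)
        (D.M (𝒢.cover.d₃ k (𝒳.cover.π₃ r))).1) x := fun k => by
    rw [hR]
    simp only
    rw [pullback₁_comm_sq (hf₃ k) hs₂ hs₃ (hn₃ k) (𝒳.toBundle.snd_face₃ k), 𝒳.cover.π_d₃]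
  have hM : logForm IT (IP.prod (IG.prod (IG.prod IG))) (fun y => 𝒢.α (𝒳.cover.π₃ r) y.2) x +
      R 0 + R 2 = R 1 + R 3 := by
    rw [hReq, hReq, hReq, hReq, logForm_comp sα (hs₃ x)]
    exact ContinuousLinearMap.ext fun u => DFunLike.congr_fun (D.α_flat _ _ mα) _
  have ep : (fun y => 𝒳.β (𝒳.cover.d₃ 3 r) (𝒳.toBundle.face₃ 3 y) *
      (𝒳.β (𝒳.cover.d₃ 2 r) (𝒳.toBundle.face₃ 2 y))⁻¹ *
      𝒳.β (𝒳.cover.d₃ 1 r) (𝒳.toBundle.face₃ 1 y) *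
      (𝒳.β (𝒳.cover.d₃ 0 r) (𝒳.toBundle.face₃ 0 y))⁻¹ * 𝒢.α (𝒳.cover.π₃ r) y.2) =ᶠ[𝓝 x]
      fun _ => 1 := by
    filter_upwards [(hV₃ r).mem_nhds hr] with y hy using 𝒳.pentagon r y hy
  have ep' := logForm_congr (I := IT) (J := IP.prod (IG.prod (IG.prod IG))) ep
  rw [logForm_const] at ep'
  have ep3 : L 3 - L 2 + L 1 - L 0 +
    logForm IT (IP.prod (IG.prod (IG.prod IG))) (fun y => 𝒢.α (𝒳.cover.π₃ r) y.2) x = 0 :=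
    (logForm_alternating_five (sβk' 3) (sβk' 2) (sβk' 1) (sβk' 0) sα').symm.trans ep'
  have n00 : N 1 0 = N 0 0 := hNeq 0 0 le_rfl
  have n01 : N 2 0 = N 0 1 := hNeq 0 1 (by decide)
  have n02 : N 3 0 = N 0 2 := hNeq 0 2 (by decide)
  have n11 : N 2 1 = N 1 1 := hNeq 1 1 le_rfl
  have n12 : N 3 1 = N 1 2 := hNeq 1 2 (by decide)
  have n22 : N 3 2 = N 2 2 := hNeq 2 2 le_rfl
  rw [hface, hface, hface, hface, n00, n01, n02, n11, n12, n22]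
  linear_combination (norm := module) hM - ep3

section Existence

variable [FiniteDimensional ℝ EM] [T2Space M] [SigmaCompactSpace M]
  [FiniteDimensional ℝ EP] [FiniteDimensional ℝ EG]
  [T2Space P] [T2Space G] [SigmaCompactSpace P] [SigmaCompactSpace G]

variable (D 𝒳) in
/-- Connective structures exist.  For arbitrary connections on the gerbe over `P` and on `ρ`, the
failure of `β` to be flat is a global `1`-form on `P × G²`.  By the pentagon identities it is closed
for the simplicial differential, hence exact, and the connection on `ρ` can be corrected. -/
theorem nonempty_connectiveStructure : Nonempty (ConnectiveStructure 𝒳 D) := by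
  obtain ⟨σ, hσ⟩ := exists_connective (I := IP) 𝒳.cover.cover₀ 𝒳.smooth_b 𝒳.b_cocycle
  obtain ⟨η, hη⟩ := 𝒳.exists_connection D σ hσ
  have hU₂ := 𝒢.cover.cover₂.isOpen
  have hV₁ := 𝒳.cover.cover₁.isOpen
  have hf₂ := 𝒳.toBundle.contMDiff_face₂
  have hs₂ : ContMDiff (IP.prod (IG.prod IG)) (IG.prod IG) ∞
    (Prod.snd : P × G × G → G × G) := contMDiff_snd
  have sη : ∀ j r, ∀ x ∈ 𝒳.cover.V₂ r, SmoothAt₁ (IP.prod (IG.prod IG))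
      (pullback₁ (IP.prod (IG.prod IG)) (IP.prod IG) (𝒳.toBundle.face₂ j)
        (η (𝒳.cover.d₂ j r)).1) x := fun j r x hx =>
    (smoothAt_of_mem_forms₁ (hV₁ _) _ (𝒳.cover.mapsTo₂ j r hx)).pullback (hf₂ j x)
  have sM : ∀ r, ∀ x ∈ 𝒳.cover.V₂ r, SmoothAt₁ (IP.prod (IG.prod IG))
      (pullback₁ (IP.prod (IG.prod IG)) (IG.prod IG) Prod.snd (D.M (𝒳.cover.π₂ r)).1) x :=
    fun r x hx =>
      (smoothAt_of_mem_forms₁ (hU₂ _) _ (𝒳.cover.mapsTo_π₂ r hx)).pullback (hs₂ x)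
  have sβ : ∀ r, ∀ x ∈ 𝒳.cover.V₂ r, ContMDiffAt (IP.prod (IG.prod IG)) IT ∞ (𝒳.β r) x :=
    fun r x hx => (𝒳.smooth_β r).contMDiffAt ((𝒳.cover.cover₂.isOpen r).mem_nhds hx)
  obtain ⟨F, hF, hFeq⟩ := isSmoothness₁.exists_glue (I := IP.prod (IG.prod IG)) 𝒳.cover.cover₂
    (h := flatnessDefect D 𝒳 η) (fun r x hx => isSmoothness₁.sub (isSmoothness₁.sub
      (isSmoothness₁.add (isSmoothness₁.add (SmoothAt₁.logForm (sβ r x hx)) (sM r x hx))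
        (sη 1 r x hx)) (sη 0 r x hx)) (sη 2 r x hx)) (flatnessDefect_eq hη)
  obtain ⟨e, he, heF⟩ := 𝒳.toBundle.exists_primitive₁_double hF (flatnessDefect_closed hFeq)
  choose η' hη' using fun r => exists_mem_forms₁ (hV₁ r) (a := fun x => (η r).1 x + e x)
    fun x hx => isSmoothness₁.add (smoothAt_of_mem_forms₁ (hV₁ r) _ hx) (he x)
  refine ⟨⟨σ, η', hσ, fun r s x hx => ?_, fun r x hx => ?_⟩⟩
  · rw [hη' r x hx.1, hη' s x hx.2]
    linear_combination (norm := module) hη r s x hx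
  · have hp : ∀ k, pullback₁ (IP.prod (IG.prod IG)) (IP.prod IG) (𝒳.toBundle.face₂ k)
        (η' (𝒳.cover.d₂ k r)).1 x =
        pullback₁ (IP.prod (IG.prod IG)) (IP.prod IG) (𝒳.toBundle.face₂ k)
          (η (𝒳.cover.d₂ k r)).1 x +
        pullback₁ (IP.prod (IG.prod IG)) (IP.prod IG) (𝒳.toBundle.face₂ k) e x := fun k => by
      rw [pullback₁, hη' _ _ (𝒳.cover.mapsTo₂ k r hx)]
      exact ContinuousLinearMap.ext fun u => rfl
    have h1 := heF x
    rw [hFeq r x hx, flatnessDefect] at h1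
    rw [hp, hp, hp]
    linear_combination (norm := module) -h1

end Existence

section Isomorphisms

variable [FiniteDimensional ℝ EM] [T2Space M] [SigmaCompactSpace M]

/-- Any two connective structures are isomorphic.  Isomorphisms of the connective structures of the
gerbe over `P` exist; the failure of such an isomorphism to be compatible with `ρ` is a closed,
hence exact, global `1`-form on `P × G`. -/
theorem nonempty_connectiveIso [FiniteDimensional ℝ EP] [T2Space P] [SigmaCompactSpace P]
    (S₁ S₂ : ConnectiveStructure 𝒳 D) : Nonempty (ConnectiveIso S₁ S₂) := by
  have hV₀ := 𝒳.cover.cover₀.isOpen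
  have hV₁ := 𝒳.cover.cover₁.isOpen
  have hf₁ := 𝒳.toBundle.contMDiff_face₁
  have hf₂ := 𝒳.toBundle.contMDiff_face₂
  have hσ : ∀ (S : ConnectiveStructure 𝒳 D) r s, ∀ x ∈ 𝒳.cover.V₀ r ∩ 𝒳.cover.V₀ s,
      SmoothAt₁ IP (S.σ r s).1 x := fun S r s x hx =>
    smoothAt_of_mem_forms₁ ((hV₀ r).inter (hV₀ s)) _ hx
  obtain ⟨φ, hφ, hφd⟩ := isSmoothness₁.exists_cech_primitive (I := IP) 𝒳.cover.cover₀
    (c := fun r s x => (S₁.σ r s).1 x - (S₂.σ r s).1 x)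
    (fun r s x hx => isSmoothness₁.sub (hσ S₁ r s x hx) (hσ S₂ r s x hx))
    (fun r s t x hx => by
      have h1 := S₁.σ_cocycle r s t x hx
      have h2 := S₂.σ_cocycle r s t x hx
      linear_combination (norm := module) h1 - h2)
  -- The failure of `φ` to be compatible with `ρ` is a global `1`-form.
  set El : 𝒳.cover.R₁ → P × G → EP × EG →L[ℝ] ET := fun r x =>
    (S₁.η r).1 x - (S₂.η r).1 x +
      pullback₁ (IP.prod IG) IP (𝒳.toBundle.face₁ 0) (φ (𝒳.cover.d₁ 0 r)) x -
      pullback₁ (IP.prod IG) IP (𝒳.toBundle.face₁ 1) (φ (𝒳.cover.d₁ 1 r)) x with hEl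
  have sη : ∀ (S : ConnectiveStructure 𝒳 D) r, ∀ x ∈ 𝒳.cover.V₁ r,
      SmoothAt₁ (IP.prod IG) (S.η r).1 x := fun S r x hx => smoothAt_of_mem_forms₁ (hV₁ r) _ hx
  have sφ : ∀ j r, ∀ x ∈ 𝒳.cover.V₁ r, SmoothAt₁ (IP.prod IG)
      (pullback₁ (IP.prod IG) IP (𝒳.toBundle.face₁ j) (φ (𝒳.cover.d₁ j r))) x := fun j r x hx =>
    (hφ _ _ (𝒳.cover.mapsTo₁ j r hx)).pullback (hf₁ j x)
  obtain ⟨E, hE, hEeq⟩ := isSmoothness₁.exists_glue (I := IP.prod IG) 𝒳.cover.cover₁ (h := El)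
    (fun r x hx => isSmoothness₁.sub (isSmoothness₁.add (isSmoothness₁.sub (sη S₁ r x hx)
      (sη S₂ r x hx)) (sφ 0 r x hx)) (sφ 1 r x hx)) (fun r s x hx => by
      have h : ∀ j, pullback₁ (IP.prod IG) IP (𝒳.toBundle.face₁ j) (φ (𝒳.cover.d₁ j r)) x -
          pullback₁ (IP.prod IG) IP (𝒳.toBundle.face₁ j) (φ (𝒳.cover.d₁ j s)) x =
          pullback₁ (IP.prod IG) IP (𝒳.toBundle.face₁ j)
            (S₁.σ (𝒳.cover.d₁ j r) (𝒳.cover.d₁ j s)).1 x -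
          pullback₁ (IP.prod IG) IP (𝒳.toBundle.face₁ j)
            (S₂.σ (𝒳.cover.d₁ j r) (𝒳.cover.d₁ j s)).1 x := fun j =>
        ContinuousLinearMap.ext fun u => DFunLike.congr_fun (hφd _ _ _
          ⟨𝒳.cover.mapsTo₁ j r hx.1, 𝒳.cover.mapsTo₁ j s hx.2⟩) _
      have h1 := S₁.η_connection r s x hx
      have h2 := S₂.η_connection r s x hx
      simp only [hEl]
      linear_combination (norm := module) h1 - h2 + h 0 - h 1)
  -- It is closed because `β` is flat for both connective structures.
  obtain ⟨e, he, heE⟩ := 𝒳.toBundle.exists_primitive₁ hE (fun x => by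
    obtain ⟨r, hr⟩ := 𝒳.cover.cover₂.covers x
    have m₂ := fun k => 𝒳.cover.mapsTo₂ k r hr
    set Z : Fin 3 → Fin 2 → EP × EG × EG →L[ℝ] ET := fun k j =>
      pullback₁ (IP.prod (IG.prod IG)) (IP.prod IG) (𝒳.toBundle.face₂ k)
        (pullback₁ (IP.prod IG) IP (𝒳.toBundle.face₁ j)
          (φ (𝒳.cover.d₁ j (𝒳.cover.d₂ k r)))) x with hZ
    have hface : ∀ k, pullback₁ (IP.prod (IG.prod IG)) (IP.prod IG) (𝒳.toBundle.face₂ k) E x =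
        pullback₁ (IP.prod (IG.prod IG)) (IP.prod IG) (𝒳.toBundle.face₂ k)
          (S₁.η (𝒳.cover.d₂ k r)).1 x -
        pullback₁ (IP.prod (IG.prod IG)) (IP.prod IG) (𝒳.toBundle.face₂ k)
          (S₂.η (𝒳.cover.d₂ k r)).1 x + Z k 0 - Z k 1 := fun k => by
      rw [pullback₁, hEeq _ _ (m₂ k)]
      exact ContinuousLinearMap.ext fun u => rfl
    have hZeq : ∀ j k : Fin 2, j ≤ k → Z k.succ j = Z j.castSucc k := fun j k hjk => by
      rw [hZ]
      simp only
      rw [pullback₁_comm_sq (hf₂ _) (hf₁ _) (hf₂ _) (hf₁ _) (𝒳.toBundle.face₁_face₂ hjk),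
        𝒳.cover.d₁_d₂ j k hjk]
    have z00 : Z 1 0 = Z 0 0 := hZeq 0 0 le_rfl
    have z01 : Z 2 0 = Z 0 1 := hZeq 0 1 (by decide)
    have z11 : Z 2 1 = Z 1 1 := hZeq 1 1 le_rfl
    have h1 := S₁.β_flat r x hr
    have h2 := S₂.β_flat r x hr
    rw [hface, hface, hface, z00, z01, z11]
    linear_combination (norm := module) h1 - h2)
  choose φ' hφ' using fun r => exists_mem_forms₁ (hV₀ r) (a := fun x => φ r x - e x)
    fun x hx => isSmoothness₁.sub (hφ r x hx) (he x)
  refine ⟨⟨φ', fun r s x hx => ?_, fun r x hx => ?_⟩⟩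
  · rw [hφ' r x hx.1, hφ' s x hx.2, ← hφd r s x hx]
    abel
  · have hp : ∀ j, pullback₁ (IP.prod IG) IP (𝒳.toBundle.face₁ j) (φ' (𝒳.cover.d₁ j r)).1 x =
        pullback₁ (IP.prod IG) IP (𝒳.toBundle.face₁ j) (φ (𝒳.cover.d₁ j r)) x -
        pullback₁ (IP.prod IG) IP (𝒳.toBundle.face₁ j) e x := fun j => by
      rw [pullback₁, hφ' _ _ (𝒳.cover.mapsTo₁ j r hx)]
      exact ContinuousLinearMap.ext fun u => rfl
    have h := heE x
    rw [hEeq r x hx] at h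
    simp only [hEl] at h
    rw [hp, hp]
    linear_combination (norm := module) -h

/-- The action of `Ω¹(M, 𝔱)` on isomorphisms of connective structures. -/
theorem exists_connectiveIso_act (S₁ S₂ : ConnectiveStructure 𝒳 D) :
    ∃ act : ConnectiveIso S₁ S₂ → forms₁ IM ET (univ : Set M) → ConnectiveIso S₁ S₂,
      ∀ φ τ r, ∀ x ∈ 𝒳.cover.V₀ r, ((act φ τ).φ r).1 x =
        (φ.φ r).1 x + pullback₁ IP IM 𝒳.toBundle.proj τ.1 x := by
  have hV₀ := 𝒳.cover.cover₀.isOpen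
  choose f hf using fun (φ : ConnectiveIso S₁ S₂) (τ : forms₁ IM ET (univ : Set M)) r =>
    exists_mem_forms₁ (hV₀ r)
      (a := fun x => (φ.φ r).1 x + pullback₁ IP IM 𝒳.toBundle.proj τ.1 x)
      fun x hx => isSmoothness₁.add (smoothAt_of_mem_forms₁ (hV₀ r) _ hx)
        ((smoothAt_of_mem_forms₁ isOpen_univ τ (mem_univ _)).pullback (𝒳.toBundle.smooth_proj x))
  refine ⟨fun φ τ => ⟨f φ τ, fun r s x hx => ?_, fun r x hx => ?_⟩, hf⟩
  · rw [hf φ τ r x hx.1, hf φ τ s x hx.2, ← φ.connection r s x hx]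
    abel
  · have hp : ∀ j, pullback₁ (IP.prod IG) IP (𝒳.toBundle.face₁ j) (f φ τ (𝒳.cover.d₁ j r)).1 x =
        pullback₁ (IP.prod IG) IP (𝒳.toBundle.face₁ j) (φ.φ (𝒳.cover.d₁ j r)).1 x +
        pullback₁ (IP.prod IG) IP (𝒳.toBundle.face₁ j)
          (pullback₁ IP IM 𝒳.toBundle.proj τ.1) x := fun j => by
      rw [pullback₁, hf _ _ _ _ (𝒳.cover.mapsTo₁ j r hx)]
      exact ContinuousLinearMap.ext fun u => rfl
    have hπ := 𝒳.toBundle.smooth_proj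
    rw [hp, hp, pullback₁_comm_sq (𝒳.toBundle.contMDiff_face₁ 0) hπ
      (𝒳.toBundle.contMDiff_face₁ 1) hπ 𝒳.toBundle.proj_face₁]
    linear_combination (norm := module) φ.comm r x hx

/-- Two isomorphisms between the same connective structures differ by a global `1`-form on `P`, and
compatibility with `ρ` says that it is basic. -/
theorem exists_connectiveIso_torsor [FiniteDimensional ℝ EP] [T2Space P] [SigmaCompactSpace P]
    (S₁ S₂ : ConnectiveStructure 𝒳 D) :
    ∃ act : ConnectiveIso S₁ S₂ → forms₁ IM ET (univ : Set M) → ConnectiveIso S₁ S₂,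
      IsAdditiveTorsor act ∧
      ∀ (τ : forms₁ IM ET (univ : Set M)) (φ : ConnectiveIso S₁ S₂) (r : 𝒳.cover.R₀),
        ∀ x ∈ 𝒳.cover.V₀ r, ((act φ τ).φ r).1 x =
          (φ.φ r).1 x + pullback₁ IP IM 𝒳.toBundle.proj τ.1 x := by
  obtain ⟨act, hact⟩ := exists_connectiveIso_act S₁ S₂
  have hext : ∀ φ φ' : ConnectiveIso S₁ S₂, (∀ r, ∀ x ∈ 𝒳.cover.V₀ r,
      (φ.φ r).1 x = (φ'.φ r).1 x) → φ = φ' := fun φ φ' h =>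
    ConnectiveIso.ext (funext fun r => Subtype.ext (funext fun x => by
      by_cases hx : x ∈ 𝒳.cover.V₀ r
      · exact h r x hx
      · rw [(φ.φ r).2.2 x hx, (φ'.φ r).2.2 x hx]))
  refine ⟨act, ⟨nonempty_connectiveIso S₁ S₂, fun φ => hext _ _ fun r x hx => ?_,
    fun φ τ τ' => hext _ _ fun r x hx => ?_, fun φ φ' => ?_⟩, fun τ φ r x hx => hact φ τ r x hx⟩
  · rw [hact _ _ _ _ hx]
    exact ContinuousLinearMap.ext fun u => add_zero _
  · rw [hact _ _ _ _ hx, hact _ _ _ _ hx, hact _ _ _ _ hx, add_assoc]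
    rfl
  · have hV₀ := 𝒳.cover.cover₀.isOpen
    obtain ⟨a, ha, haeq⟩ := isSmoothness₁.exists_glue (I := IP) 𝒳.cover.cover₀
      (h := fun r x => (φ'.φ r).1 x - (φ.φ r).1 x)
      (fun r x hx => isSmoothness₁.sub (smoothAt_of_mem_forms₁ (hV₀ r) _ hx)
        (smoothAt_of_mem_forms₁ (hV₀ r) _ hx)) (fun r s x hx => by
        have h1 := φ.connection r s x hx
        have h2 := φ'.connection r s x hx
        linear_combination (norm := module) h2 - h1)
    obtain ⟨τ, hτ, hτa⟩ := 𝒳.toBundle.descend₁ ha (fun z => by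
      obtain ⟨r, hr⟩ := 𝒳.cover.cover₁.covers z
      have hp : ∀ j, pullback₁ (IP.prod IG) IP (𝒳.toBundle.face₁ j) a z =
          pullback₁ (IP.prod IG) IP (𝒳.toBundle.face₁ j) (φ'.φ (𝒳.cover.d₁ j r)).1 z -
          pullback₁ (IP.prod IG) IP (𝒳.toBundle.face₁ j) (φ.φ (𝒳.cover.d₁ j r)).1 z :=
        fun j => by
          rw [pullback₁, haeq _ _ (𝒳.cover.mapsTo₁ j r hr)]
          exact ContinuousLinearMap.ext fun u => rfl
      have h1 := φ.comm r z hr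
      have h2 := φ'.comm r z hr
      change pullback₁ (IP.prod IG) IP (𝒳.toBundle.face₁ 0) a z =
        pullback₁ (IP.prod IG) IP (𝒳.toBundle.face₁ 1) a z
      rw [hp, hp]
      linear_combination (norm := module) h2 - h1)
    obtain ⟨τ', hτ'⟩ := exists_mem_forms₁ isOpen_univ fun m _ => hτ m
    have hττ : τ'.1 = τ := funext fun m => hτ' m (mem_univ m)
    refine ⟨τ', hext _ _ fun r x hx => ?_, fun τ'' h => Subtype.ext ?_⟩
    · rw [hact _ _ _ _ hx, hττ, hτa, haeq r x hx]
      abel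
    · rw [hττ]
      refine 𝒳.toBundle.pullback₁_proj_injective fun p => ?_
      obtain ⟨r, hr⟩ := 𝒳.cover.cover₀.covers p
      have h1 := hact φ τ'' r p hr
      rw [h] at h1
      rw [hτa, haeq r p hr, h1]
      abel

end Isomorphisms

end ConnectiveStructures

/-! ### Tensorial forms and the central extension -/

section Extension

variable {EM HM EP HP EG HG : Type*}
  [NormedAddCommGroup EM] [NormedSpace ℝ EM] [TopologicalSpace HM]
  [NormedAddCommGroup EP] [NormedSpace ℝ EP] [TopologicalSpace HP]
  [NormedAddCommGroup EG] [NormedSpace ℝ EG] [TopologicalSpace HG]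
  {IM : ModelWithCorners ℝ EM HM} {IP : ModelWithCorners ℝ EP HP} {IG : ModelWithCorners ℝ EG HG}
  {M P G : Type*} [TopologicalSpace M] [ChartedSpace HM M] [TopologicalSpace P] [ChartedSpace HP P]
  [TopologicalSpace G] [ChartedSpace HG G] [Group G] [LieGroup IG ∞ G]
  {V : Type*} [NormedAddCommGroup V] [NormedSpace ℝ V]
  {Q : PrincipalBundle IM IP IG M P G}

namespace PrincipalBundle

theorem Connection.act_apply (A : Q.Connection) (z : P × G) (u : EP × EG) :
    pullback₁ (IP.prod IG) IP Q.act A.1.1 z u =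
      adRep IG z.2⁻¹ (pullback₁ (IP.prod IG) IP Prod.fst A.1.1 z u +
        pullback₁ (IP.prod IG) IG Prod.snd (thetaR IG) z u) := by
  rw [A.2 z, map_add]
  simp only [add_apply, ContinuousLinearMap.comp_apply, pullback₁_apply, thetaR_eq,
    adRep_inv_adRep]

theorem adForms_act_apply (a : Q.adForms) (z : P × G) (u : EP × EG) :
    pullback₁ (IP.prod IG) IP Q.act a.1.1 z u =
      adRep IG z.2⁻¹ (pullback₁ (IP.prod IG) IP Prod.fst a.1.1 z u) := by
  rw [a.2 z]
  rfl

/-- The translate of a `G`-connection by a tensorial form. -/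
def Connection.add (A : Q.Connection) (a : Q.adForms) : Q.Connection :=
  ⟨A.1 + a.1, fun z => by
    refine ContinuousLinearMap.ext fun u => ?_
    have h₁ := DFunLike.congr_fun (A.2 z) u
    have h₂ := DFunLike.congr_fun (a.2 z) u
    simp only [pullback₁_apply, add_apply, ContinuousLinearMap.comp_apply, Submodule.coe_add,
      Pi.add_apply, map_add] at h₁ h₂ ⊢
    rw [h₁, h₂]
    abel⟩

/-- The inhomogeneous term `g*θᴸ` cancels in the difference of two connections. -/
theorem Connection.sub_mem_adForms (A A' : Q.Connection) : A'.1 - A.1 ∈ Q.adForms := fun z => by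
  refine ContinuousLinearMap.ext fun u => ?_
  have h₁ := DFunLike.congr_fun (A.2 z) u
  have h₂ := DFunLike.congr_fun (A'.2 z) u
  simp only [pullback₁_apply, add_apply, ContinuousLinearMap.comp_apply, Submodule.coe_sub,
    Pi.sub_apply, sub_apply, map_sub] at h₁ h₂ ⊢
  rw [h₁, h₂]
  abel

theorem pullback₂_proj_add (β β' : M → EM →L[ℝ] EM →L[ℝ] V) (p : P) :
    pullback₂ IP IM Q.proj (β + β') p = pullback₂ IP IM Q.proj β p + pullback₂ IP IM Q.proj β' p :=
  rfl

theorem pullback₂_act_proj (β : M → EM →L[ℝ] EM →L[ℝ] V) (z : P × G) :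
    pullback₂ (IP.prod IG) IP Q.act (pullback₂ IP IM Q.proj β) z =
      pullback₂ (IP.prod IG) IP Prod.fst (pullback₂ IP IM Q.proj β) z :=
  pullback₂_comm_sq Q.smooth_act Q.smooth_proj contMDiff_fst Q.smooth_proj Q.proj_face₁ β z

variable {κ : EG →L[ℝ] EG →L[ℝ] V}

/-- For an invariant pairing, `⟨a ∧ a'⟩` is basic for tensorial forms `a` and `a'`. -/
theorem pairWedge_adForms_act (hκ : ∀ (g : G) X Y, κ (adRep IG g X) (adRep IG g Y) = κ X Y)
    (a a' : Q.adForms) (z : P × G) :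
    pullback₂ (IP.prod IG) IP Q.act (pairWedge κ a.1.1 a'.1.1) z =
      pullback₂ (IP.prod IG) IP Prod.fst (pairWedge κ a.1.1 a'.1.1) z := by
  refine ContinuousLinearMap.ext fun u => ContinuousLinearMap.ext fun v => ?_
  rw [pullback₂_apply, pullback₂_apply, pairWedge_apply, pairWedge_apply]
  simp only [← pullback₁_apply, adForms_act_apply, hκ]

/-- The failure of `⟨A ∧ a⟩` to be basic, for a connection `A` and a tensorial form `a`. -/
theorem pairWedge_connection_act (hκ : ∀ (g : G) X Y, κ (adRep IG g X) (adRep IG g Y) = κ X Y)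
    (A : Q.Connection) (a : Q.adForms) (z : P × G) (u v : EP × EG) :
    pullback₂ (IP.prod IG) IP Q.act (pairWedge κ A.1.1 a.1.1) z u v =
      pullback₂ (IP.prod IG) IP Prod.fst (pairWedge κ A.1.1 a.1.1) z u v +
        (κ (pullback₁ (IP.prod IG) IG Prod.snd (thetaR IG) z u)
            (pullback₁ (IP.prod IG) IP Prod.fst a.1.1 z v) -
          κ (pullback₁ (IP.prod IG) IG Prod.snd (thetaR IG) z v)
            (pullback₁ (IP.prod IG) IP Prod.fst a.1.1 z u)) := by
  rw [pullback₂_apply, pullback₂_apply, pairWedge_apply, pairWedge_apply]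
  simp only [← pullback₁_apply, adForms_act_apply, Connection.act_apply, hκ]
  simp only [map_add, add_apply]
  abel

/-- The failure of `⟨A ⊗ A⟩` to be basic, for a connection `A`. -/
theorem pairTensor_connection_act (hκ : ∀ (g : G) X Y, κ (adRep IG g X) (adRep IG g Y) = κ X Y)
    (A : Q.Connection) (z : P × G) (u v : EP × EG) :
    pullback₂ (IP.prod IG) IP Q.act (pairTensor κ A.1.1 A.1.1) z u v =
      pullback₂ (IP.prod IG) IP Prod.fst (pairTensor κ A.1.1 A.1.1) z u v +
        κ (pullback₁ (IP.prod IG) IP Prod.fst A.1.1 z u)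
          (pullback₁ (IP.prod IG) IG Prod.snd (thetaR IG) z v) +
        κ (pullback₁ (IP.prod IG) IG Prod.snd (thetaR IG) z u)
          (pullback₁ (IP.prod IG) IP Prod.fst A.1.1 z v) +
        κ (pullback₁ (IP.prod IG) IG Prod.snd (thetaR IG) z u)
          (pullback₁ (IP.prod IG) IG Prod.snd (thetaR IG) z v) := by
  rw [pullback₂_apply, pullback₂_apply, pairTensor_apply, pairTensor_apply]
  simp only [← pullback₁_apply, Connection.act_apply, hκ]
  simp only [map_add, add_apply]
  abel

variable [IM.Boundaryless] [IP.Boundaryless] [IG.Boundaryless]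
  [IsManifold IM ∞ M] [IsManifold IP ∞ P]
  [FiniteDimensional ℝ EM] [T2Space M] [SigmaCompactSpace M]

theorem descend_tensors₂ {b : P → EP →L[ℝ] EP →L[ℝ] V} (hb : ∀ p, SmoothAt₂ IP b p)
    (h : ∀ z, pullback₂ (IP.prod IG) IP Q.act b z = pullback₂ (IP.prod IG) IP Prod.fst b z) :
    ∃ β : tensors₂ IM V (univ : Set M), ∀ p, pullback₂ IP IM Q.proj β.1 p = b p := by
  obtain ⟨τ, hτ, hτb⟩ := Q.descend₂ hb h
  obtain ⟨β, hβ⟩ := exists_mem_tensors₂ isOpen_univ fun m _ => hτ m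
  exact ⟨β, fun p => by rw [show β.1 = τ from funext fun m => hβ m (mem_univ m), hτb]⟩

/-- A basic `2`-form descends to `M`; that the result is alternating follows from the injectivity of
the pullback along `π`. -/
theorem descend_forms₂ {b : P → EP →L[ℝ] EP →L[ℝ] V} (hb : ∀ p, SmoothAltAt IP b p)
    (h : ∀ z, pullback₂ (IP.prod IG) IP Q.act b z = pullback₂ (IP.prod IG) IP Prod.fst b z) :
    ∃ β : forms₂ IM V (univ : Set M), ∀ p, pullback₂ IP IM Q.proj β.1 p = b p := by
  obtain ⟨β, hβ⟩ := descend_tensors₂ (fun p => (hb p).1) h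
  have halt : β.1 = fun m => -(β.1 m).flip := Q.pullback₂_proj_injective fun p => by
    refine ContinuousLinearMap.ext fun u => ContinuousLinearMap.ext fun v => ?_
    change pullback₂ IP IM Q.proj β.1 p u v = -pullback₂ IP IM Q.proj β.1 p v u
    rw [hβ]
    exact (hb p).2.self_of_nhds u v
  exact ⟨⟨β.1, β.2, fun m u v => DFunLike.congr_fun (DFunLike.congr_fun (congrFun halt m) u) v⟩, hβ⟩

end PrincipalBundle

/-- Elements of the extension may be compared on `P`, where the group law is explicit. -/
theorem AdExtension.eq_of {x y : AdExtension V Q} (ha : x.a = y.a)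
    (hb : ∀ p, pullback₂ IP IM Q.proj x.b.1 p = pullback₂ IP IM Q.proj y.b.1 p) : x = y := by
  obtain ⟨a, b⟩ := x
  obtain ⟨a', b'⟩ := y
  obtain rfl : a = a' := ha
  obtain rfl : b = b' := Subtype.ext (Q.pullback₂_proj_injective hb)
  rfl

/-- The central extension of the group of tensorial `1`-forms by the `2`-forms on `M`. -/
theorem exists_adExtension_group [IM.Boundaryless] [IP.Boundaryless] [IG.Boundaryless]
    [IsManifold IM ∞ M] [IsManifold IP ∞ P] [FiniteDimensional ℝ EM] [T2Space M]
    [SigmaCompactSpace M] {κ : EG →L[ℝ] EG →L[ℝ] V} (hs : ∀ X Y, κ X Y = κ Y X)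
    (hκ : ∀ (g : G) X Y, κ (adRep IG g X) (adRep IG g Y) = κ X Y) :
    ∃ _ : Group (AdExtension V Q),
      IsAdExtensionProduct κ (fun x y : AdExtension V Q => x * y) ∧
        (1 : AdExtension V Q) = ⟨0, 0⟩ := by
  choose w hw using fun a a' : Q.adForms => PrincipalBundle.descend_forms₂ (IM := IM)
    (fun p => (smoothAt_of_mem_forms₁ isOpen_univ a.1 (mem_univ p)).pairWedge
      (smoothAt_of_mem_forms₁ isOpen_univ a'.1 (mem_univ p)))
    (PrincipalBundle.pairWedge_adForms_act hκ a a')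
  let _ : Mul (AdExtension V Q) := ⟨fun x y => ⟨x.a + y.a, x.b + y.b + w x.a y.a⟩⟩
  let _ : One (AdExtension V Q) := ⟨⟨0, 0⟩⟩
  let _ : Inv (AdExtension V Q) := ⟨fun x => ⟨-x.a, -x.b⟩⟩
  have hmul : ∀ (x y : AdExtension V Q) p u v, pullback₂ IP IM Q.proj (x * y).b.1 p u v =
      pullback₂ IP IM Q.proj x.b.1 p u v + pullback₂ IP IM Q.proj y.b.1 p u v +
        (κ (x.a.1.1 p u) (y.a.1.1 p v) - κ (x.a.1.1 p v) (y.a.1.1 p u)) := fun x y p u v => by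
    rw [← pairWedge_apply, ← hw]
    rfl
  have hext : ∀ x y : AdExtension V Q, x.a = y.a → (∀ p u v,
      pullback₂ IP IM Q.proj x.b.1 p u v = pullback₂ IP IM Q.proj y.b.1 p u v) → x = y :=
    fun x y ha hb => AdExtension.eq_of ha fun p =>
      ContinuousLinearMap.ext fun u => ContinuousLinearMap.ext fun v => hb p u v
  have ha : ∀ (a a' : Q.adForms) p u, (a + a').1.1 p u = a.1.1 p u + a'.1.1 p u :=
    fun _ _ _ _ => rfl
  refine ⟨Group.ofLeftAxioms (fun x y z => hext _ _ (add_assoc _ _ _) fun p u v => ?_)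
    (fun x => hext _ _ (zero_add _) fun p u v => ?_)
    (fun x => hext _ _ (neg_add_cancel x.a) fun p u v => ?_), fun x y => ⟨rfl, funext fun p => ?_⟩,
    rfl⟩
  · rw [hmul, hmul, hmul, hmul]
    change _ + _ + (κ ((x.a + y.a).1.1 p u) _ - κ ((x.a + y.a).1.1 p v) _) =
      _ + _ + (κ _ ((y.a + z.a).1.1 p v) - κ _ ((y.a + z.a).1.1 p u))
    simp only [ha, map_add, add_apply]
    abel
  · rw [hmul]
    change (0 : V) + _ + (κ 0 _ - κ 0 _) = _
    simp only [map_zero, zero_apply, sub_zero, add_zero, zero_add]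
  · rw [hmul]
    change -pullback₂ IP IM Q.proj x.b.1 p u v + _ + (κ (-x.a.1.1 p u) _ - κ (-x.a.1.1 p v) _) = 0
    simp only [map_neg, neg_apply, hs (x.a.1.1 p v)]
    abel
  · refine ContinuousLinearMap.ext fun u => ContinuousLinearMap.ext fun v => ?_
    exact hmul x y p u v

end Extension

/-! ### Connections and enhanced connections -/

section TwoConnections

variable {EM HM EP HP EG HG ET HT : Type*}
  [NormedAddCommGroup EM] [NormedSpace ℝ EM] [TopologicalSpace HM]
  [NormedAddCommGroup EP] [NormedSpace ℝ EP] [TopologicalSpace HP]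
  [NormedAddCommGroup EG] [NormedSpace ℝ EG] [TopologicalSpace HG]
  [NormedAddCommGroup ET] [NormedSpace ℝ ET] [TopologicalSpace HT]
  {IM : ModelWithCorners ℝ EM HM} {IP : ModelWithCorners ℝ EP HP}
  {IG : ModelWithCorners ℝ EG HG} {IT : ModelWithCorners ℝ ET HT}
  {M P G T : Type*}
  [TopologicalSpace M] [ChartedSpace HM M] [IsManifold IM ∞ M]
  [TopologicalSpace P] [ChartedSpace HP P] [IsManifold IP ∞ P]
  [TopologicalSpace G] [ChartedSpace HG G] [Group G] [LieGroup IG ∞ G]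
  [TopologicalSpace T] [ChartedSpace HT T] [CommGroup T] [LieGroup IT ∞ T]
  [IM.Boundaryless] [IP.Boundaryless] [IG.Boundaryless] [IT.Boundaryless]
  {𝒢 : MultiplicativeGerbe IG IT G T} {D : MultConnectiveStructure 𝒢}
  {𝒳 : PrincipalTwoBundle IM IP M P 𝒢}

variable {S : ConnectiveStructure 𝒳 D} {mc : MaurerCartanData D}

/-- The forms `⟨p*A ∧ g*θᴿ⟩` on `P × G` and `⟨g₁*θᴸ ∧ g₂*θᴿ⟩` on `G²` satisfy the cocycle condition
over `P × G²`. -/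
theorem pairWedge_connection_cocycle {Q : PrincipalBundle IM IP IG M P G}
    {κ : EG →L[ℝ] EG →L[ℝ] ET}
    (hκ : ∀ (g : G) X Y, κ (adRep IG g X) (adRep IG g Y) = κ X Y) (A : Q.Connection)
    (x : P × G × G) :
    pullback₂ (IP.prod (IG.prod IG)) (IG.prod IG) Prod.snd
        (pairWedge κ (pullback₁ (IG.prod IG) IG Prod.fst (thetaL IG))
          (pullback₁ (IG.prod IG) IG Prod.snd (thetaR IG))) x +
      pullback₂ (IP.prod (IG.prod IG)) (IP.prod IG) (Q.face₂ 1)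
        (pairWedge κ (pullback₁ (IP.prod IG) IP Prod.fst A.1.1)
          (pullback₁ (IP.prod IG) IG Prod.snd (thetaR IG))) x =
      pullback₂ (IP.prod (IG.prod IG)) (IP.prod IG) (Q.face₂ 0)
        (pairWedge κ (pullback₁ (IP.prod IG) IP Prod.fst A.1.1)
          (pullback₁ (IP.prod IG) IG Prod.snd (thetaR IG))) x +
      pullback₂ (IP.prod (IG.prod IG)) (IP.prod IG) (Q.face₂ 2)
        (pairWedge κ (pullback₁ (IP.prod IG) IP Prod.fst A.1.1)
          (pullback₁ (IP.prod IG) IG Prod.snd (thetaR IG))) x := by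
  have hf₁ := Q.contMDiff_face₁
  have hf₂ := Q.contMDiff_face₂
  have hn₂ := contMDiff_nerveFace₂ (I := IG) (G := G)
  have hs₁ : ContMDiff (IP.prod IG) IG ∞ (Prod.snd : P × G → G) := contMDiff_snd
  have hs₂ : ContMDiff (IP.prod (IG.prod IG)) (IG.prod IG) ∞
    (Prod.snd : P × G × G → G × G) := contMDiff_snd
  have a12 : ∀ u, pullback₁ (IP.prod (IG.prod IG)) (IP.prod IG) (Q.face₂ 1)
      (pullback₁ (IP.prod IG) IP Prod.fst A.1.1) x u =
      pullback₁ (IP.prod (IG.prod IG)) (IP.prod IG) (Q.face₂ 2)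
        (pullback₁ (IP.prod IG) IP Prod.fst A.1.1) x u := fun u =>
    DFunLike.congr_fun (pullback₁_comm_sq (hf₂ 1) (hf₁ 1) (hf₂ 2) (hf₁ 1)
      (Q.face₁_face₂ (j := 1) (k := 1) le_rfl).symm A.1.1 x) u
  have a0 : ∀ u, pullback₁ (IP.prod (IG.prod IG)) (IP.prod IG) (Q.face₂ 0)
      (pullback₁ (IP.prod IG) IP Prod.fst A.1.1) x u =
      adRep IG x.2.1⁻¹ (pullback₁ (IP.prod (IG.prod IG)) (IP.prod IG) (Q.face₂ 2)
        (pullback₁ (IP.prod IG) IP Prod.fst A.1.1) x u) +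
      pullback₁ (IP.prod (IG.prod IG)) (IG.prod IG) Prod.snd
        (pullback₁ (IG.prod IG) IG Prod.fst (thetaL IG)) x u := fun u => by
    have h1 : pullback₁ (IP.prod (IG.prod IG)) (IP.prod IG) (Q.face₂ 0)
        (pullback₁ (IP.prod IG) IP Prod.fst A.1.1) x =
      pullback₁ (IP.prod (IG.prod IG)) (IP.prod IG) (Q.face₂ 2)
        (pullback₁ (IP.prod IG) IP Q.act A.1.1) x :=
      pullback₁_comm_sq (hf₂ 0) (hf₁ 1) (hf₂ 2) (hf₁ 0)
        (Q.face₁_face₂ (j := 0) (k := 1) (by decide)).symm A.1.1 x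
    have h2 : pullback₁ (IP.prod (IG.prod IG)) (IP.prod IG) (Q.face₂ 2)
        (pullback₁ (IP.prod IG) IG Prod.snd (thetaL IG)) x =
      pullback₁ (IP.prod (IG.prod IG)) (IG.prod IG) Prod.snd
        (pullback₁ (IG.prod IG) IG Prod.fst (thetaL IG)) x :=
      pullback₁_comm_sq (hf₂ 2) hs₁ hs₂ (hn₂ 2) (Q.snd_face₂ 2) _ x
    rw [h1, ← h2, pullback₁_apply, A.2]
    rfl
  have γ1 : ∀ u, pullback₁ (IP.prod (IG.prod IG)) (IP.prod IG) (Q.face₂ 1)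
      (pullback₁ (IP.prod IG) IG Prod.snd (thetaR IG)) x u =
      pullback₁ (IP.prod (IG.prod IG)) (IP.prod IG) (Q.face₂ 2)
        (pullback₁ (IP.prod IG) IG Prod.snd (thetaR IG)) x u +
      adRep IG x.2.1 (pullback₁ (IP.prod (IG.prod IG)) (IG.prod IG) Prod.snd
        (pullback₁ (IG.prod IG) IG Prod.snd (thetaR IG)) x u) := fun u => by
    have h1 : pullback₁ (IP.prod (IG.prod IG)) (IP.prod IG) (Q.face₂ 1)
        (pullback₁ (IP.prod IG) IG Prod.snd (thetaR IG)) x =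
      pullback₁ (IP.prod (IG.prod IG)) (IG.prod IG) Prod.snd
        (pullback₁ (IG.prod IG) IG (fun z : G × G => z.1 * z.2) (thetaR IG)) x :=
      pullback₁_comm_sq (hf₂ 1) hs₁ hs₂ (hn₂ 1) (Q.snd_face₂ 1) _ x
    have h2 : pullback₁ (IP.prod (IG.prod IG)) (IP.prod IG) (Q.face₂ 2)
        (pullback₁ (IP.prod IG) IG Prod.snd (thetaR IG)) x =
      pullback₁ (IP.prod (IG.prod IG)) (IG.prod IG) Prod.snd
        (pullback₁ (IG.prod IG) IG Prod.fst (thetaR IG)) x :=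
      pullback₁_comm_sq (hf₂ 2) hs₁ hs₂ (hn₂ 2) (Q.snd_face₂ 2) _ x
    rw [h1, h2, pullback₁_apply, pullback_thetaR_mul mdifferentiableAt_fst mdifferentiableAt_snd]
    rfl
  have γ0 : ∀ u, pullback₁ (IP.prod (IG.prod IG)) (IP.prod IG) (Q.face₂ 0)
      (pullback₁ (IP.prod IG) IG Prod.snd (thetaR IG)) x u =
      pullback₁ (IP.prod (IG.prod IG)) (IG.prod IG) Prod.snd
        (pullback₁ (IG.prod IG) IG Prod.snd (thetaR IG)) x u := fun u =>
    DFunLike.congr_fun (pullback₁_comm_sq (hf₂ 0) hs₁ hs₂ (hn₂ 0) (Q.snd_face₂ 0) _ x) u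
  have hinv : ∀ X Y, κ (adRep IG x.2.1⁻¹ X) Y = κ X (adRep IG x.2.1 Y) := fun X Y => by
    rw [← hκ x.2.1, adRep_adRep_inv]
  refine ContinuousLinearMap.ext fun u => ContinuousLinearMap.ext fun v => ?_
  simp only [add_apply, pullback₂_apply, pairWedge_apply]
  simp only [← pullback₁_apply, a12, a0, γ1, γ0, map_add, add_apply, hinv]
  abel

set_option maxHeartbeats 400000 in
/-- Every `G`-connection underlies a connection on the `2`-bundle.  For an arbitrary curving, the
failure of the curvature equation is a closed, hence exact, global `2`-form on `P × G`. -/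
theorem exists_twoConnection_over [FiniteDimensional ℝ EM] [T2Space M] [SigmaCompactSpace M]
    [FiniteDimensional ℝ EP] [T2Space P] [SigmaCompactSpace P] (S : ConnectiveStructure 𝒳 D)
    (mc : MaurerCartanData D) (A : 𝒳.toBundle.Connection) : ∃ c : TwoConnection S mc, c.A = A := by
  obtain ⟨B, hB⟩ := exists_curving (I := IP) 𝒳.cover.cover₀ S.σ 𝒳.smooth_b S.σ_cocycle
  have hU₁ := 𝒢.cover.cover₁.isOpen
  have hU₂ := 𝒢.cover.cover₂.isOpen
  have hV₀ := 𝒳.cover.cover₀.isOpen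
  have hV₁ := 𝒳.cover.cover₁.isOpen
  have hf₁ := 𝒳.toBundle.contMDiff_face₁
  have hf₂ := 𝒳.toBundle.contMDiff_face₂
  have hn₂ := contMDiff_nerveFace₂ (I := IG) (G := G)
  have hs₁ : ContMDiff (IP.prod IG) IG ∞ (Prod.snd : P × G → G) := contMDiff_snd
  have hs₂ : ContMDiff (IP.prod (IG.prod IG)) (IG.prod IG) ∞
    (Prod.snd : P × G × G → G × G) := contMDiff_snd
  set W : P × G → EP × EG →L[ℝ] EP × EG →L[ℝ] ET := pairWedge mc.pairing
    (pullback₁ (IP.prod IG) IP Prod.fst A.1.1)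
    (pullback₁ (IP.prod IG) IG Prod.snd (thetaR IG)) with hW
  -- The curvature of `ρ` with respect to the curving `B` is a global `2`-form `K`.
  set Kl : 𝒳.cover.R₁ → P × G → EP × EG →L[ℝ] EP × EG →L[ℝ] ET := fun r x =>
    extDeriv₁ (IP.prod IG) (S.η r).1 x -
      (pullback₂ (IP.prod IG) IG Prod.snd (mc.Θ (𝒳.cover.π₁ r)).1 x +
        pullback₂ (IP.prod IG) IP (𝒳.toBundle.face₁ 1) (B (𝒳.cover.d₁ 1 r)).1 x) +
      pullback₂ (IP.prod IG) IP (𝒳.toBundle.face₁ 0) (B (𝒳.cover.d₁ 0 r)).1 x with hKl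
  have sB : ∀ j r, ∀ x ∈ 𝒳.cover.V₁ r, SmoothAltAt (IP.prod IG)
      (pullback₂ (IP.prod IG) IP (𝒳.toBundle.face₁ j) (B (𝒳.cover.d₁ j r)).1) x := fun j r x hx =>
    (smoothAltAt_of_mem_forms₂ (hV₀ _) _ (𝒳.cover.mapsTo₁ j r hx)).pullback (hf₁ j x)
  have sΘ : ∀ r, ∀ x ∈ 𝒳.cover.V₁ r, SmoothAltAt (IP.prod IG)
      (pullback₂ (IP.prod IG) IG Prod.snd (mc.Θ (𝒳.cover.π₁ r)).1) x := fun r x hx =>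
    (smoothAltAt_of_mem_forms₂ (hU₁ _) _ (𝒳.cover.mapsTo_π₁ r hx)).pullback (hs₁ x)
  obtain ⟨K, hK, hKeq⟩ := isSmoothnessAlt.exists_glue (I := IP.prod IG) 𝒳.cover.cover₁ (h := Kl)
    (fun r x hx => isSmoothnessAlt.add (isSmoothnessAlt.sub
      (smoothAltAt_extDeriv₁ (hV₁ r) (S.η r) hx) (isSmoothnessAlt.add (sΘ r x hx) (sB 1 r x hx)))
      (sB 0 r x hx)) (fun r s x hx => by
        have m₀ : ∀ j, ∀ y ∈ 𝒳.cover.V₁ r ∩ 𝒳.cover.V₁ s, 𝒳.toBundle.face₁ j y ∈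
            𝒳.cover.V₀ (𝒳.cover.d₁ j r) ∩ 𝒳.cover.V₀ (𝒳.cover.d₁ j s) := fun j y hy =>
          ⟨𝒳.cover.mapsTo₁ j r hy.1, 𝒳.cover.mapsTo₁ j s hy.2⟩
        have mΘ : ∀ y ∈ 𝒳.cover.V₁ r ∩ 𝒳.cover.V₁ s,
            y.2 ∈ 𝒢.cover.U₁ (𝒳.cover.π₁ r) ∩ 𝒢.cover.U₁ (𝒳.cover.π₁ s) := fun y hy =>
          ⟨𝒳.cover.mapsTo_π₁ r hy.1, 𝒳.cover.mapsTo_π₁ s hy.2⟩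
        have hσ : ∀ j, ∀ y ∈ 𝒳.cover.V₁ r ∩ 𝒳.cover.V₁ s, SmoothAt₁ IP
            (S.σ (𝒳.cover.d₁ j r) (𝒳.cover.d₁ j s)).1 (𝒳.toBundle.face₁ j y) := fun j y hy =>
          smoothAt_of_mem_forms₁ ((hV₀ _).inter (hV₀ _)) _ (m₀ j y hy)
        exact curvature_eq_of_connection ((hV₁ r).inter (hV₁ s)) (𝒳.smooth_ρ r s) (hf₁ 0) hs₁
          (hf₁ 1) (hσ 0)
          (fun y hy => smoothAt_of_mem_forms₁ ((hU₁ _).inter (hU₁ _)) _ (mΘ y hy)) (hσ 1)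
          (fun y hy => smoothAt_of_mem_forms₁ (hV₁ r) _ hy.1)
          (fun y hy => smoothAt_of_mem_forms₁ (hV₁ s) _ hy.2) (S.η_connection r s) hx
          (hB _ _ _ (m₀ 0 x hx)) (mc.Θ_curving _ _ _ (mΘ x hx)) (hB _ _ _ (m₀ 1 x hx)))
  have hWs : ∀ z, SmoothAltAt (IP.prod IG) W z := fun z =>
    ((smoothAt_of_mem_forms₁ isOpen_univ A.1 (mem_univ _)).pullback (hf₁ 1 z)).pairWedge
      ((smoothAt₁_thetaR _).pullback (hs₁ z))
  -- The failure `K + W` of the curvature equation is closed, by the flatness of `β`, the curvature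
  -- equation of the product `m`, and the cocycle condition for the pairings.
  obtain ⟨e, he, heK⟩ := 𝒳.toBundle.exists_primitive₂ (a := fun z => K z + W z)
    (fun z => isSmoothnessAlt.add (hK z) (hWs z)) (fun x => by
    obtain ⟨r, hr⟩ := 𝒳.cover.cover₂.covers x
    have m₂ := fun k => 𝒳.cover.mapsTo₂ k r hr
    have mM := 𝒳.cover.mapsTo_π₂ r hr
    set Z : Fin 3 → Fin 2 → EP × EG × EG →L[ℝ] EP × EG × EG →L[ℝ] ET := fun k j =>
      pullback₂ (IP.prod (IG.prod IG)) (IP.prod IG) (𝒳.toBundle.face₂ k)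
        (pullback₂ (IP.prod IG) IP (𝒳.toBundle.face₁ j)
          (B (𝒳.cover.d₁ j (𝒳.cover.d₂ k r))).1) x with hZ
    set R : Fin 3 → EP × EG × EG →L[ℝ] EP × EG × EG →L[ℝ] ET := fun k =>
      pullback₂ (IP.prod (IG.prod IG)) (IP.prod IG) (𝒳.toBundle.face₂ k)
        (pullback₂ (IP.prod IG) IG Prod.snd (mc.Θ (𝒳.cover.π₁ (𝒳.cover.d₂ k r))).1) x with hR
    have hface : ∀ k, pullback₂ (IP.prod (IG.prod IG)) (IP.prod IG) (𝒳.toBundle.face₂ k)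
          (fun z => K z + W z) x =
        pullback₂ (IP.prod (IG.prod IG)) (IP.prod IG) (𝒳.toBundle.face₂ k)
          (extDeriv₁ (IP.prod IG) (S.η (𝒳.cover.d₂ k r)).1) x - (R k + Z k 1) + Z k 0 +
        pullback₂ (IP.prod (IG.prod IG)) (IP.prod IG) (𝒳.toBundle.face₂ k) W x := fun k => by
      rw [pullback₂, hKeq _ _ (m₂ k)]
      exact ContinuousLinearMap.ext fun u => ContinuousLinearMap.ext fun v => rfl
    have hZeq : ∀ j k : Fin 2, j ≤ k → Z k.succ j = Z j.castSucc k := fun j k hjk => by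
      rw [hZ]
      simp only
      rw [pullback₂_comm_sq (hf₂ _) (hf₁ _) (hf₂ _) (hf₁ _) (𝒳.toBundle.face₁_face₂ hjk),
        𝒳.cover.d₁_d₂ j k hjk]
    have hReq : ∀ k, R k = pullback₂ (IP.prod (IG.prod IG)) (IG.prod IG) Prod.snd
        (pullback₂ (IG.prod IG) IG (nerveFace₂ k)
          (mc.Θ (𝒢.cover.d₂ k (𝒳.cover.π₂ r))).1) x := fun k => by
      rw [hR]
      simp only
      rw [pullback₂_comm_sq (hf₂ k) hs₁ hs₂ (hn₂ k) (𝒳.toBundle.snd_face₂ k), 𝒳.cover.π_d₂]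
    have hmc : pullback₂ (IP.prod (IG.prod IG)) (IG.prod IG) Prod.snd
        (extDeriv₁ (IG.prod IG) (D.M (𝒳.cover.π₂ r)).1) x - (R 2 + R 0) + R 1 =
        -pullback₂ (IP.prod (IG.prod IG)) (IG.prod IG) Prod.snd
          (pairWedge mc.pairing (pullback₁ (IG.prod IG) IG Prod.fst (thetaL IG))
            (pullback₁ (IG.prod IG) IG Prod.snd (thetaR IG))) x := by
      rw [hReq, hReq, hReq]
      exact ContinuousLinearMap.ext fun u => ContinuousLinearMap.ext fun v =>
        DFunLike.congr_fun (DFunLike.congr_fun (mc.curvature _ _ mM) _) _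
    have hflat := extDeriv₁_flat (𝒳.cover.cover₂.isOpen r) (𝒳.smooth_β r) hs₂ (hf₂ 1) (hf₂ 0)
      (hf₂ 2) (fun y hy => smoothAt_of_mem_forms₁ (hU₂ _) _ (𝒳.cover.mapsTo_π₂ r hy))
      (fun y hy => smoothAt_of_mem_forms₁ (hV₁ _) _ (𝒳.cover.mapsTo₂ 1 r hy))
      (fun y hy => smoothAt_of_mem_forms₁ (hV₁ _) _ (𝒳.cover.mapsTo₂ 0 r hy))
      (fun y hy => smoothAt_of_mem_forms₁ (hV₁ _) _ (𝒳.cover.mapsTo₂ 2 r hy)) (S.β_flat r) x hr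
    have hcoc := pairWedge_connection_cocycle mc.adInvariant A x
    have z00 : Z 1 0 = Z 0 0 := hZeq 0 0 le_rfl
    have z01 : Z 2 0 = Z 0 1 := hZeq 0 1 (by decide)
    have z11 : Z 2 1 = Z 1 1 := hZeq 1 1 le_rfl
    rw [hface, hface, hface, z00, z01, z11]
    rw [← hW] at hcoc
    linear_combination (norm := module) hflat - hmc + hcoc)
  choose B' hB' using fun r => exists_mem_forms₂ (hV₀ r) (a := fun x => (B r).1 x - e x)
    fun x hx => isSmoothnessAlt.sub (smoothAltAt_of_mem_forms₂ (hV₀ r) _ hx) (he x)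
  refine ⟨⟨A, B', fun r s x hx => ?_, fun r x hx => ?_⟩, rfl⟩
  · rw [hB' r x hx.1, hB' s x hx.2, ← hB r s x hx]
    abel
  · have hp : ∀ j, pullback₂ (IP.prod IG) IP (𝒳.toBundle.face₁ j) (B' (𝒳.cover.d₁ j r)).1 x =
        pullback₂ (IP.prod IG) IP (𝒳.toBundle.face₁ j) (B (𝒳.cover.d₁ j r)).1 x -
        pullback₂ (IP.prod IG) IP (𝒳.toBundle.face₁ j) e x := fun j => by
      rw [pullback₂, hB' _ _ (𝒳.cover.mapsTo₁ j r hx)]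
      exact ContinuousLinearMap.ext fun u => ContinuousLinearMap.ext fun v => rfl
    have h := heK x
    rw [hKeq r x hx] at h
    simp only [hKl] at h
    change extDeriv₁ (IP.prod IG) (S.η r).1 x -
        (pullback₂ (IP.prod IG) IP (𝒳.toBundle.face₁ 1) (B' (𝒳.cover.d₁ 1 r)).1 x +
          pullback₂ (IP.prod IG) IG Prod.snd (mc.Θ (𝒳.cover.π₁ r)).1 x) +
        pullback₂ (IP.prod IG) IP (𝒳.toBundle.face₁ 0) (B' (𝒳.cover.d₁ 0 r)).1 x = -W x
    rw [hp, hp]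
    linear_combination (norm := module) -h

theorem pullback₂_of_eq_add {f : P × G → P} {B B' b : P → EP →L[ℝ] EP →L[ℝ] ET} {x : P × G}
    (h : B (f x) = B' (f x) + b (f x)) :
    pullback₂ (IP.prod IG) IP f B x =
      pullback₂ (IP.prod IG) IP f B' x + pullback₂ (IP.prod IG) IP f b x := by
  rw [pullback₂, h]
  rfl

theorem pullback₂_of_eq_sub {f : P × G → P} {B B' b : P → EP →L[ℝ] EP →L[ℝ] ET} {x : P × G}
    (h : B (f x) = B' (f x) - b (f x)) :
    pullback₂ (IP.prod IG) IP f B x =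
      pullback₂ (IP.prod IG) IP f B' x - pullback₂ (IP.prod IG) IP f b x := by
  rw [pullback₂, h]
  rfl

namespace TwoConnection

theorem ext_on {c c' : TwoConnection S mc} (hA : c.A = c'.A)
    (hB : ∀ r, ∀ x ∈ 𝒳.cover.V₀ r, (c.B r).1 x = (c'.B r).1 x) : c = c' := by
  refine TwoConnection.ext hA (funext fun r => Subtype.ext (funext fun x => ?_))
  by_cases hx : x ∈ 𝒳.cover.V₀ r
  · exact hB r x hx
  · rw [(c.B r).2.1.2 x hx, (c'.B r).2.1.2 x hx]

/-- A global `2`-form `b` on `P` translates connections over `A` to connections over `A'` if its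
failure to be basic is the difference of the two curvatures prescribed for `ρ`. -/
theorem exists_translate (c : TwoConnection S mc) (A' : 𝒳.toBundle.Connection)
    {b : P → EP →L[ℝ] EP →L[ℝ] ET} (hb : ∀ p, SmoothAltAt IP b p)
    (h : ∀ z, pullback₂ (IP.prod IG) IP 𝒳.toBundle.act b z -
        pullback₂ (IP.prod IG) IP Prod.fst b z =
      pairWedge mc.pairing (pullback₁ (IP.prod IG) IP Prod.fst c.A.1.1)
          (pullback₁ (IP.prod IG) IG Prod.snd (thetaR IG)) z -
        pairWedge mc.pairing (pullback₁ (IP.prod IG) IP Prod.fst A'.1.1)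
          (pullback₁ (IP.prod IG) IG Prod.snd (thetaR IG)) z) :
    ∃ c' : TwoConnection S mc, c'.A = A' ∧
      ∀ r, ∀ x ∈ 𝒳.cover.V₀ r, (c'.B r).1 x = (c.B r).1 x + b x := by
  have hV₀ := 𝒳.cover.cover₀.isOpen
  choose B' hB' using fun r => exists_mem_forms₂ (hV₀ r) (a := fun x => (c.B r).1 x + b x)
    fun x hx => isSmoothnessAlt.add (smoothAltAt_of_mem_forms₂ (hV₀ r) _ hx) (hb x)
  refine ⟨⟨A', B', fun r s x hx => ?_, fun r x hx => ?_⟩, rfl, hB'⟩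
  · rw [hB' r x hx.1, hB' s x hx.2, ← c.curving r s x hx]
    abel
  · have h₁ : pullback₂ (IP.prod IG) IP Prod.fst (B' (𝒳.cover.d₁ 1 r)).1 x =
        pullback₂ (IP.prod IG) IP Prod.fst (c.B (𝒳.cover.d₁ 1 r)).1 x +
        pullback₂ (IP.prod IG) IP Prod.fst b x :=
      pullback₂_of_eq_add (hB' _ _ (𝒳.cover.mapsTo₁ 1 r hx))
    have h₀ : pullback₂ (IP.prod IG) IP 𝒳.toBundle.act (B' (𝒳.cover.d₁ 0 r)).1 x =
        pullback₂ (IP.prod IG) IP 𝒳.toBundle.act (c.B (𝒳.cover.d₁ 0 r)).1 x +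
        pullback₂ (IP.prod IG) IP 𝒳.toBundle.act b x :=
      pullback₂_of_eq_add (hB' _ _ (𝒳.cover.mapsTo₁ 0 r hx))
    rw [h₁, h₀]
    linear_combination (norm := module) c.curvature r x hx + h x

/-- Two connections differ by a global `2`-form on `P`, whose failure to be basic is the difference
of the two curvatures prescribed for `ρ`. -/
theorem exists_difference (c c' : TwoConnection S mc) :
    ∃ b : P → EP →L[ℝ] EP →L[ℝ] ET, (∀ p, SmoothAltAt IP b p) ∧
      (∀ z, pullback₂ (IP.prod IG) IP 𝒳.toBundle.act b z -
          pullback₂ (IP.prod IG) IP Prod.fst b z =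
        pairWedge mc.pairing (pullback₁ (IP.prod IG) IP Prod.fst c.A.1.1)
            (pullback₁ (IP.prod IG) IG Prod.snd (thetaR IG)) z -
          pairWedge mc.pairing (pullback₁ (IP.prod IG) IP Prod.fst c'.A.1.1)
            (pullback₁ (IP.prod IG) IG Prod.snd (thetaR IG)) z) ∧
      ∀ r, ∀ x ∈ 𝒳.cover.V₀ r, (c'.B r).1 x = (c.B r).1 x + b x := by
  have hV₀ := 𝒳.cover.cover₀.isOpen
  obtain ⟨b, hb, hbeq⟩ := isSmoothnessAlt.exists_glue (I := IP) 𝒳.cover.cover₀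
    (h := fun r x => (c'.B r).1 x - (c.B r).1 x)
    (fun r x hx => isSmoothnessAlt.sub (smoothAltAt_of_mem_forms₂ (hV₀ r) _ hx)
      (smoothAltAt_of_mem_forms₂ (hV₀ r) _ hx)) (fun r s x hx => by
        linear_combination (norm := module) c'.curving r s x hx - c.curving r s x hx)
  refine ⟨b, hb, fun z => ?_, fun r x hx => by rw [hbeq r x hx]; abel⟩
  obtain ⟨r, hr⟩ := 𝒳.cover.cover₁.covers z
  have h₁ : pullback₂ (IP.prod IG) IP Prod.fst b z =
      pullback₂ (IP.prod IG) IP Prod.fst (c'.B (𝒳.cover.d₁ 1 r)).1 z -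
      pullback₂ (IP.prod IG) IP Prod.fst (c.B (𝒳.cover.d₁ 1 r)).1 z :=
    pullback₂_of_eq_sub (hbeq _ _ (𝒳.cover.mapsTo₁ 1 r hr))
  have h₀ : pullback₂ (IP.prod IG) IP 𝒳.toBundle.act b z =
      pullback₂ (IP.prod IG) IP 𝒳.toBundle.act (c'.B (𝒳.cover.d₁ 0 r)).1 z -
      pullback₂ (IP.prod IG) IP 𝒳.toBundle.act (c.B (𝒳.cover.d₁ 0 r)).1 z :=
    pullback₂_of_eq_sub (hbeq _ _ (𝒳.cover.mapsTo₁ 0 r hr))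
  rw [h₁, h₀]
  linear_combination (norm := module) c'.curvature r z hr - c.curvature r z hr

end TwoConnection

namespace EnhancedConnection

theorem ext_on {c c' : EnhancedConnection S mc} (hA : c.A = c'.A)
    (hB : ∀ r, ∀ x ∈ 𝒳.cover.V₀ r, (c.B r).1 x = (c'.B r).1 x) : c = c' := by
  refine EnhancedConnection.ext hA (funext fun r => Subtype.ext (funext fun x => ?_))
  by_cases hx : x ∈ 𝒳.cover.V₀ r
  · exact hB r x hx
  · rw [(c.B r).2.2 x hx, (c'.B r).2.2 x hx]

/-- The analogue of `TwoConnection.exists_translate`, with `2`-tensors in place of `2`-forms. -/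
theorem exists_translate (c : EnhancedConnection S mc) (A' : 𝒳.toBundle.Connection)
    {b : P → EP →L[ℝ] EP →L[ℝ] ET} (hb : ∀ p, SmoothAt₂ IP b p)
    (h : ∀ z, pullback₂ (IP.prod IG) IP 𝒳.toBundle.act b z -
        pullback₂ (IP.prod IG) IP Prod.fst b z =
      (2 : ℝ) • pairTensor mc.pairing (pullback₁ (IP.prod IG) IP Prod.fst c.A.1.1)
          (pullback₁ (IP.prod IG) IG Prod.snd (thetaR IG)) z -
        (2 : ℝ) • pairTensor mc.pairing (pullback₁ (IP.prod IG) IP Prod.fst A'.1.1)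
          (pullback₁ (IP.prod IG) IG Prod.snd (thetaR IG)) z) :
    ∃ c' : EnhancedConnection S mc, c'.A = A' ∧
      ∀ r, ∀ x ∈ 𝒳.cover.V₀ r, (c'.B r).1 x = (c.B r).1 x + b x := by
  have hV₀ := 𝒳.cover.cover₀.isOpen
  choose B' hB' using fun r => exists_mem_tensors₂ (hV₀ r) (a := fun x => (c.B r).1 x + b x)
    fun x hx => isSmoothness₂.add (smoothAt_of_mem_tensors₂ (hV₀ r) _ hx) (hb x)
  refine ⟨⟨A', B', fun r s x hx => ?_, fun r x hx => ?_⟩, rfl, hB'⟩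
  · rw [hB' r x hx.1, hB' s x hx.2, ← c.curving r s x hx]
    abel
  · have h₁ : pullback₂ (IP.prod IG) IP Prod.fst (B' (𝒳.cover.d₁ 1 r)).1 x =
        pullback₂ (IP.prod IG) IP Prod.fst (c.B (𝒳.cover.d₁ 1 r)).1 x +
        pullback₂ (IP.prod IG) IP Prod.fst b x :=
      pullback₂_of_eq_add (hB' _ _ (𝒳.cover.mapsTo₁ 1 r hx))
    have h₀ : pullback₂ (IP.prod IG) IP 𝒳.toBundle.act (B' (𝒳.cover.d₁ 0 r)).1 x =
        pullback₂ (IP.prod IG) IP 𝒳.toBundle.act (c.B (𝒳.cover.d₁ 0 r)).1 x +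
        pullback₂ (IP.prod IG) IP 𝒳.toBundle.act b x :=
      pullback₂_of_eq_add (hB' _ _ (𝒳.cover.mapsTo₁ 0 r hx))
    rw [h₁, h₀]
    linear_combination (norm := module) c.curvature r x hx + h x

/-- The analogue of `TwoConnection.exists_difference`, with `2`-tensors in place of `2`-forms. -/
theorem exists_difference (c c' : EnhancedConnection S mc) :
    ∃ b : P → EP →L[ℝ] EP →L[ℝ] ET, (∀ p, SmoothAt₂ IP b p) ∧
      (∀ z, pullback₂ (IP.prod IG) IP 𝒳.toBundle.act b z -
          pullback₂ (IP.prod IG) IP Prod.fst b z =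
        (2 : ℝ) • pairTensor mc.pairing (pullback₁ (IP.prod IG) IP Prod.fst c.A.1.1)
            (pullback₁ (IP.prod IG) IG Prod.snd (thetaR IG)) z -
          (2 : ℝ) • pairTensor mc.pairing (pullback₁ (IP.prod IG) IP Prod.fst c'.A.1.1)
            (pullback₁ (IP.prod IG) IG Prod.snd (thetaR IG)) z) ∧
      ∀ r, ∀ x ∈ 𝒳.cover.V₀ r, (c'.B r).1 x = (c.B r).1 x + b x := by
  have hV₀ := 𝒳.cover.cover₀.isOpen
  obtain ⟨b, hb, hbeq⟩ := isSmoothness₂.exists_glue (I := IP) 𝒳.cover.cover₀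
    (h := fun r x => (c'.B r).1 x - (c.B r).1 x)
    (fun r x hx => isSmoothness₂.sub (smoothAt_of_mem_tensors₂ (hV₀ r) _ hx)
      (smoothAt_of_mem_tensors₂ (hV₀ r) _ hx)) (fun r s x hx => by
        linear_combination (norm := module) c'.curving r s x hx - c.curving r s x hx)
  refine ⟨b, hb, fun z => ?_, fun r x hx => by rw [hbeq r x hx]; abel⟩
  obtain ⟨r, hr⟩ := 𝒳.cover.cover₁.covers z
  have h₁ : pullback₂ (IP.prod IG) IP Prod.fst b z =
      pullback₂ (IP.prod IG) IP Prod.fst (c'.B (𝒳.cover.d₁ 1 r)).1 z -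
      pullback₂ (IP.prod IG) IP Prod.fst (c.B (𝒳.cover.d₁ 1 r)).1 z :=
    pullback₂_of_eq_sub (hbeq _ _ (𝒳.cover.mapsTo₁ 1 r hr))
  have h₀ : pullback₂ (IP.prod IG) IP 𝒳.toBundle.act b z =
      pullback₂ (IP.prod IG) IP 𝒳.toBundle.act (c'.B (𝒳.cover.d₁ 0 r)).1 z -
      pullback₂ (IP.prod IG) IP 𝒳.toBundle.act (c.B (𝒳.cover.d₁ 0 r)).1 z :=
    pullback₂_of_eq_sub (hbeq _ _ (𝒳.cover.mapsTo₁ 0 r hr))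
  rw [h₁, h₀]
  linear_combination (norm := module) c'.curvature r z hr - c.curvature r z hr

/-- The enhanced connection `(A, B - ⟨A ⊗ A⟩)` associated with a connection `(A, B)`. -/
theorem exists_of_twoConnection (c : TwoConnection S mc) :
    ∃ c' : EnhancedConnection S mc, c'.A = c.A := by
  have hV₀ := 𝒳.cover.cover₀.isOpen
  have hA : ∀ p, SmoothAt₁ IP c.A.1.1 p := fun p =>
    smoothAt_of_mem_forms₁ isOpen_univ c.A.1 (mem_univ p)
  choose B' hB' using fun r => exists_mem_tensors₂ (hV₀ r)
    (a := fun x => (c.B r).1 x - pairTensor mc.pairing c.A.1.1 c.A.1.1 x)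
    fun x hx => isSmoothness₂.sub (smoothAltAt_of_mem_forms₂ (hV₀ r) _ hx).1
      ((hA x).pairTensor (hA x))
  refine ⟨⟨c.A, B', fun r s x hx => ?_, fun r x hx => ?_⟩, rfl⟩
  · rw [hB' r x hx.1, hB' s x hx.2, ← c.curving r s x hx]
    abel
  · have h₁ : pullback₂ (IP.prod IG) IP Prod.fst (B' (𝒳.cover.d₁ 1 r)).1 x =
        pullback₂ (IP.prod IG) IP Prod.fst (c.B (𝒳.cover.d₁ 1 r)).1 x -
        pullback₂ (IP.prod IG) IP Prod.fst (pairTensor mc.pairing c.A.1.1 c.A.1.1) x :=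
      pullback₂_of_eq_sub (hB' _ _ (𝒳.cover.mapsTo₁ 1 r hx))
    have h₀ : pullback₂ (IP.prod IG) IP 𝒳.toBundle.act (B' (𝒳.cover.d₁ 0 r)).1 x =
        pullback₂ (IP.prod IG) IP 𝒳.toBundle.act (c.B (𝒳.cover.d₁ 0 r)).1 x -
        pullback₂ (IP.prod IG) IP 𝒳.toBundle.act (pairTensor mc.pairing c.A.1.1 c.A.1.1) x :=
      pullback₂_of_eq_sub (hB' _ _ (𝒳.cover.mapsTo₁ 0 r hx))
    have h₂ : pullback₂ (IP.prod IG) IG Prod.snd (mc.enhanced (𝒳.cover.π₁ r)) x =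
        pullback₂ (IP.prod IG) IG Prod.snd (mc.Θ (𝒳.cover.π₁ r)).1 x -
        pullback₂ (IP.prod IG) IG Prod.snd (pairTensor mc.pairing (thetaL IG) (thetaL IG)) x := rfl
    -- by invariance the pairing does not distinguish `θᴸ` from `θᴿ`
    have h₃ : ∀ u v, pullback₂ (IP.prod IG) IG Prod.snd
        (pairTensor mc.pairing (thetaL IG) (thetaL IG)) x u v =
        mc.pairing (pullback₁ (IP.prod IG) IG Prod.snd (thetaR IG) x u)
          (pullback₁ (IP.prod IG) IG Prod.snd (thetaR IG) x v) := fun u v => by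
      rw [pullback₂_apply, pairTensor_apply, pullback₁_apply, pullback₁_apply, thetaR_eq]
      exact (mc.adInvariant _ _ _).symm
    have h₄ : pullback₂ (IP.prod IG) IP 𝒳.toBundle.act
        (pairTensor mc.pairing c.A.1.1 c.A.1.1) x -
        pullback₂ (IP.prod IG) IP Prod.fst (pairTensor mc.pairing c.A.1.1 c.A.1.1) x -
        pullback₂ (IP.prod IG) IG Prod.snd (pairTensor mc.pairing (thetaL IG) (thetaL IG)) x =
        (2 : ℝ) • pairTensor mc.pairing (pullback₁ (IP.prod IG) IP Prod.fst c.A.1.1)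
          (pullback₁ (IP.prod IG) IG Prod.snd (thetaR IG)) x -
        pairWedge mc.pairing (pullback₁ (IP.prod IG) IP Prod.fst c.A.1.1)
          (pullback₁ (IP.prod IG) IG Prod.snd (thetaR IG)) x := by
      refine ContinuousLinearMap.ext fun u => ContinuousLinearMap.ext fun v => ?_
      simp only [sub_apply, smul_apply]
      rw [PrincipalBundle.pairTensor_connection_act mc.adInvariant, h₃, pairWedge_apply,
        pairTensor_apply, mc.symm (pullback₁ (IP.prod IG) IG Prod.snd (thetaR IG) x u)
          (pullback₁ (IP.prod IG) IP Prod.fst c.A.1.1 x v)]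
      module
    rw [h₁, h₀, h₂]
    linear_combination (norm := module) c.curvature r x hx - h₄

end EnhancedConnection

end TwoConnections

/-! ### Torsors of connections -/

section Torsors

variable {EM HM EP HP EG HG ET HT : Type*}
  [NormedAddCommGroup EM] [NormedSpace ℝ EM] [TopologicalSpace HM]
  [NormedAddCommGroup EP] [NormedSpace ℝ EP] [TopologicalSpace HP]
  [NormedAddCommGroup EG] [NormedSpace ℝ EG] [TopologicalSpace HG]
  [NormedAddCommGroup ET] [NormedSpace ℝ ET] [TopologicalSpace HT]
  {IM : ModelWithCorners ℝ EM HM} {IP : ModelWithCorners ℝ EP HP}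
  {IG : ModelWithCorners ℝ EG HG} {IT : ModelWithCorners ℝ ET HT}
  {M P G T : Type*}
  [TopologicalSpace M] [ChartedSpace HM M] [IsManifold IM ∞ M]
  [TopologicalSpace P] [ChartedSpace HP P] [IsManifold IP ∞ P]
  [TopologicalSpace G] [ChartedSpace HG G] [Group G] [LieGroup IG ∞ G]
  [TopologicalSpace T] [ChartedSpace HT T] [CommGroup T] [LieGroup IT ∞ T]
  [IM.Boundaryless] [IP.Boundaryless] [IG.Boundaryless] [IT.Boundaryless]
  {𝒢 : MultiplicativeGerbe IG IT G T} {D : MultConnectiveStructure 𝒢}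
  {𝒳 : PrincipalTwoBundle IM IP M P 𝒢}

section Abstract

variable {X Γ : Type*} {R : X → Γ → X → Prop}

/-- A right torsor may be given by the relation `x · g = y`. -/
theorem IsRightTorsor.of_relation [Group Γ] (hX : Nonempty X) (ex : ∀ x g, ∃ y, R x g y)
    (unique : ∀ {x g y y'}, R x g y → R x g y' → y = y') (one : ∀ x, R x 1 x)
    (mul : ∀ {x g y h z}, R x g y → R y h z → R x (g * h) z)
    (transitive : ∀ x y, ∃ g, R x g y) (free : ∀ {x g g' y}, R x g y → R x g' y → g = g') :
    ∃ act : X → Γ → X, IsRightTorsor act ∧ ∀ x g, R x g (act x g) := by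
  choose act h using ex
  refine ⟨act, ⟨hX, fun x => unique (h x 1) (one x), fun x g g' =>
    unique (mul (h x g) (h _ g')) (h x _), fun x y => ?_⟩, h⟩
  obtain ⟨g, hg⟩ := transitive x y
  exact ⟨g, unique (h x g) hg, fun g' hg' => free (hg' ▸ h x g') hg⟩

/-- A torsor for an additive group may be given by the relation `x + g = y`. -/
theorem IsAdditiveTorsor.of_relation [AddCommGroup Γ] (hX : Nonempty X)
    (ex : ∀ x g, ∃ y, R x g y) (unique : ∀ {x g y y'}, R x g y → R x g y' → y = y')
    (zero : ∀ x, R x 0 x) (add : ∀ {x g y h z}, R x g y → R y h z → R x (g + h) z)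
    (transitive : ∀ x y, ∃ g, R x g y) (free : ∀ {x g g' y}, R x g y → R x g' y → g = g') :
    ∃ act : X → Γ → X, IsAdditiveTorsor act ∧ ∀ x g, R x g (act x g) := by
  choose act h using ex
  refine ⟨act, ⟨hX, fun x => unique (h x 0) (zero x), fun x g g' =>
    unique (add (h x g) (h _ g')) (h x _), fun x y => ?_⟩, h⟩
  obtain ⟨g, hg⟩ := transitive x y
  exact ⟨g, unique (h x g) hg, fun g' hg' => free (hg' ▸ h x g') hg⟩

end Abstract

variable {S : ConnectiveStructure 𝒳 D} {mc : MaurerCartanData D}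

/-- The `2`-form `⟨A ∧ a⟩ + π*b` by which `(a, b)` translates the curving of `(A, B)`. -/
def adShift (κ : EG →L[ℝ] EG →L[ℝ] ET) {Q : PrincipalBundle IM IP IG M P G} (A : Q.Connection)
    (γ : AdExtension ET Q) : P → EP →L[ℝ] EP →L[ℝ] ET := fun x =>
  pairWedge κ A.1.1 γ.a.1.1 x + pullback₂ IP IM Q.proj γ.b.1 x

/-- The symmetric part `⟨A ⊗ A⟩ - ⟨(A + a) ⊗ (A + a)⟩ + π*k` of the translation of an enhanced
curving. -/
def symShift (κ : EG →L[ℝ] EG →L[ℝ] ET) {Q : PrincipalBundle IM IP IG M P G} (A : Q.Connection)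
    (a : Q.adForms) (k : symTensors₂ IM ET (univ : Set M)) : P → EP →L[ℝ] EP →L[ℝ] ET := fun x =>
  pairTensor κ A.1.1 A.1.1 x - pairTensor κ (A.1 + a.1).1 (A.1 + a.1).1 x +
    pullback₂ IP IM Q.proj k.1 x

section Shift

variable {κ : EG →L[ℝ] EG →L[ℝ] ET} {Q : PrincipalBundle IM IP IG M P G}

theorem smoothAltAt_adShift (A : Q.Connection) (γ : AdExtension ET Q) (x : P) :
    SmoothAltAt IP (adShift κ A γ) x :=
  isSmoothnessAlt.add
    ((smoothAt_of_mem_forms₁ isOpen_univ A.1 (mem_univ x)).pairWedge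
      (smoothAt_of_mem_forms₁ isOpen_univ γ.a.1 (mem_univ x)))
    ((smoothAltAt_of_mem_forms₂ isOpen_univ γ.b (mem_univ _)).pullback (Q.smooth_proj x))

theorem smoothAt₂_symShift (A : Q.Connection) (a : Q.adForms)
    (k : symTensors₂ IM ET (univ : Set M)) (x : P) : SmoothAt₂ IP (symShift κ A a k) x := by
  have hA : ∀ A : forms₁ IP EG (univ : Set P), SmoothAt₁ IP A.1 x := fun A =>
    smoothAt_of_mem_forms₁ isOpen_univ A (mem_univ x)
  exact isSmoothness₂.add (isSmoothness₂.sub ((hA _).pairTensor (hA _)) ((hA _).pairTensor (hA _)))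
    ((smoothAt_of_mem_tensors₂ isOpen_univ ⟨k.1, k.2.1⟩ (mem_univ _)).pullback (Q.smooth_proj x))

/-- The failure of `⟨A ∧ a⟩ + π*b` to be basic is exactly the change of the curvature
`-⟨p*A ∧ g*θᴿ⟩` prescribed for `ρ`, when `A` is replaced by `A + a`. -/
theorem adShift_act (hs : ∀ X Y, κ X Y = κ Y X)
    (hκ : ∀ (g : G) X Y, κ (adRep IG g X) (adRep IG g Y) = κ X Y) (A : Q.Connection)
    (γ : AdExtension ET Q) (z : P × G) :
    pullback₂ (IP.prod IG) IP Q.act (adShift κ A γ) z -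
        pullback₂ (IP.prod IG) IP Prod.fst (adShift κ A γ) z =
      pairWedge κ (pullback₁ (IP.prod IG) IP Prod.fst A.1.1)
          (pullback₁ (IP.prod IG) IG Prod.snd (thetaR IG)) z -
        pairWedge κ (pullback₁ (IP.prod IG) IP Prod.fst (A.add γ.a).1.1)
          (pullback₁ (IP.prod IG) IG Prod.snd (thetaR IG)) z := by
  have h₁ : ∀ f : P × G → P, pullback₂ (IP.prod IG) IP f (adShift κ A γ) z =
      pullback₂ (IP.prod IG) IP f (pairWedge κ A.1.1 γ.a.1.1) z +
      pullback₂ (IP.prod IG) IP f (pullback₂ IP IM Q.proj γ.b.1) z := fun f => rfl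
  have h₂ : ∀ u, pullback₁ (IP.prod IG) IP Prod.fst (A.add γ.a).1.1 z u =
      pullback₁ (IP.prod IG) IP Prod.fst A.1.1 z u +
      pullback₁ (IP.prod IG) IP Prod.fst γ.a.1.1 z u := fun u => rfl
  rw [h₁, h₁, Q.pullback₂_act_proj]
  refine ContinuousLinearMap.ext fun u => ContinuousLinearMap.ext fun v => ?_
  simp only [sub_apply, add_apply]
  rw [PrincipalBundle.pairWedge_connection_act hκ, pairWedge_apply, pairWedge_apply, h₂, h₂,
    map_add, map_add, add_apply, add_apply,
    hs (pullback₁ (IP.prod IG) IG Prod.snd (thetaR IG) z u),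
    hs (pullback₁ (IP.prod IG) IG Prod.snd (thetaR IG) z v)]
  abel

/-- The failure to be basic of the translation of an enhanced curving is exactly the change of the
curvature `-2⟨p*A ⊗ g*θᴿ⟩` prescribed for `ρ`: the squares `⟨A ⊗ A⟩` and `⟨(A + a) ⊗ (A + a)⟩`
supply the symmetric part. -/
theorem symShift_act (hs : ∀ X Y, κ X Y = κ Y X)
    (hκ : ∀ (g : G) X Y, κ (adRep IG g X) (adRep IG g Y) = κ X Y) (A : Q.Connection)
    (γ : AdExtension ET Q) (k : symTensors₂ IM ET (univ : Set M)) (z : P × G) :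
    pullback₂ (IP.prod IG) IP Q.act (fun x => adShift κ A γ x + symShift κ A γ.a k x) z -
        pullback₂ (IP.prod IG) IP Prod.fst (fun x => adShift κ A γ x + symShift κ A γ.a k x) z =
      (2 : ℝ) • pairTensor κ (pullback₁ (IP.prod IG) IP Prod.fst A.1.1)
          (pullback₁ (IP.prod IG) IG Prod.snd (thetaR IG)) z -
        (2 : ℝ) • pairTensor κ (pullback₁ (IP.prod IG) IP Prod.fst (A.add γ.a).1.1)
          (pullback₁ (IP.prod IG) IG Prod.snd (thetaR IG)) z := by
  have h₁ : ∀ f : P × G → P, pullback₂ (IP.prod IG) IP f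
        (fun x => adShift κ A γ x + symShift κ A γ.a k x) z =
      pullback₂ (IP.prod IG) IP f (adShift κ A γ) z +
        (pullback₂ (IP.prod IG) IP f (pairTensor κ A.1.1 A.1.1) z -
          pullback₂ (IP.prod IG) IP f (pairTensor κ (A.add γ.a).1.1 (A.add γ.a).1.1) z +
          pullback₂ (IP.prod IG) IP f (pullback₂ IP IM Q.proj k.1) z) := fun f => rfl
  have h := adShift_act hs hκ A γ z
  rw [h₁, h₁, Q.pullback₂_act_proj]
  refine ContinuousLinearMap.ext fun u => ContinuousLinearMap.ext fun v => ?_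
  have h' := DFunLike.congr_fun (DFunLike.congr_fun h u) v
  simp only [sub_apply, add_apply, smul_apply] at h' ⊢
  rw [pairWedge_apply, pairWedge_apply] at h'
  rw [PrincipalBundle.pairTensor_connection_act hκ, PrincipalBundle.pairTensor_connection_act hκ,
    pairTensor_apply κ (pullback₁ (IP.prod IG) IP Prod.fst A.1.1),
    pairTensor_apply κ (pullback₁ (IP.prod IG) IP Prod.fst (A.add γ.a).1.1),
    hs (pullback₁ (IP.prod IG) IG Prod.snd (thetaR IG) z u)
      (pullback₁ (IP.prod IG) IP Prod.fst A.1.1 z v),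
    hs (pullback₁ (IP.prod IG) IG Prod.snd (thetaR IG) z u)
      (pullback₁ (IP.prod IG) IP Prod.fst (A.add γ.a).1.1 z v)]
  linear_combination (norm := module) h'

theorem adShift_mk (A : Q.Connection) (a : Q.adForms) (b : forms₂ IM ET (univ : Set M)) (x : P) :
    adShift κ A ⟨a, b⟩ x = adShift κ A ⟨a, 0⟩ x + pullback₂ IP IM Q.proj b.1 x := by
  have h : pullback₂ IP IM Q.proj (0 : forms₂ IM ET (univ : Set M)).1 x = 0 := rfl
  simp only [adShift]
  rw [h, add_zero]

theorem symShift_eq (A : Q.Connection) (a : Q.adForms) (k : symTensors₂ IM ET (univ : Set M))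
    (x : P) : symShift κ A a k x = symShift κ A a 0 x + pullback₂ IP IM Q.proj k.1 x := by
  have h : pullback₂ IP IM Q.proj (0 : symTensors₂ IM ET (univ : Set M)).1 x = 0 := rfl
  simp only [symShift]
  rw [h, add_zero]

variable [Group (AdExtension ET Q)]

theorem adShift_one (hone : (1 : AdExtension ET Q) = ⟨0, 0⟩) (A : Q.Connection) (x : P) :
    adShift κ A 1 x = 0 := by
  refine ContinuousLinearMap.ext fun u => ContinuousLinearMap.ext fun v => ?_
  rw [hone]
  change pairWedge κ A.1.1 (0 : P → EP →L[ℝ] EG) x u v + (0 : ET) = 0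
  rw [pairWedge_apply]
  simp

/-- Translating by `γ` and then by `γ'` amounts to translating by `γ * γ'`: the term `⟨a ∧ a'⟩` of
the group law accounts for the change of `A` after the first translation. -/
theorem adShift_mul (hmul : IsAdExtensionProduct κ (fun x y : AdExtension ET Q => x * y))
    (A A' : Q.Connection) (γ γ' : AdExtension ET Q) (hA : A'.1 = A.1 + γ.a.1) (x : P) :
    adShift κ A (γ * γ') x = adShift κ A γ x + adShift κ A' γ' x := by
  obtain ⟨ha, hb⟩ := hmul γ γ'
  have hb' := congrFun hb x
  simp only [Pi.add_apply] at hb'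
  simp only [adShift]
  rw [hb', ha, hA]
  refine ContinuousLinearMap.ext fun u => ContinuousLinearMap.ext fun v => ?_
  simp only [add_apply, pairWedge_apply, Submodule.coe_add, Pi.add_apply, map_add]
  abel

theorem symShift_zero (A : Q.Connection) (a : Q.adForms) (ha : a = 0) (x : P) :
    symShift κ A a 0 x = 0 := by
  subst ha
  have hA : A.1 + (0 : Q.adForms).1 = A.1 := add_zero _
  simp only [symShift]
  rw [hA, sub_self, zero_add]
  rfl

/-- The squares telescope, so that the symmetric parts add up without a correction. -/
theorem symShift_add (A A' : Q.Connection) (a a' : Q.adForms) (hA : A'.1 = A.1 + a.1)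
    (k k' : symTensors₂ IM ET (univ : Set M)) (x : P) :
    symShift κ A (a + a') (k + k') x = symShift κ A a k x + symShift κ A' a' k' x := by
  have h : pullback₂ IP IM Q.proj (k + k').1 x =
    pullback₂ IP IM Q.proj k.1 x + pullback₂ IP IM Q.proj k'.1 x := rfl
  have hA' : A.1 + (a + a').1 = A'.1 + a'.1 := by rw [hA, add_assoc]; rfl
  simp only [symShift]
  rw [h, hA', ← hA]
  abel

end Shift

/-- A `2`-tensor is the sum of its alternating and its symmetric part. -/
theorem exists_alternating_add_symmetric (β : tensors₂ IM ET (univ : Set M)) :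
    ∃ (b : forms₂ IM ET (univ : Set M)) (k : symTensors₂ IM ET (univ : Set M)),
      b.1 + k.1 = β.1 := by
  have hβ : ∀ x, SmoothAt₂ IM β.1 x := fun x =>
    smoothAt_of_mem_tensors₂ isOpen_univ β (mem_univ x)
  obtain ⟨b, hb⟩ := exists_mem_tensors₂ (I := IM) isOpen_univ
    (a := fun x => (2⁻¹ : ℝ) • (β.1 x - (β.1 x).flip)) fun x _ =>
      isSmoothness₂.smul (f := fun x => β.1 x - (β.1 x).flip) contMDiffAt_const
        (isSmoothness₂.sub (hβ x) (hβ x).flip)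
  refine ⟨⟨b.1, b.2, fun x u v => ?_⟩, ⟨β.1 - b.1, sub_mem β.2 b.2, fun x u v => ?_⟩,
    add_sub_cancel _ _⟩
  · rw [hb x (mem_univ x)]
    simp only [smul_apply, sub_apply, ContinuousLinearMap.flip_apply]
    module
  · simp only [Pi.sub_apply, sub_apply]
    rw [hb x (mem_univ x)]
    simp only [smul_apply, sub_apply, ContinuousLinearMap.flip_apply]
    module

theorem alternating_add_symmetric_injective {b b' : forms₂ IM ET (univ : Set M)}
    {k k' : symTensors₂ IM ET (univ : Set M)} (h : b.1 + k.1 = b'.1 + k'.1) : b = b' ∧ k = k' := by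
  have hb : b = b' := by
    refine Subtype.ext (funext fun x => ContinuousLinearMap.ext fun u =>
      ContinuousLinearMap.ext fun v => ?_)
    have h₁ : b.1 x u v + k.1 x u v = b'.1 x u v + k'.1 x u v :=
      DFunLike.congr_fun (DFunLike.congr_fun (congrFun h x) u) v
    have h₂ : b.1 x v u + k.1 x v u = b'.1 x v u + k'.1 x v u :=
      DFunLike.congr_fun (DFunLike.congr_fun (congrFun h x) v) u
    rw [b.2.2 x v u, b'.2.2 x v u, k.2.2 x v u, k'.2.2 x v u] at h₂
    linear_combination (norm := module) (2⁻¹ : ℝ) • h₁ - (2⁻¹ : ℝ) • h₂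
  subst hb
  exact ⟨rfl, Subtype.ext (add_left_cancel h)⟩

variable [FiniteDimensional ℝ EM] [T2Space M] [SigmaCompactSpace M]

/-- Connections with a given connective structure form a torsor for the central extension. -/
theorem TwoConnection.exists_torsor [FiniteDimensional ℝ EP] [T2Space P] [SigmaCompactSpace P]
    [Group (AdExtension ET 𝒳.toBundle)]
    (hmul : IsAdExtensionProduct mc.pairing (fun x y : AdExtension ET 𝒳.toBundle => x * y))
    (hone : (1 : AdExtension ET 𝒳.toBundle) = ⟨0, 0⟩) :
    ∃ act : TwoConnection S mc → AdExtension ET 𝒳.toBundle → TwoConnection S mc,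
      IsRightTorsor act ∧ ∀ c γ, (act c γ).A.1 = c.A.1 + γ.a.1 ∧
        ∀ r, ∀ x ∈ 𝒳.cover.V₀ r,
          ((act c γ).B r).1 x = (c.B r).1 x + adShift mc.pairing c.A γ x := by
  refine IsRightTorsor.of_relation (R := fun (c : TwoConnection S mc)
    (γ : AdExtension ET 𝒳.toBundle) (c' : TwoConnection S mc) => c'.A.1 = c.A.1 + γ.a.1 ∧
      ∀ r, ∀ x ∈ 𝒳.cover.V₀ r, (c'.B r).1 x = (c.B r).1 x + adShift mc.pairing c.A γ x)
    ?_ (fun c γ => ?_) (fun {c γ c₁ c₂} h₁ h₂ => ?_) (fun c => ?_) (fun {c γ c₁ γ' c₂} h₁ h₂ => ?_)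
    (fun c c' => ?_) (fun {c γ γ' c'} h h' => ?_)
  · obtain ⟨A⟩ := 𝒳.toBundle.nonempty_connection
    obtain ⟨c, -⟩ := exists_twoConnection_over S mc A
    exact ⟨c⟩
  · obtain ⟨c', hA, hB⟩ := c.exists_translate (c.A.add γ.a) (smoothAltAt_adShift c.A γ)
      (adShift_act mc.symm mc.adInvariant c.A γ)
    exact ⟨c', by rw [hA]; rfl, hB⟩
  · exact TwoConnection.ext_on (Subtype.ext (h₁.1.trans h₂.1.symm)) fun r x hx =>
      (h₁.2 r x hx).trans (h₂.2 r x hx).symm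
  · refine ⟨?_, fun r x _ => by rw [adShift_one hone, add_zero]⟩
    rw [hone]
    exact (add_zero _).symm
  · refine ⟨?_, fun r x hx => ?_⟩
    · rw [h₂.1, h₁.1, (hmul γ γ').1, add_assoc]
      rfl
    · rw [h₂.2 r x hx, h₁.2 r x hx, adShift_mul hmul c.A c₁.A γ γ' h₁.1, add_assoc]
  · obtain ⟨b, hb, hact, hB⟩ := c.exists_difference c'
    set a : 𝒳.toBundle.adForms := ⟨c'.A.1 - c.A.1, c.A.sub_mem_adForms c'.A⟩ with ha
    have hadd : c.A.add a = c'.A := Subtype.ext (add_sub_cancel _ _)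
    -- what remains of the difference after subtracting `⟨A ∧ a⟩` is basic
    obtain ⟨β, hβ⟩ := PrincipalBundle.descend_forms₂ (Q := 𝒳.toBundle)
      (b := fun x => b x - adShift mc.pairing c.A ⟨a, 0⟩ x)
      (fun p => isSmoothnessAlt.sub (hb p) (smoothAltAt_adShift c.A ⟨a, 0⟩ p)) fun z => by
        have h := adShift_act mc.symm mc.adInvariant c.A ⟨a, 0⟩ z
        rw [hadd, ← hact] at h
        have hf : ∀ f : P × G → P, pullback₂ (IP.prod IG) IP f
            (fun x => b x - adShift mc.pairing c.A ⟨a, 0⟩ x) z =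
            pullback₂ (IP.prod IG) IP f b z -
            pullback₂ (IP.prod IG) IP f (adShift mc.pairing c.A ⟨a, 0⟩) z := fun f => rfl
        rw [hf, hf]
        linear_combination (norm := module) -h
    refine ⟨⟨a, β⟩, (add_sub_cancel _ _).symm, fun r x hx => ?_⟩
    rw [hB r x hx, adShift_mk, hβ]
    abel
  · have ha : γ.a = γ'.a := Subtype.ext (add_left_cancel (h.1.symm.trans h'.1))
    refine AdExtension.eq_of ha fun p => ?_
    obtain ⟨r, hr⟩ := 𝒳.cover.cover₀.covers p
    have h₁ := add_left_cancel ((h.2 r p hr).symm.trans (h'.2 r p hr))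
    simp only [adShift] at h₁
    rw [ha] at h₁
    exact add_left_cancel h₁

/-- For fixed `A` the difference of two curvings is basic, so it descends to a `2`-form on `M`. -/
theorem TwoConnectionOver.exists_torsor [FiniteDimensional ℝ EP] [T2Space P] [SigmaCompactSpace P]
    (A : 𝒳.toBundle.Connection) :
    ∃ act : TwoConnectionOver S mc A → forms₂ IM ET (univ : Set M) → TwoConnectionOver S mc A,
      IsAdditiveTorsor act ∧ ∀ c b r, ∀ x ∈ 𝒳.cover.V₀ r,
        ((act c b).1.B r).1 x = (c.1.B r).1 x + pullback₂ IP IM 𝒳.toBundle.proj b.1 x := by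
  refine IsAdditiveTorsor.of_relation (R := fun (c : TwoConnectionOver S mc A)
    (b : forms₂ IM ET (univ : Set M)) (c' : TwoConnectionOver S mc A) =>
      ∀ r, ∀ x ∈ 𝒳.cover.V₀ r,
        (c'.1.B r).1 x = (c.1.B r).1 x + pullback₂ IP IM 𝒳.toBundle.proj b.1 x)
    ?_ (fun c b => ?_) (fun {c γ c₁ c₂} h₁ h₂ => ?_) (fun c r x _ => ?_)
    (fun {c b c₁ b' c₂} h₁ h₂ r x hx => ?_) (fun c c' => ?_) (fun {c b b' c'} h h' => ?_)
  · obtain ⟨c, hc⟩ := exists_twoConnection_over S mc A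
    exact ⟨⟨c, hc⟩⟩
  · obtain ⟨c', hA, hB⟩ := c.1.exists_translate c.1.A
      (fun p => (smoothAltAt_of_mem_forms₂ isOpen_univ b (mem_univ _)).pullback
        (𝒳.toBundle.smooth_proj p)) fun z => by
        rw [𝒳.toBundle.pullback₂_act_proj, sub_self, sub_self]
    exact ⟨⟨c', hA.trans c.2⟩, hB⟩
  · exact Subtype.ext (TwoConnection.ext_on (c₁.2.trans c₂.2.symm) fun r x hx =>
      (h₁ r x hx).trans (h₂ r x hx).symm)
  · exact (add_zero _).symm
  · rw [h₂ r x hx, h₁ r x hx, add_assoc]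
    rfl
  · obtain ⟨b, hb, hact, hB⟩ := c.1.exists_difference c'.1
    obtain ⟨β, hβ⟩ := PrincipalBundle.descend_forms₂ (Q := 𝒳.toBundle) hb fun z => by
      rw [← sub_eq_zero, hact, c.2, c'.2, sub_self]
    exact ⟨β, fun r x hx => by rw [hB r x hx, hβ]⟩
  · refine Subtype.ext (𝒳.toBundle.pullback₂_proj_injective fun p => ?_)
    obtain ⟨r, hr⟩ := 𝒳.cover.cover₀.covers p
    exact add_left_cancel ((h r p hr).symm.trans (h' r p hr))

/-- The difference of two enhanced connections is, up to the prescribed shift, the pullback of a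
`2`-tensor on `M`, whose alternating and symmetric parts are the components in `Ω²(M, 𝔱)` and in
`Γ(S²T*M ⊗ 𝔱)`. -/
theorem EnhancedConnection.exists_torsor [FiniteDimensional ℝ EP] [T2Space P]
    [SigmaCompactSpace P] [Group (AdExtension ET 𝒳.toBundle)]
    (hmul : IsAdExtensionProduct mc.pairing (fun x y : AdExtension ET 𝒳.toBundle => x * y))
    (hone : (1 : AdExtension ET 𝒳.toBundle) = ⟨0, 0⟩) :
    ∃ act : EnhancedConnection S mc →
        AdExtension ET 𝒳.toBundle × Multiplicative (symTensors₂ IM ET (univ : Set M)) →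
        EnhancedConnection S mc,
      IsRightTorsor act ∧ ∀ c γ, (act c γ).A.1 = c.A.1 + γ.1.a.1 ∧
        ∀ r, ∀ x ∈ 𝒳.cover.V₀ r, ((act c γ).B r).1 x = (c.B r).1 x +
          (adShift mc.pairing c.A γ.1 x + symShift mc.pairing c.A γ.1.a γ.2.toAdd x) := by
  refine IsRightTorsor.of_relation (R := fun (c : EnhancedConnection S mc)
    (γ : AdExtension ET 𝒳.toBundle × Multiplicative (symTensors₂ IM ET (univ : Set M)))
    (c' : EnhancedConnection S mc) => c'.A.1 = c.A.1 + γ.1.a.1 ∧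
      ∀ r, ∀ x ∈ 𝒳.cover.V₀ r, (c'.B r).1 x = (c.B r).1 x +
        (adShift mc.pairing c.A γ.1 x + symShift mc.pairing c.A γ.1.a γ.2.toAdd x))
    ?_ (fun c γ => ?_) (fun {c γ c₁ c₂} h₁ h₂ => ?_) (fun c => ?_) (fun {c γ c₁ γ' c₂} h₁ h₂ => ?_)
    (fun c c' => ?_) (fun {c γ γ' c'} h h' => ?_)
  · obtain ⟨A⟩ := 𝒳.toBundle.nonempty_connection
    obtain ⟨c, -⟩ := exists_twoConnection_over S mc A
    obtain ⟨c', -⟩ := EnhancedConnection.exists_of_twoConnection c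
    exact ⟨c'⟩
  · obtain ⟨c', hA, hB⟩ := c.exists_translate (c.A.add γ.1.a)
      (fun p => isSmoothness₂.add (smoothAltAt_adShift c.A γ.1 p).1
        (smoothAt₂_symShift c.A γ.1.a γ.2.toAdd p))
      (symShift_act mc.symm mc.adInvariant c.A γ.1 γ.2.toAdd)
    exact ⟨c', by rw [hA]; rfl, hB⟩
  · exact EnhancedConnection.ext_on (Subtype.ext (h₁.1.trans h₂.1.symm)) fun r x hx =>
      (h₁.2 r x hx).trans (h₂.2 r x hx).symm
  · have ha : (1 : AdExtension ET 𝒳.toBundle).a = 0 := by rw [hone]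
    refine ⟨?_, fun r x _ => ?_⟩
    · rw [Prod.fst_one, ha]
      exact (add_zero _).symm
    · rw [Prod.fst_one, Prod.snd_one, toAdd_one, adShift_one hone, symShift_zero _ _ ha, add_zero,
        add_zero]
  · have ha : (γ.1 * γ'.1).a = γ.1.a + γ'.1.a := (hmul γ.1 γ'.1).1
    refine ⟨?_, fun r x hx => ?_⟩
    · rw [h₂.1, h₁.1, Prod.fst_mul, ha, add_assoc]
      rfl
    · rw [h₂.2 r x hx, h₁.2 r x hx, Prod.fst_mul, Prod.snd_mul, toAdd_mul, ha,
        adShift_mul hmul c.A c₁.A γ.1 γ'.1 h₁.1, symShift_add c.A c₁.A γ.1.a γ'.1.a h₁.1]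
      abel
  · obtain ⟨b, hb, hact, hB⟩ := c.exists_difference c'
    set a : 𝒳.toBundle.adForms := ⟨c'.A.1 - c.A.1, c.A.sub_mem_adForms c'.A⟩ with ha
    have hadd : c.A.add a = c'.A := Subtype.ext (add_sub_cancel _ _)
    -- what remains of the difference after subtracting the shift for `b = 0`, `k = 0` is basic
    obtain ⟨β, hβ⟩ := PrincipalBundle.descend_tensors₂ (Q := 𝒳.toBundle)
      (b := fun x => b x - (adShift mc.pairing c.A ⟨a, 0⟩ x + symShift mc.pairing c.A a 0 x))
      (fun p => isSmoothness₂.sub (hb p) (isSmoothness₂.add (smoothAltAt_adShift c.A ⟨a, 0⟩ p).1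
        (smoothAt₂_symShift c.A a 0 p))) fun z => by
        have h := symShift_act mc.symm mc.adInvariant c.A ⟨a, 0⟩ 0 z
        rw [hadd, ← hact] at h
        have hf : ∀ f : P × G → P, pullback₂ (IP.prod IG) IP f (fun x => b x -
              (adShift mc.pairing c.A ⟨a, 0⟩ x + symShift mc.pairing c.A a 0 x)) z =
            pullback₂ (IP.prod IG) IP f b z - pullback₂ (IP.prod IG) IP f (fun x =>
              adShift mc.pairing c.A ⟨a, 0⟩ x + symShift mc.pairing c.A a 0 x) z := fun f => rfl
        rw [hf, hf]
        linear_combination (norm := module) -h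
    obtain ⟨α, k, hαk⟩ := exists_alternating_add_symmetric β
    refine ⟨(⟨a, α⟩, Multiplicative.ofAdd k), (add_sub_cancel _ _).symm, fun r x hx => ?_⟩
    have h := hβ x
    rw [← hαk, 𝒳.toBundle.pullback₂_proj_add] at h
    simp only [toAdd_ofAdd]
    rw [hB r x hx, adShift_mk, symShift_eq]
    linear_combination (norm := module) -h
  · have ha : γ.1.a = γ'.1.a := Subtype.ext (add_left_cancel (h.1.symm.trans h'.1))
    obtain ⟨⟨a, b⟩, k⟩ := γ
    obtain ⟨⟨a', b'⟩, k'⟩ := γ'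
    obtain rfl : a = a' := ha
    obtain ⟨rfl, hk⟩ := alternating_add_symmetric_injective (b := b) (b' := b')
      (k := k.toAdd) (k' := k'.toAdd) (𝒳.toBundle.pullback₂_proj_injective fun p => by
        obtain ⟨r, hr⟩ := 𝒳.cover.cover₀.covers p
        have h₁ := add_left_cancel ((h.2 r p hr).symm.trans (h'.2 r p hr))
        rw [adShift_mk, symShift_eq, adShift_mk c.A a b', symShift_eq c.A a k'.toAdd] at h₁
        rw [𝒳.toBundle.pullback₂_proj_add, 𝒳.toBundle.pullback₂_proj_add]
        linear_combination (norm := module) h₁)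
    rw [Multiplicative.toAdd.injective hk]

/-- For fixed `A` the difference of two enhanced curvings is the pullback of a `2`-tensor on `M`. -/
theorem EnhancedConnectionOver.exists_torsor [FiniteDimensional ℝ EP] [T2Space P]
    [SigmaCompactSpace P] (A : 𝒳.toBundle.Connection) :
    ∃ act : EnhancedConnectionOver S mc A → tensors₂ IM ET (univ : Set M) →
        EnhancedConnectionOver S mc A,
      IsAdditiveTorsor act ∧ ∀ c b r, ∀ x ∈ 𝒳.cover.V₀ r,
        ((act c b).1.B r).1 x = (c.1.B r).1 x + pullback₂ IP IM 𝒳.toBundle.proj b.1 x := by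
  refine IsAdditiveTorsor.of_relation (R := fun (c : EnhancedConnectionOver S mc A)
    (b : tensors₂ IM ET (univ : Set M)) (c' : EnhancedConnectionOver S mc A) =>
      ∀ r, ∀ x ∈ 𝒳.cover.V₀ r,
        (c'.1.B r).1 x = (c.1.B r).1 x + pullback₂ IP IM 𝒳.toBundle.proj b.1 x)
    ?_ (fun c b => ?_) (fun {c γ c₁ c₂} h₁ h₂ => ?_) (fun c r x _ => ?_)
    (fun {c b c₁ b' c₂} h₁ h₂ r x hx => ?_) (fun c c' => ?_) (fun {c b b' c'} h h' => ?_)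
  · obtain ⟨c, hc⟩ := exists_twoConnection_over S mc A
    obtain ⟨c', hc'⟩ := EnhancedConnection.exists_of_twoConnection c
    exact ⟨⟨c', hc'.trans hc⟩⟩
  · obtain ⟨c', hA, hB⟩ := c.1.exists_translate c.1.A
      (fun p => (smoothAt_of_mem_tensors₂ isOpen_univ b (mem_univ _)).pullback
        (𝒳.toBundle.smooth_proj p)) fun z => by
        rw [𝒳.toBundle.pullback₂_act_proj, sub_self, sub_self]
    exact ⟨⟨c', hA.trans c.2⟩, hB⟩
  · exact Subtype.ext (EnhancedConnection.ext_on (c₁.2.trans c₂.2.symm) fun r x hx =>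
      (h₁ r x hx).trans (h₂ r x hx).symm)
  · exact (add_zero _).symm
  · rw [h₂ r x hx, h₁ r x hx, add_assoc]
    rfl
  · obtain ⟨b, hb, hact, hB⟩ := c.1.exists_difference c'.1
    obtain ⟨β, hβ⟩ := PrincipalBundle.descend_tensors₂ (Q := 𝒳.toBundle) hb fun z => by
      rw [← sub_eq_zero, hact, c.2, c'.2, sub_self]
    exact ⟨β, fun r x hx => by rw [hB r x hx, hβ]⟩
  · refine Subtype.ext (𝒳.toBundle.pullback₂_proj_injective fun p => ?_)
    obtain ⟨r, hr⟩ := 𝒳.cover.cover₀.covers p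
    exact add_left_cancel ((h r p hr).symm.trans (h' r p hr))

/-- The `2`-forms on `M` are central in the extension. -/
theorem IsAdExtensionProduct.central {κ : EG →L[ℝ] EG →L[ℝ] ET}
    {Q : PrincipalBundle IM IP IG M P G}
    {mul : AdExtension ET Q → AdExtension ET Q → AdExtension ET Q}
    (hmul : IsAdExtensionProduct κ mul) (b : forms₂ IM ET (univ : Set M))
    (x : AdExtension ET Q) : mul ⟨0, b⟩ x = mul x ⟨0, b⟩ := by
  obtain ⟨ha, hb⟩ := hmul ⟨0, b⟩ x
  obtain ⟨ha', hb'⟩ := hmul x ⟨0, b⟩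
  refine AdExtension.eq_of (by rw [ha, ha', add_comm]) fun p => ?_
  rw [hb, hb']
  refine ContinuousLinearMap.ext fun u => ContinuousLinearMap.ext fun v => ?_
  have h₁ : pairWedge κ (0 : P → EP →L[ℝ] EG) x.a.1.1 p u v = 0 := by
    rw [pairWedge_apply]; simp
  have h₂ : pairWedge κ x.a.1.1 (0 : P → EP →L[ℝ] EG) p u v = 0 := by
    rw [pairWedge_apply]; simp
  change pullback₂ IP IM Q.proj b.1 p u v + pullback₂ IP IM Q.proj x.b.1 p u v +
      pairWedge κ (0 : P → EP →L[ℝ] EG) x.a.1.1 p u v =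
    pullback₂ IP IM Q.proj x.b.1 p u v + pullback₂ IP IM Q.proj b.1 p u v +
      pairWedge κ x.a.1.1 (0 : P → EP →L[ℝ] EG) p u v
  rw [h₁, h₂, add_comm (pullback₂ IP IM Q.proj b.1 p u v)]

end Torsors

end

end HigherGauge

/-! ### Existence of connective structures and the torsors of connections -/

theorem mainTheorem10
    {EM HM EP HP EG HG ET HT : Type*}
    [NormedAddCommGroup EM] [NormedSpace ℝ EM] [FiniteDimensional ℝ EM] [TopologicalSpace HM]
    [NormedAddCommGroup EP] [NormedSpace ℝ EP] [FiniteDimensional ℝ EP] [TopologicalSpace HP]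
    [NormedAddCommGroup EG] [NormedSpace ℝ EG] [FiniteDimensional ℝ EG] [TopologicalSpace HG]
    [NormedAddCommGroup ET] [NormedSpace ℝ ET] [FiniteDimensional ℝ ET] [TopologicalSpace HT]
    {IM : ModelWithCorners ℝ EM HM} {IP : ModelWithCorners ℝ EP HP}
    {IG : ModelWithCorners ℝ EG HG} {IT : ModelWithCorners ℝ ET HT}
    [IM.Boundaryless] [IP.Boundaryless] [IG.Boundaryless] [IT.Boundaryless]
    {M P G T : Type*}
    [TopologicalSpace M] [ChartedSpace HM M] [IsManifold IM ∞ M]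
    [T2Space M] [SecondCountableTopology M]
    [TopologicalSpace P] [ChartedSpace HP P] [IsManifold IP ∞ P]
    [T2Space P] [SecondCountableTopology P]
    [TopologicalSpace G] [ChartedSpace HG G] [Group G] [LieGroup IG ∞ G]
    [T2Space G] [SecondCountableTopology G]
    [TopologicalSpace T] [ChartedSpace HT T] [CommGroup T] [LieGroup IT ∞ T]
    [T2Space T] [SecondCountableTopology T]
    (𝒢 : MultiplicativeGerbe IG IT G T) (D : MultConnectiveStructure 𝒢)
    (𝒳 : PrincipalTwoBundle IM IP M P 𝒢) :
    -- connective structures exist; any two are isomorphic, and the isomorphisms between them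
    -- form a torsor for `Ω¹(M, 𝔱)`, acting by `φ ↦ φ + π*τ`
    Nonempty (ConnectiveStructure 𝒳 D) ∧
    (∀ S₁ S₂ : ConnectiveStructure 𝒳 D,
      ∃ act : ConnectiveIso S₁ S₂ → forms₁ IM ET (Set.univ : Set M) → ConnectiveIso S₁ S₂,
        IsAdditiveTorsor act ∧
        ∀ (τ : forms₁ IM ET (Set.univ : Set M)) (φ : ConnectiveIso S₁ S₂) (r : 𝒳.cover.R₀),
          ∀ x ∈ 𝒳.cover.V₀ r,
            ((act φ τ).φ r).1 x = (φ.φ r).1 x + pullback₁ IP IM 𝒳.toBundle.proj τ.1 x) ∧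
    -- the Maurer-Cartan data of `𝒢` with its connective structure exist and are unique
    Nonempty (Unique (MaurerCartanData D)) ∧
    ∀ mc : MaurerCartanData D,
      -- the central extension of `Ω¹(ad P)` by `Ω²(M, 𝔱)`
      ∃ _ : Group (AdExtension ET 𝒳.toBundle),
        IsAdExtensionProduct mc.pairing (fun x y : AdExtension ET 𝒳.toBundle => x * y) ∧
        (∀ (b : forms₂ IM ET (Set.univ : Set M)) (x : AdExtension ET 𝒳.toBundle),
          ⟨0, b⟩ * x = x * ⟨0, b⟩) ∧
        ∀ S : ConnectiveStructure 𝒳 D,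
          -- connections form a right torsor
          (∃ act : TwoConnection S mc → AdExtension ET 𝒳.toBundle → TwoConnection S mc,
            IsRightTorsor act ∧
            ∀ (c : TwoConnection S mc) (γ : AdExtension ET 𝒳.toBundle),
              (act c γ).A.1 = c.A.1 + γ.a.1 ∧
              ∀ r, ∀ x ∈ 𝒳.cover.V₀ r,
                ((act c γ).B r).1 x = (c.B r).1 x +
                  pairWedge mc.pairing c.A.1.1 γ.a.1.1 x +
                  pullback₂ IP IM 𝒳.toBundle.proj γ.b.1 x) ∧
          -- over each `G`-connection they form an affine space for `Ω²(M, 𝔱)`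
          (∀ A : 𝒳.toBundle.Connection,
            ∃ act : TwoConnectionOver S mc A → forms₂ IM ET (Set.univ : Set M) →
                TwoConnectionOver S mc A,
              IsAdditiveTorsor act ∧
              ∀ (b : forms₂ IM ET (Set.univ : Set M)) (c : TwoConnectionOver S mc A) r,
                ∀ x ∈ 𝒳.cover.V₀ r,
                  ((act c b).1.B r).1 x =
                    (c.1.B r).1 x + pullback₂ IP IM 𝒳.toBundle.proj b.1 x) ∧
          -- enhanced connections form a right torsor
          (∃ act : EnhancedConnection S mc →
              AdExtension ET 𝒳.toBundle × Multiplicative (symTensors₂ IM ET (Set.univ : Set M)) →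
              EnhancedConnection S mc,
            IsRightTorsor act ∧
            ∀ (c : EnhancedConnection S mc) (γ : AdExtension ET 𝒳.toBundle)
              (k : symTensors₂ IM ET (Set.univ : Set M)),
              (act c (γ, Multiplicative.ofAdd k)).A.1 = c.A.1 + γ.a.1 ∧
              ∀ r, ∀ x ∈ 𝒳.cover.V₀ r,
                ((act c (γ, Multiplicative.ofAdd k)).B r).1 x = (c.B r).1 x +
                  (pairWedge mc.pairing c.A.1.1 γ.a.1.1 x +
                    pullback₂ IP IM 𝒳.toBundle.proj γ.b.1 x) +
                  (pairTensor mc.pairing c.A.1.1 c.A.1.1 x -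
                    pairTensor mc.pairing (c.A.1 + γ.a.1).1 (c.A.1 + γ.a.1).1 x +
                    pullback₂ IP IM 𝒳.toBundle.proj k.1 x)) ∧
          -- over each `G`-connection they form an affine space for `Γ(T*M ⊗ T*M ⊗ 𝔱)`
          (∀ A : 𝒳.toBundle.Connection,
            ∃ act : EnhancedConnectionOver S mc A → tensors₂ IM ET (Set.univ : Set M) →
                EnhancedConnectionOver S mc A,
              IsAdditiveTorsor act ∧
              ∀ (b : tensors₂ IM ET (Set.univ : Set M))
                (c : EnhancedConnectionOver S mc A) r,
                ∀ x ∈ 𝒳.cover.V₀ r,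
                  ((act c b).1.B r).1 x =
                    (c.1.B r).1 x + pullback₂ IP IM 𝒳.toBundle.proj b.1 x) := by
  -- Locally compact second countable spaces are σ-compact, as partitions of unity require.
  have : LocallyCompactSpace M := Manifold.locallyCompact_of_finiteDimensional IM
  have : LocallyCompactSpace P := Manifold.locallyCompact_of_finiteDimensional IP
  have : LocallyCompactSpace G := Manifold.locallyCompact_of_finiteDimensional IG
  refine ⟨nonempty_connectiveStructure D 𝒳, fun S₁ S₂ => exists_connectiveIso_torsor S₁ S₂,
    nonempty_unique_maurerCartanData D, fun mc => ?_⟩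
  obtain ⟨_, hmul, hone⟩ := exists_adExtension_group (Q := 𝒳.toBundle) mc.symm mc.adInvariant
  refine ⟨_, hmul, hmul.central, fun S => ⟨?_, fun A => ?_, ?_, fun A => ?_⟩⟩
  · obtain ⟨act, hact, h⟩ := TwoConnection.exists_torsor (S := S) hmul hone
    exact ⟨act, hact, fun c γ => ⟨(h c γ).1, fun r x hx => ((h c γ).2 r x hx).trans
      (add_assoc _ _ _).symm⟩⟩
  · obtain ⟨act, hact, h⟩ := TwoConnectionOver.exists_torsor (S := S) (mc := mc) A
    exact ⟨act, hact, fun b c => h c b⟩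
  · obtain ⟨act, hact, h⟩ := EnhancedConnection.exists_torsor (S := S) hmul hone
    exact ⟨act, hact, fun c γ k => ⟨(h c _).1, fun r x hx => ((h c _).2 r x hx).trans
      (add_assoc _ _ _).symm⟩⟩
  · obtain ⟨act, hact, h⟩ := EnhancedConnectionOver.exists_torsor (S := S) (mc := mc) A
    exact ⟨act, hact, fun b c => h c b⟩
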